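/- Let $k$ be a commutative ring with unit and let $s\ge 0$ be an integer; unadorned tensor products are over $k$. **Conventions.** An $A_\infty$-algebra over a commutative ring $R$ is a graded $R$-module $A$ with $R$-linear maps $m_n:A^{\otimes_R n}\to A$ of degree $2-n$ ($n\ge 1$) such that $\sum_{r+t+u=n,\,t\ge 1}(-1)^{r+tu}\,m_{r+1+u}(\mathrm{id}^{\otimes r}\otimes m_t\otimes \mathrm{id}^{\otimes u})=0$ for all $n\ge 1$. A morphism $f_\bullet:A\to B$ is a family of $R$-linear maps $f_n:A^{\otimes_R n}\to B$ of degree $1-n$ such that, for all $n\ge1$, $$\sum_{r+t+u=n,\,t\ge1}(-1)^{r+tu} f_{r+1+u}(\mathrm{id}^{\otimes r}\otimes m^A_t\otimes \mathrm{id}^{\otimes u})=\sum_{q\ge1}\ \sum_{i_1+\dots+i_q=n}(-1)^{\sum_j (q-j)(i_j-1)}\, m^B_q(f_{i_1}\otimes\dots\otimes f_{i_q}),$$ with the Koszul sign rule; it is a quasi-isomorphism if $f_1:(A,m_1^A)\to(B,m_1^B)$ induces an isomorphism in cohomology. A strict unit is an element $1_A$ with $m_2(1_A,a)=a=m_2(a,1_A)$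 such that $m_n$, $n\neq2$, vanishes whenever an argument is $1_A$. A morphism is strictly unitary if $f_1(1_A)=1_B$ and $f_n$, $n\ge2$, vanishes whenever an argument is $1_A$. A compatible bigrading of $s$-th type is a bigrading $A=\bigoplus_{p,q\in\mathbb Z} A^{p,q}$ (by $k$-submodules, $A^{p,q}$ being of degree $p+q$) for which $m_n$ has bidegree $(2-n)(s,1-s)$, and $1_A\in A^{0,0}$ in the unitary case; a morphism is compatible with the bigradings if $f_n$ has bidegree $(1-n)(s,1-s)$. Give $\hbar$ bidegree $(-1,1)$. For a bigraded $k$-module $V$ put $V[[\hbar]]^{\mathrm{bgr}}=\bigoplus_{p,q}\prod_{r\ge0}V^{p+r,q-r}\hbar^r$, a bigraded $k[\hbar]$-module with canonical projection $V[[\hbar]]^{\mathrm{bgr}}\to V$, $\hbar\mapsto0$. Let $(A,m_\bullet)$ be an $A_\infty$-algebra over $k$ with a compatible bigrading of $s$-th type. A formal bigraded deformation $A_\hbar$ of $A$ is an $A_\infty$-algebra structure $\tilde m_\bullet$ over $k[\hbar]$ on $A[[\hbar]]^{\mathrm{bgr}}$, with compatible bigrading of $s$-th type, which reduces to $m_\bullet$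 under $\hbar\mapsto 0$; if $A$ is unitary, $1_A$ is also required to be a strict unit of $A_\hbar$. A morphism of formal bigraded deformations $A_\hbar\to B_\hbar$ is a pair $(f_\bullet,\tilde f_\bullet)$ of morphisms of $A_\infty$-algebras compatible with the bigradings, $f_\bullet:A\to B$ over $k$ and $\tilde f_\bullet:A_\hbar\to B_\hbar$ over $k[\hbar]$ (both strictly unitary in the unitary case), such that $\tilde f_\bullet$ reduces to $f_\bullet$ under $\hbar\mapsto0$; we say that $\tilde f_\bullet$ lifts $f_\bullet$. It is a quasi-isomorphism if $f_1$ and all reductions of $\tilde f_1$ modulo $\hbar^{N+1}$, $N\ge0$, as well as $\tilde f_1$ itself as a morphism of complexes over $k[\hbar]$, are quasi-isomorphisms. **Theorem.** Let $A$ be a (resp. unitary) $A_\infty$-algebra over $k$ with a compatible bigrading of $s$-th type whose cohomology $H(A)=\operatorname{Ker} m_1/\operatorname{Im} m_1$ is a projective $k$-module, and let $A_\hbar$ be a formal bigraded deformation of $A$. Let $H(A)$, with the induced bigrading, be equipped with a structure of (resp. unitary) $A_\infty$-algebra $\bar m_\bullet$ over $k$ with $\bar m_1=0$ for which this bigrading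 is compatible of $s$-th type, and let $f_\bullet:H(A)\to A$ be a quasi-isomorphism of (resp. strictly unitary) $A_\infty$-algebras compatible with the bigradings. (Every model of $A$ given by Kadeishvili's theorem that is compatible with the bigrading is of this kind.) Then: 1. there are a formal bigraded deformation $H(A)_\hbar$ of $(H(A),\bar m_\bullet)$ and a quasi-isomorphism of formal bigraded deformations $(f_\bullet,\tilde f_\bullet)$ from $H(A)_\hbar$ to $A_\hbar$ that lifts the given $f_\bullet$; 2. for every formal bigraded deformation $H(A)_\hbar$ of $(H(A),\bar m_\bullet)$, every morphism of formal bigraded deformations $(f_\bullet,\tilde f_\bullet)$ from $H(A)_\hbar$ to $A_\hbar$ that lifts $f_\bullet$ is a quasi-isomorphism; in particular $\tilde f_1$ is a quasi-isomorphism over $k[\hbar]$; 3. any two formal bigraded deformations $H(A)_\hbar$ and $H(A)'_\hbar$ of $(H(A),\bar m_\bullet)$ that admit such lifts $\tilde f_\bullet$ and $\tilde f'_\bullet$ of $f_\bullet$ are quasi-isomorphic: there is a quasi-isomorphism of formal bigraded deformations from $H(A)_\hbar$ to $H(A)'_\hbar$. -/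

import Mathlib

/-! # Bigraded `A_∞`-algebras, their cohomology and their formal bigraded deformations

Bigradings are indexed by `ℤ × ℤ`; the cohomological degree of an element of bidegree `(p, q)` is
`p + q`, and all Koszul signs are taken with respect to it.  A finite list `a_1, …, a_n` of elements
is written as the first `n` terms of a sequence `a : ℕ → V` (so `a_{i+1}` is `a i`). -/

namespace AInf

universe u v w

/-- The cohomological (total) degree of a bidegree. -/
def totalDeg (d : ℤ × ℤ) : ℤ := d.1 + d.2

/-- The sequence `a_1, …, a_r, x, a_{r+s+1}, a_{r+s+2}, …`: the `s ≥ 1` terms that follow the first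
`r` ones are replaced by the single term `x`. -/
def replaceBlock {V : Type*} (r s : ℕ) (a : ℕ → V) (x : V) : ℕ → V :=
  fun i => if i < r then a i else if i = r then x else a (i + s - 1)

/-- For `a_i` of bidegree `d_i`, the value on `a_1 ⊗ … ⊗ a_n` of
`∑_{r + s + t = n, s ≥ 1} (-1)^{r + s t} g_{r+1+t} ∘ (id^{⊗ r} ⊗ m_s ⊗ id^{⊗ t})`,
where `m_s` has degree `2 - s`.  Applying `m_s` behind `a_1, …, a_r` produces the Koszul sign
`(-1)^{(2 - s)(|a_1| + … + |a_r|)}`. -/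
def insertionSum {V : Type*} {W : Type*} [AddCommGroup W]
    (g : (n : ℕ) → (Fin n → V) → W) (m : (n : ℕ) → (Fin n → V) → V)
    (n : ℕ) (d : ℕ → ℤ × ℤ) (a : ℕ → V) : W :=
  ∑ r ∈ Finset.range n, ∑ s ∈ Finset.Icc 1 (n - r),
    Int.negOnePow ((r : ℤ) + (s : ℤ) * ((n - r - s : ℕ) : ℤ)
        + (2 - (s : ℤ)) * ∑ i ∈ Finset.range r, totalDeg (d i)) •
      g (r + 1 + (n - r - s))
        (fun i => replaceBlock r s a (m s (fun j => a (r + (j : ℕ)))) (i : ℕ))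

/-- For `a_i` of bidegree `d_i`, the value on `a_1 ⊗ … ⊗ a_n` of
`∑_q ∑_{i_1 + … + i_q = n} (-1)^w m_q ∘ (f_{i_1} ⊗ … ⊗ f_{i_q})`, `w = ∑_j (q - j) (i_j - 1)`,
where `f_i` has degree `1 - i`.  Applying `f_{i_1} ⊗ … ⊗ f_{i_q}` produces the Koszul sign whose
exponent is the sum over `j` of `1 - i_j` times the degree of all arguments of the earlier `f`'s. -/
def blockSum {V : Type*} {W : Type*} [AddCommGroup W]
    (f : (n : ℕ) → (Fin n → V) → W) (m : (n : ℕ) → (Fin n → W) → W)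
    (n : ℕ) (d : ℕ → ℤ × ℤ) (a : ℕ → V) : W :=
  ∑ c : Composition n,
    Int.negOnePow (∑ j : Fin c.length,
        (((c.length : ℤ) - 1 - (j : ℕ)) * ((c.blocksFun j : ℤ) - 1)
          + (1 - (c.blocksFun j : ℤ)) *
            ∑ i ∈ Finset.range (c.sizeUpTo (j : ℕ)), totalDeg (d i))) •
      m c.length
        (fun j => f (c.blocksFun j) (fun l => a (c.sizeUpTo (j : ℕ) + (l : ℕ))))

/-- An `A_∞`-algebra over the commutative ring `R` whose underlying `R`-module `V` carries a
bigrading `gr` by `k`-submodules, the bigrading being compatible of `s`-th type: `m_n` is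
homogeneous of bidegree `(2 - n)(s, 1 - s)`.  (For an algebra over `k` itself one takes `R = k`.)
The operations are `m_1, m_2, …`; there is no curvature term. -/
structure Algebra (k : Type u) (R : Type v) [CommRing k] [CommRing R] {V : Type w}
    [AddCommGroup V] [Module k V] [Module R V] (gr : ℤ × ℤ → Submodule k V) (s : ℕ) where
  m : (n : ℕ) → MultilinearMap R (fun _ : Fin n => V) V
  m_zero : m 0 = 0
  homogeneous : ∀ (n : ℕ) (d : Fin n → ℤ × ℤ) (a : Fin n → V), (∀ i, a i ∈ gr (d i)) →
    m n a ∈ gr (∑ i, d i + (2 - (n : ℤ)) • ((s : ℤ), 1 - (s : ℤ)))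
  stasheff : ∀ (n : ℕ) (d : ℕ → ℤ × ℤ) (a : ℕ → V), (∀ i, a i ∈ gr (d i)) →
    insertionSum (fun i => m i) (fun i => m i) n d a = 0

section general

variable {k : Type u} {R : Type v} [CommRing k] [CommRing R]
  {V : Type w} [AddCommGroup V] [Module k V] [Module R V] {gr : ℤ × ℤ → Submodule k V}
  {W : Type w} [AddCommGroup W] [Module k W] [Module R W] {gr' : ℤ × ℤ → Submodule k W}
  {s : ℕ}

/-- `e` is a strict unit of the `A_∞`-algebra `X`. -/
def Algebra.IsStrictUnit (X : Algebra k R gr s) (e : V) : Prop :=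
  (∀ a : V, X.m 2 ![e, a] = a) ∧ (∀ a : V, X.m 2 ![a, e] = a) ∧
    ∀ n : ℕ, n ≠ 2 → ∀ a : Fin n → V, (∃ i, a i = e) → X.m n a = 0

/-- The differential `m_1`. -/
def Algebra.d (X : Algebra k R gr s) : V →ₗ[R] V :=
  (MultilinearMap.ofSubsingleton R V V (0 : Fin 1)).symm (X.m 1)

/-- A morphism of `A_∞`-algebras over `R`, compatible with the bigradings: `f_n` is homogeneous of
bidegree `(1 - n)(s, 1 - s)`.  The components are `f_1, f_2, …`. -/
structure Hom (X : Algebra k R gr s) (Y : Algebra k R gr' s) where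
  f : (n : ℕ) → MultilinearMap R (fun _ : Fin n => V) W
  f_zero : f 0 = 0
  homogeneous : ∀ (n : ℕ) (d : Fin n → ℤ × ℤ) (a : Fin n → V), (∀ i, a i ∈ gr (d i)) →
    f n a ∈ gr' (∑ i, d i + (1 - (n : ℤ)) • ((s : ℤ), 1 - (s : ℤ)))
  stasheff : ∀ (n : ℕ) (d : ℕ → ℤ × ℤ) (a : ℕ → V), (∀ i, a i ∈ gr (d i)) →
    insertionSum (fun i => f i) (fun i => X.m i) n d a
      = blockSum (fun i => f i) (fun i => Y.m i) n d a

/-- The first component `f_1`. -/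
def Hom.linear {X : Algebra k R gr s} {Y : Algebra k R gr' s} (f : Hom X Y) : V →ₗ[R] W :=
  (MultilinearMap.ofSubsingleton R V W (0 : Fin 1)).symm (f.f 1)

/-- The morphism is strictly unitary with respect to the units `e` and `e'`. -/
def Hom.IsUnital {X : Algebra k R gr s} {Y : Algebra k R gr' s} (f : Hom X Y) (e : V) (e' : W) :
    Prop :=
  f.linear e = e' ∧ ∀ n : ℕ, 2 ≤ n → ∀ a : Fin n → V, (∃ i, a i = e) → f.f n a = 0

/-- The cohomology `Ker d / Im d`. -/
abbrev Cohomology (d : V →ₗ[R] V) : Type w :=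
  LinearMap.ker d ⧸ (LinearMap.range d).submoduleOf (LinearMap.ker d)

/-- The map induced in cohomology by a morphism of complexes. -/
def cohomologyMap (d : V →ₗ[R] V) (d' : W →ₗ[R] W) (φ : V →ₗ[R] W)
    (h : ∀ x, φ (d x) = d' (φ x)) : Cohomology d →ₗ[R] Cohomology d' :=
  Submodule.mapQ _ _
    (φ.restrict (p := LinearMap.ker d) (q := LinearMap.ker d') (fun x hx => by
      rw [LinearMap.mem_ker] at hx ⊢
      rw [← h x, hx, map_zero]))
    (by
      rintro ⟨x, hx⟩ ⟨y, hy⟩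
      exact ⟨φ y, by rw [← h y, hy]; rfl⟩)

/-- `φ` is a morphism of complexes that induces an isomorphism in cohomology. -/
def IsQuasiIsoMap (d : V →ₗ[R] V) (d' : W →ₗ[R] W) (φ : V →ₗ[R] W) : Prop :=
  ∃ h : ∀ x, φ (d x) = d' (φ x), Function.Bijective (cohomologyMap d d' φ h)

/-- A morphism of `A_∞`-algebras is a quasi-isomorphism if its first component is one. -/
def Hom.IsQuasiIso {X : Algebra k R gr s} {Y : Algebra k R gr' s} (f : Hom X Y) : Prop :=
  IsQuasiIsoMap X.d Y.d f.linear

/-- The bigrading induced on the cohomology of a complex of `k`-modules. -/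
def cohomologyGrading (gr : ℤ × ℤ → Submodule k V) (d : V →ₗ[k] V) :
    ℤ × ℤ → Submodule k (Cohomology d) :=
  fun p => ((gr p).submoduleOf (LinearMap.ker d)).map (Submodule.mkQ _)

end general

section completion

variable {k : Type u} [CommRing k] {V : Type w} [AddCommGroup V] [Module k V]

/-- The series `∑_r v_r ħ^r` that are homogeneous of bidegree `(p, q)`, where `ħ` has bidegree
`(-1, 1)`: the product over `r` of the components of bidegree `(p + r, q - r)`. -/
def homogeneousSeries (gr : ℤ × ℤ → Submodule k V) (d : ℤ × ℤ) : Submodule k (ℕ → V) :=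
  Submodule.pi Set.univ (fun r : ℕ => gr (d.1 + (r : ℤ), d.2 - (r : ℤ)))

/-- The finite sums of homogeneous series. -/
def seriesSubmodule (gr : ℤ × ℤ → Submodule k V) : Submodule k (ℕ → V) :=
  ⨆ d : ℤ × ℤ, homogeneousSeries gr d

/-- The bigraded completion `V[[ħ]]^bgr = ⨁_{p,q} ∏_r V^{p+r,q-r} ħ^r` of `V ⊗ k[ħ]`. -/
def BgrSeries (gr : ℤ × ℤ → Submodule k V) : Type w := ↥(seriesSubmodule gr)

instance (gr : ℤ × ℤ → Submodule k V) : AddCommGroup (BgrSeries gr) :=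
  inferInstanceAs (AddCommGroup ↥(seriesSubmodule gr))

instance (gr : ℤ × ℤ → Submodule k V) : Module k (BgrSeries gr) :=
  inferInstanceAs (Module k ↥(seriesSubmodule gr))

/-- Multiplication by `ħ` on sequences of coefficients. -/
def shift : (ℕ → V) →ₗ[k] (ℕ → V) where
  toFun v n := Nat.casesOn n 0 v
  map_add' v w := by funext n; cases n <;> simp
  map_smul' c v := by funext n; cases n <;> simp

theorem shift_mem (gr : ℤ × ℤ → Submodule k V) :
    ∀ x ∈ seriesSubmodule gr, (shift (k := k) x) ∈ seriesSubmodule gr := by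
  intro x hx
  have h : seriesSubmodule gr ≤ (seriesSubmodule gr).comap (shift (k := k)) := by
    refine iSup_le fun d v hv => ?_
    refine (le_iSup (homogeneousSeries gr) (d.1 - 1, d.2 + 1)) ?_
    rw [homogeneousSeries, Submodule.mem_pi] at hv ⊢
    rintro (_ | r) -
    · exact Submodule.zero_mem _
    · have := hv r (Set.mem_univ r)
      have e : (d.1 - 1 + ((r + 1 : ℕ) : ℤ), d.2 + 1 - ((r + 1 : ℕ) : ℤ))
          = (d.1 + (r : ℤ), d.2 - (r : ℤ)) := by
        ext <;> push_cast <;> ring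
      change v r ∈ gr (d.1 - 1 + ((r + 1 : ℕ) : ℤ), d.2 + 1 - ((r + 1 : ℕ) : ℤ))
      rw [e]
      exact this
  exact h hx

/-- Multiplication by `ħ` on `V[[ħ]]^bgr`. -/
def mulHbar (gr : ℤ × ℤ → Submodule k V) : Module.End k (BgrSeries gr) :=
  (shift (k := k)).restrict (shift_mem gr)

/-- `V[[ħ]]^bgr` as a module over `k[ħ]`; the polynomial variable acts as `ħ`. -/
noncomputable instance (gr : ℤ × ℤ → Submodule k V) : Module (Polynomial k) (BgrSeries gr) :=
  Module.compHom (BgrSeries gr) (Polynomial.aeval (R := k) (mulHbar gr)).toRingHom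

/-- The bigrading of `V[[ħ]]^bgr`. -/
def seriesGrading (gr : ℤ × ℤ → Submodule k V) : ℤ × ℤ → Submodule k (BgrSeries gr) :=
  fun d => (homogeneousSeries gr d).submoduleOf (seriesSubmodule gr)

/-- The canonical projection `V[[ħ]]^bgr → V`, `ħ ↦ 0`. -/
def constCoeff (gr : ℤ × ℤ → Submodule k V) : BgrSeries gr →ₗ[k] V :=
  (LinearMap.proj 0).comp (seriesSubmodule gr).subtype

/-- The homogeneous element `v = v ⊗ 1` of `V`, seen in `V[[ħ]]^bgr`. -/
def constSeries {gr : ℤ × ℤ → Submodule k V} {d : ℤ × ℤ} (v : gr d) : BgrSeries gr :=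
  ⟨Pi.single 0 (v : V), by
    refine (le_iSup (homogeneousSeries gr) d) ?_
    rw [homogeneousSeries, Submodule.mem_pi]
    rintro (_ | r) -
    · simp
    · simp⟩

/-- The ideal `(ħ^{N+1})` applied to a `k[ħ]`-module. -/
noncomputable abbrev hbarPow (k : Type u) [CommRing k] (N : ℕ) (M : Type w) [AddCommGroup M]
    [Module (Polynomial k) M] : Submodule (Polynomial k) M :=
  Ideal.span {(Polynomial.X : Polynomial k) ^ (N + 1)} • (⊤ : Submodule (Polynomial k) M)

/-- The reduction `φ ⊗ k[ħ]/(ħ^{N+1})` of a `k[ħ]`-linear map. -/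
noncomputable def reduction {M M' : Type w} [AddCommGroup M] [AddCommGroup M'] [Module (Polynomial k) M]
    [Module (Polynomial k) M'] (N : ℕ) (φ : M →ₗ[Polynomial k] M') :
    (M ⧸ hbarPow k N M) →ₗ[Polynomial k] (M' ⧸ hbarPow k N M') :=
  Submodule.mapQ _ _ φ (Submodule.smul_top_le_comap_smul_top _ φ)

end completion

section deformation

variable {k : Type u} [CommRing k]
  {V : Type w} [AddCommGroup V] [Module k V] {gr : ℤ × ℤ → Submodule k V}
  {W : Type w} [AddCommGroup W] [Module k W] {gr' : ℤ × ℤ → Submodule k W}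
  {s : ℕ}

/-- A formal bigraded deformation of `X`: a structure of `A_∞`-algebra over `k[ħ]` with compatible
bigrading of `s`-th type on `V[[ħ]]^bgr` that reduces to `X` modulo `ħ`. -/
structure FormalDeformation (X : Algebra k k gr s) where
  alg : Algebra k (Polynomial k) (seriesGrading gr) s
  reduces : ∀ (n : ℕ) (a : Fin n → BgrSeries gr),
    constCoeff gr (alg.m n a) = X.m n (fun i => constCoeff gr (a i))

/-- The deformation preserves the strict unit `e` of `X`. -/
def FormalDeformation.PreservesUnit {X : Algebra k k gr s} (D : FormalDeformation X)
    (e : gr (0, 0)) : Prop :=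
  D.alg.IsStrictUnit (constSeries e)

/-- A morphism of formal bigraded deformations: a morphism `base` of `A_∞`-algebras over `k` and a
morphism `lift` of `A_∞`-algebras over `k[ħ]`, both compatible with the bigradings, such that `lift`
followed by the canonical projection is `base` preceded by the canonical projections. -/
structure DeformationHom {X : Algebra k k gr s} {Y : Algebra k k gr' s}
    (D : FormalDeformation X) (E : FormalDeformation Y) where
  base : Hom X Y
  lift : Hom D.alg E.alg
  reduces : ∀ (n : ℕ) (a : Fin n → BgrSeries gr),
    constCoeff gr' (lift.f n a) = base.f n (fun i => constCoeff gr (a i))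

/-- Both parts of the morphism are strictly unitary. -/
def DeformationHom.IsUnital {X : Algebra k k gr s} {Y : Algebra k k gr' s}
    {D : FormalDeformation X} {E : FormalDeformation Y} (F : DeformationHom D E)
    (e : gr (0, 0)) (e' : gr' (0, 0)) : Prop :=
  F.base.IsUnital (e : V) (e' : W) ∧ F.lift.IsUnital (constSeries e) (constSeries e')

/-- A quasi-isomorphism of formal bigraded deformations: `base`, every reduction of `lift` modulo
`ħ^{N+1}`, and `lift` itself, over `k[ħ]`, are quasi-isomorphisms. -/
def DeformationHom.IsQuasiIso {X : Algebra k k gr s} {Y : Algebra k k gr' s}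
    {D : FormalDeformation X} {E : FormalDeformation Y} (F : DeformationHom D E) : Prop :=
  F.base.IsQuasiIso ∧
    (∀ N : ℕ, IsQuasiIsoMap (reduction N D.alg.d) (reduction N E.alg.d)
      (reduction N F.lift.linear)) ∧
    F.lift.IsQuasiIso

end deformation

end AInf

/-! After suspension, a family of operations is the component of a coderivation of the tensor
coalgebra and a morphism is the component of a coalgebra map, so that everything becomes a function
on lists: the equations read `coder (-e) b b = 0` and `pull f m = coder (-e) b f`. The signs of the
definitions are absorbed once and for all by `coder_twist_eq_insertionSum` and
`pull_twist_eq_blockSum`. Calculations take place in an associative ring. A multilinear function on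
lists factors through products in some algebra (`exists_universal`); functions on lists with values
in that algebra form a ring under convolution; there the coalgebra map with component `f` becomes
`geom f`, the inverse of `1 - f`, and the coderivation along `(p, f)` with component `η` becomes
`geom p * η * geom f`.

Existence. The unknowns are operations `B` on the series over `H(A)` and components `C` of a lift,
both prescribed modulo `ħ`; the defect is `E = pull C m - coder B C`, where `m` is the structure of
the deformation of `A`. The induction runs over the weight, the exponent of `ħ` plus the length of
the list. A change of `B` and `C` in weight `w + 1` changes the part of `E` in that weight by `m₁ ΔC
- f₁ ΔB` alone: every other term either evaluates on a shorter list or contains the linear part of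
`B`, which is divisible by `ħ` because `H(A)` is minimal. The Bianchi identity says that, in leading
order, `m₁ E + f₁ (B ∘ B) = 0`. Since `f₁` is injective on cohomology and the differential of `H(A)`
is zero, an equation `f₁ x + m₁ y = 0` forces `x = 0`. Hence the leading part of `E` is a cocycle,
and `B ∘ B` vanishes one order further (`AdmissibleOp.div_square_and_closed`). Since `f₁` is
surjective on cohomology, a cocycle has the form `f₁ x - m₁ y`; projectivity of `H(A)` makes the
choice of `x` and `y` multilinear in the arguments, and the bigrading makes it homogeneous
(`exists_graded_lift`). Correcting weight by weight converges (`Solvable.exists_solution`), and the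
Stasheff identities of `B` come for free.

Uniqueness is the same scheme with other unknowns: a morphism `B` that deforms the identity of
`H(A)`, and a homotopy `C` between one lift and the composition of the other with `B`. The defect of
`B` as a morphism plays the role of `B ∘ B` (`homotopy_coder`,
`AdmissibleHomotopy.div_defect_and_closed`).

A lift is a quasi-isomorphism because its mapping cone is exact modulo `ħ`: bidegree by bidegree, a
cocycle of the cone is a boundary modulo `ħ`, and division by `ħ` and iteration sum up to a series
(`ConeExact.series`). Exactness modulo `ħ ^ (N + 1)` follows since `ħ` acts injectively.

Strict units. The equations hold automatically on lists through the unit, provided the unknowns stay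
constant there. The unit line of a projective unital algebra is a direct summand
(`exists_unit_form`), so that there is a homogeneous endomorphism `P` that kills the unit and is
invisible to multilinear functions vanishing on lists through it. Precomposing the corrections with
`P` keeps them unital. -/

namespace AInf

universe u v w

set_option linter.unusedSectionVars false

/-! ### The convolution ring of functions on lists -/

section conv

variable {V W S : Type*}

/-- Functions on finite sequences, multiplied by summing over all splittings of a sequence. -/
def Conv (V S : Type*) : Type _ := List V → S

instance [AddCommGroup S] : AddCommGroup (Conv V S) := inferInstanceAs (AddCommGroup (List V → S))

/-- The value of a convolution product on a list. -/
def convMul [Ring S] : List V → (List V → S) → (List V → S) → S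
  | [], Φ, Ψ => Φ [] * Ψ []
  | x :: l, Φ, Ψ => Φ [] * Ψ (x :: l) + convMul l (fun q => Φ (x :: q)) Ψ

section

variable [Ring S]

theorem convMul_add_left (l : List V) : ∀ Φ Φ' Ψ : List V → S,
    convMul l (fun q => Φ q + Φ' q) Ψ = convMul l Φ Ψ + convMul l Φ' Ψ := by
  induction l with
  | nil => intro Φ Φ' Ψ; simp [convMul, add_mul]
  | cons x l ih => intro Φ Φ' Ψ; simp only [convMul, ih, add_mul]; abel

theorem convMul_add_right (l : List V) : ∀ Φ Ψ Ψ' : List V → S,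
    convMul l Φ (fun q => Ψ q + Ψ' q) = convMul l Φ Ψ + convMul l Φ Ψ' := by
  induction l with
  | nil => intro Φ Ψ Ψ'; simp [convMul, mul_add]
  | cons x l ih => intro Φ Ψ Ψ'; simp only [convMul, ih, mul_add]; abel

theorem convMul_mul_left (s : S) (l : List V) : ∀ Φ Ψ : List V → S,
    convMul l (fun q => s * Φ q) Ψ = s * convMul l Φ Ψ := by
  induction l with
  | nil => intro Φ Ψ; simp [convMul, mul_assoc]
  | cons x l ih => intro Φ Ψ; simp only [convMul, ih, mul_add, mul_assoc]

theorem convMul_zero_left (l : List V) : ∀ Ψ : List V → S, convMul l (fun _ => 0) Ψ = 0 := by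
  induction l with
  | nil => intro Ψ; simp [convMul]
  | cons x l ih => intro Ψ; simp [convMul, ih]

theorem convMul_zero_right (l : List V) : ∀ Φ : List V → S, convMul l Φ (fun _ => 0) = 0 := by
  induction l with
  | nil => intro Ψ; simp [convMul]
  | cons x l ih => intro Ψ; simp [convMul, ih]

theorem convMul_assoc (l : List V) : ∀ Φ Ψ Ξ : List V → S,
    convMul l (fun q => convMul q Φ Ψ) Ξ = convMul l Φ (fun q => convMul q Ψ Ξ) := by
  induction l with
  | nil => intro Φ Ψ Ξ; simp [convMul, mul_assoc]
  | cons x l ih =>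
    intro Φ Ψ Ξ
    simp only [convMul, convMul_add_left, convMul_mul_left, ih, mul_add, mul_assoc]
    abel

/-- This is the convolution algebra of maps from the tensor coalgebra to `S`; associativity is
coassociativity of deconcatenation. -/
instance : Ring (Conv V S) :=
  { (inferInstance : AddCommGroup (Conv V S)) with
    mul := fun Φ Ψ l => convMul l Φ Ψ
    one := fun l => match l with
      | [] => 1
      | _ :: _ => 0
    left_distrib := fun Φ Ψ Ψ' => funext fun l => convMul_add_right l Φ Ψ Ψ'
    right_distrib := fun Φ Ψ Ψ' => funext fun l => convMul_add_left l Φ Ψ Ψ'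
    zero_mul := fun Ψ => funext fun l => convMul_zero_left l Ψ
    mul_zero := fun Ψ => funext fun l => convMul_zero_right l Ψ
    mul_assoc := fun Φ Ψ Ξ => funext fun l => convMul_assoc l Φ Ψ Ξ
    one_mul := fun Φ => funext fun l => by
      change convMul l _ _ = _
      cases l with
      | nil => exact one_mul _
      | cons x l => exact (congrArg₂ (· + ·) (one_mul _) (convMul_zero_left l Φ)).trans (add_zero _)
    mul_one := fun Φ => funext fun l => by
      change convMul l _ _ = _
      induction l generalizing Φ with
      | nil => exact mul_one _
      | cons x l ih =>
        exact (congrArg₂ (· + ·) (mul_zero _) (ih fun q => Φ (x :: q))).trans (zero_add _) }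

theorem Conv.mul_nil (Φ Ψ : Conv V S) : (Φ * Ψ) [] = Φ [] * Ψ [] := rfl

theorem Conv.mul_cons (Φ Ψ : Conv V S) (x : V) (l : List V) :
    (Φ * Ψ) (x :: l) = Φ [] * Ψ (x :: l) + convMul l (fun q => Φ (x :: q)) Ψ := rfl

theorem Conv.one_nil : (1 : Conv V S) [] = 1 := rfl

theorem Conv.one_cons (x : V) (l : List V) : (1 : Conv V S) (x :: l) = 0 := rfl

theorem Conv.add_apply (Φ Ψ : Conv V S) (l : List V) : (Φ + Ψ) l = Φ l + Ψ l := rfl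

theorem Conv.sub_apply (Φ Ψ : Conv V S) (l : List V) : (Φ - Ψ) l = Φ l - Ψ l := rfl

end

end conv

/-! ### Pulling functions on lists back along families of operations -/

section pull

variable {V W Y S S' U : Type*}

/-- The sum over all splittings `l = p ++ q` of the pullback of `Θ (φ p :: ·)` at `q`. -/
def pullAux [AddCommGroup S] (f : List V → W) : List V → (List V → W) → (List W → S) → S
  | [], φ, Θ => Θ [φ []]
  | y :: l, φ, Θ => pullAux f l (fun q => f (y :: q)) (fun q => Θ (φ [] :: q))
      + pullAux f l (fun q => φ (y :: q)) Θ

/-- The sum of `Θ [f l₁, …, f l_q]` over all decompositions of a list into nonempty pieces. -/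
def pull [AddCommGroup S] (f : List V → W) (Θ : List W → S) : List V → S
  | [] => Θ []
  | x :: l => pullAux f l (fun q => f (x :: q)) Θ

/-- The sum over all splittings `l = p ++ q` of `cod (Θ (φ p :: ·)) q + pull f (Θ (χ p :: ·)) q`. -/
def codAux [AddCommGroup S] (p η f : List V → W) :
    List V → (List V → W) → (List V → W) → (List W → S) → S
  | [], _, χ, Θ => Θ [χ []]
  | y :: l, φ, χ, Θ => codAux p η f l (fun q => p (y :: q)) (fun q => η (y :: q))
        (fun q => Θ (φ [] :: q))
      + pullAux f l (fun q => f (y :: q)) (fun q => Θ (χ [] :: q))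
      + codAux p η f l (fun q => φ (y :: q)) (fun q => χ (y :: q)) Θ

/-- The sum of `Θ [p l₁, …, p l_i, η l', f l''₁, …, f l''_j]` over all decompositions of a list into
nonempty pieces, one of which is marked. -/
def cod [AddCommGroup S] (p η f : List V → W) (Θ : List W → S) : List V → S
  | [] => 0
  | x :: l => codAux p η f l (fun q => p (x :: q)) (fun q => η (x :: q)) Θ

section additive

variable [AddCommGroup S] [AddCommGroup S']

theorem pullAux_map (e : S →+ S') (f : List V → W) (l : List V) : ∀ (φ : List V → W)
    (Θ : List W → S), pullAux f l φ (fun q => e (Θ q)) = e (pullAux f l φ Θ) := by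
  induction l with
  | nil => intro φ Θ; rfl
  | cons y l ih => intro φ Θ; simp only [pullAux, ih, map_add]

theorem pull_map (e : S →+ S') (f : List V → W) (Θ : List W → S) (l : List V) :
    pull f (fun q => e (Θ q)) l = e (pull f Θ l) := by
  cases l with
  | nil => rfl
  | cons y l => exact pullAux_map e f l _ Θ

theorem codAux_map (e : S →+ S') (p η f : List V → W) (l : List V) : ∀ (φ χ : List V → W)
    (Θ : List W → S), codAux p η f l φ χ (fun q => e (Θ q)) = e (codAux p η f l φ χ Θ) := by
  induction l with
  | nil => intro φ χ Θ; rfl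
  | cons y l ih => intro φ χ Θ; simp only [codAux, ih, map_add, pullAux_map]

theorem cod_map (e : S →+ S') (p η f : List V → W) (Θ : List W → S) (l : List V) :
    cod p η f (fun q => e (Θ q)) l = e (cod p η f Θ l) := by
  cases l with
  | nil => exact (map_zero e).symm
  | cons y l => exact codAux_map e p η f l _ _ Θ

theorem pullAux_add (f : List V → W) (l : List V) : ∀ (φ : List V → W)
    (Θ Θ' : List W → S), pullAux f l φ (fun q => Θ q + Θ' q)
      = pullAux f l φ Θ + pullAux f l φ Θ' := by
  induction l with
  | nil => intro φ Θ Θ'; rfl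
  | cons y l ih => intro φ Θ Θ'; simp only [pullAux, ih]; abel

theorem pull_add (f : List V → W) (Θ Θ' : List W → S) (l : List V) :
    pull f (fun q => Θ q + Θ' q) l = pull f Θ l + pull f Θ' l := by
  cases l with
  | nil => rfl
  | cons y l => exact pullAux_add f l _ Θ Θ'

theorem codAux_add (p η f : List V → W) (l : List V) : ∀ (φ χ : List V → W)
    (Θ Θ' : List W → S), codAux p η f l φ χ (fun q => Θ q + Θ' q)
      = codAux p η f l φ χ Θ + codAux p η f l φ χ Θ' := by
  induction l with
  | nil => intro φ χ Θ Θ'; rfl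
  | cons y l ih => intro φ χ Θ Θ'; simp only [codAux, ih, pullAux_add]; abel

theorem cod_add (p η f : List V → W) (Θ Θ' : List W → S) (l : List V) :
    cod p η f (fun q => Θ q + Θ' q) l = cod p η f Θ l + cod p η f Θ' l := by
  cases l with
  | nil => exact (add_zero 0).symm
  | cons y l => exact codAux_add p η f l _ _ Θ Θ'

theorem pullAux_zero (f : List V → W) (l : List V) (φ : List V → W) :
    pullAux f l φ (fun _ => (0 : S)) = 0 := pullAux_map (0 : S →+ S) f l φ (fun _ => 0)

theorem pull_zero (f : List V → W) (l : List V) : pull f (fun _ => (0 : S)) l = 0 :=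
  pull_map (0 : S →+ S) f (fun _ => 0) l

theorem cod_zero (p η f : List V → W) (l : List V) : cod p η f (fun _ => (0 : S)) l = 0 :=
  cod_map (0 : S →+ S) p η f (fun _ => 0) l

theorem cod_sub (p η f : List V → W) (Θ Θ' : List W → S) (l : List V) :
    cod p η f (fun q => Θ q - Θ' q) l = cod p η f Θ l - cod p η f Θ' l := by
  have h := cod_add p η f (fun q => Θ q - Θ' q) Θ' l
  simp only [sub_add_cancel] at h
  rw [h, add_sub_cancel_right]

end additive

section ring

variable [Ring S]

/-- In `pullAux` the first piece is still open: `φ` has absorbed its entries so far. The cut of the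
product lies either before this piece, so that `Φ` sees the empty list, or after it. -/
theorem pullAux_convMul (f : List V → W) (l : List V) : ∀ (φ : List V → W) (Φ Ψ : List W → S),
    pullAux f l φ (fun q => convMul q Φ Ψ)
      = Φ [] * pullAux f l φ Ψ + convMul l (fun q => pullAux f q φ Φ) (pull f Ψ) := by
  induction l with
  | nil => intro φ Φ Ψ; simp [pullAux, convMul, pull]
  | cons y l ih =>
    intro φ Φ Ψ
    have hm : ∀ (φ : List V → W) (s : S) (Θ : List W → S),
        pullAux f l φ (fun q => s * Θ q) = s * pullAux f l φ Θ :=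
      fun φ s Θ => pullAux_map (AddMonoidHom.mulLeft s) f l φ Θ
    simp only [pullAux, convMul, pullAux_add, ih, hm, convMul_add_left, mul_add, pull]
    abel

/-- A map of tensor coalgebras respects deconcatenation, so pulling back is multiplicative. -/
theorem pull_convMul (f : List V → W) (Φ Ψ : List W → S) (l : List V) :
    pull f (fun q => convMul q Φ Ψ) l = convMul l (pull f Φ) (pull f Ψ) := by
  cases l with
  | nil => rfl
  | cons y l => exact pullAux_convMul f l _ Φ Ψ

theorem codAux_convMul (p η f : List V → W) (l : List V) : ∀ (φ χ : List V → W)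
    (Φ Ψ : List W → S), codAux p η f l φ χ (fun q => convMul q Φ Ψ)
      = Φ [] * codAux p η f l φ χ Ψ + convMul l (fun q => pullAux p q φ Φ) (cod p η f Ψ)
        + convMul l (fun q => codAux p η f q φ χ Φ) (pull f Ψ) := by
  induction l with
  | nil => intro φ χ Φ Ψ; simp [codAux, convMul, pull, cod]
  | cons y l ih =>
    intro φ χ Φ Ψ
    have hm : ∀ (φ : List V → W) (s : S) (Θ : List W → S),
        pullAux f l φ (fun q => s * Θ q) = s * pullAux f l φ Θ :=
      fun φ s Θ => pullAux_map (AddMonoidHom.mulLeft s) f l φ Θ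
    have hm' : ∀ (φ χ : List V → W) (s : S) (Θ : List W → S),
        codAux p η f l φ χ (fun q => s * Θ q) = s * codAux p η f l φ χ Θ :=
      fun φ χ s Θ => codAux_map (AddMonoidHom.mulLeft s) p η f l φ χ Θ
    simp only [pullAux, codAux, convMul, pullAux_add, codAux_add, ih, hm, hm', convMul_add_left,
      mul_add, pull, cod, pullAux_convMul]
    abel

/-- The twisted Leibniz rule: the marked piece lies in the right or in the left factor, with pieces
of type `p` before it and pieces of type `f` after it. -/
theorem cod_convMul (p η f : List V → W) (Φ Ψ : List W → S) (l : List V) :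
    cod p η f (fun q => convMul q Φ Ψ) l
      = convMul l (pull p Φ) (cod p η f Ψ) + convMul l (cod p η f Φ) (pull f Ψ) := by
  cases l with
  | nil => simp [cod, convMul]
  | cons y l =>
    simp only [convMul, cod, pull, zero_mul, zero_add]
    exact codAux_convMul p η f l _ _ Φ Ψ

end ring

end pull

/-- The family whose only component is the linear map `e`. -/
def single {V W : Type*} [AddCommGroup W] (e : V → W) : List V → W
  | [x] => e x
  | _ => 0

@[simp] theorem single_nil {V W : Type*} [AddCommGroup W] (e : V → W) : single e [] = 0 := rfl

@[simp] theorem single_one {V W : Type*} [AddCommGroup W] (e : V → W) (x : V) : single e [x] = e x := rfl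

@[simp] theorem single_cons_cons {V W : Type*} [AddCommGroup W] (e : V → W) (x y : V) (l : List V) :
    single e (x :: y :: l) = 0 := rfl

/-! ### Multilinear functions on lists -/

section multilinear

variable {R V W S U : Type*} [CommRing R] [AddCommGroup V] [Module R V] [AddCommGroup W] [Module R W]
  [AddCommGroup U] [Module R U]

/-- A function on lists that is `R`-linear in every entry. -/
def MultiLin (R : Type*) [CommRing R] {V U : Type*} [AddCommGroup V] [Module R V] [AddCommGroup U]
    [Module R U] (θ : List V → U) : Prop :=
  ∀ (p q : List V) (c : R) (x y : V), θ (p ++ (c • x + y) :: q) = c • θ (p ++ x :: q) + θ (p ++ y :: q)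

namespace MultiLin

variable {θ θ' : List V → U}

theorem tail (h : MultiLin R θ) (x : V) : MultiLin R (fun l => θ (x :: l)) :=
  fun p q c y z => h (x :: p) q c y z

theorem head (h : MultiLin R θ) (c : R) (x y : V) (q : List V) :
    θ ((c • x + y) :: q) = c • θ (x :: q) + θ (y :: q) := h [] q c x y

theorem map_add (h : MultiLin R θ) (p q : List V) (x y : V) :
    θ (p ++ (x + y) :: q) = θ (p ++ x :: q) + θ (p ++ y :: q) := by
  simpa using h p q 1 x y

theorem map_zero (h : MultiLin R θ) (p q : List V) : θ (p ++ 0 :: q) = 0 := by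
  simpa using h.map_add p q 0 0

theorem map_smul (h : MultiLin R θ) (p q : List V) (c : R) (x : V) :
    θ (p ++ (c • x) :: q) = c • θ (p ++ x :: q) := by
  simpa [h.map_zero] using h p q c x 0

theorem map_neg (h : MultiLin R θ) (p q : List V) (x : V) :
    θ (p ++ (-x) :: q) = -θ (p ++ x :: q) := by
  simpa using h.map_smul p q (-1) x

theorem map_sub (h : MultiLin R θ) (p q : List V) (x y : V) :
    θ (p ++ (x - y) :: q) = θ (p ++ x :: q) - θ (p ++ y :: q) := by
  rw [sub_eq_add_neg, h.map_add, h.map_neg, sub_eq_add_neg]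

theorem of_add_smul (h1 : ∀ p q x y, θ (p ++ (x + y) :: q) = θ (p ++ x :: q) + θ (p ++ y :: q))
    (h2 : ∀ p q (c : R) x, θ (p ++ (c • x) :: q) = c • θ (p ++ x :: q)) : MultiLin R θ :=
  fun p q c x y => by rw [h1, h2]

theorem add (h : MultiLin R θ) (h' : MultiLin R θ') : MultiLin R (fun l => θ l + θ' l) :=
  fun p q c x y => by simp only [h p q c x y, h' p q c x y, smul_add]; abel

theorem sub (h : MultiLin R θ) (h' : MultiLin R θ') : MultiLin R (fun l => θ l - θ' l) :=
  fun p q c x y => by simp only [h p q c x y, h' p q c x y, smul_sub]; abel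

theorem neg (h : MultiLin R θ) : MultiLin R (fun l => -θ l) :=
  fun p q c x y => by simp only [h p q c x y, smul_neg]; abel

theorem zero : MultiLin R (fun _ : List V => (0 : U)) := fun p q c x y => by simp

theorem smul (h : MultiLin R θ) (r : R) : MultiLin R (fun l => r • θ l) :=
  fun p q c x y => by simp only [h p q c x y, smul_add, smul_comm r c]

theorem comp_left {U' : Type*} [AddCommGroup U'] [Module R U'] (h : MultiLin R θ) (e : U →ₗ[R] U') :
    MultiLin R (fun l => e (θ l)) :=
  fun p q c x y => by simp only [h p q c x y, _root_.map_add, _root_.map_smul]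

theorem comp_map {V' : Type*} [AddCommGroup V'] [Module R V'] (h : MultiLin R θ) (e : V' →ₗ[R] V) :
    MultiLin R (fun l => θ (l.map e)) :=
  fun p q c x y => by simp [h (p.map e) (q.map e) c (e x) (e y)]

end MultiLin

theorem multiLin_single (e : V →ₗ[R] W) : MultiLin R (single e) := by
  intro p q c x y
  match p, q with
  | [], [] => simp
  | [], z :: q => simp
  | [z], q => simp
  | z :: z' :: p, q => simp

variable {f φ φ' p η χ χ' : List V → W} {Θ : List W → U}

theorem pullAux_comb {V : Type*} {f : List V → W} (l : List V) :
    ∀ {φ φ' : List V → W} {Θ : List W → U}, MultiLin R Θ → ∀ (c : R),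
    pullAux f l (fun q => c • φ q + φ' q) Θ = c • pullAux f l φ Θ + pullAux f l φ' Θ := by
  induction l with
  | nil => intro φ φ' Θ hΘ c; exact hΘ.head c _ _ []
  | cons y l ih =>
    intro φ φ' Θ hΘ c
    have hm : ∀ (φ : List V → W) (s : R) (Θ : List W → U),
        pullAux f l φ (fun q => s • Θ q) = s • pullAux f l φ Θ :=
      fun φ s Θ => pullAux_map (DistribSMul.toAddMonoidHom U s) f l φ Θ
    simp only [pullAux, ih hΘ, hΘ.head, pullAux_add, hm, smul_add]
    abel

theorem MultiLin.pullAux (hf : MultiLin R f) (p : List V) : ∀ {φ : List V → W} {Θ : List W → U},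
    MultiLin R φ → MultiLin R Θ → ∀ (q : List V) (c : R) (x y : V),
    AInf.pullAux f (p ++ (c • x + y) :: q) φ Θ
      = c • AInf.pullAux f (p ++ x :: q) φ Θ + AInf.pullAux f (p ++ y :: q) φ Θ := by
  induction p with
  | nil =>
    intro φ Θ hφ hΘ q c x y
    simp only [List.nil_append, AInf.pullAux, hf.head, hφ.head]
    rw [pullAux_comb q (hΘ.tail _), pullAux_comb q hΘ]
    simp only [smul_add]; abel
  | cons z p ih =>
    intro φ Θ hφ hΘ q c x y
    simp only [List.cons_append, AInf.pullAux]
    rw [ih (hf.tail z) (hΘ.tail _), ih (hφ.tail z) hΘ]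
    simp only [smul_add]; abel

theorem MultiLin.pull (hf : MultiLin R f) (hΘ : MultiLin R Θ) : MultiLin R (pull f Θ) := by
  intro p q c x y
  cases p with
  | nil =>
    simp only [List.nil_append, AInf.pull, hf.head]
    rw [pullAux_comb q hΘ]
  | cons z p => exact hf.pullAux p (hf.tail z) hΘ q c x y

theorem codAux_comb {V : Type*} {p η f : List V → W} (l : List V) : ∀ {φ φ' χ χ' : List V → W} {Θ : List W → U}, MultiLin R Θ →
    ∀ (c : R), codAux p η f l (fun q => c • φ q + φ' q) (fun q => c • χ q + χ' q) Θ
      = c • codAux p η f l φ χ Θ + codAux p η f l φ' χ' Θ := by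
  induction l with
  | nil => intro φ φ' χ χ' Θ hΘ c; exact hΘ.head c _ _ []
  | cons y l ih =>
    intro φ φ' χ χ' Θ hΘ c
    have hm : ∀ (φ : List V → W) (s : R) (Θ : List W → U),
        pullAux f l φ (fun q => s • Θ q) = s • pullAux f l φ Θ :=
      fun φ s Θ => pullAux_map (DistribSMul.toAddMonoidHom U s) f l φ Θ
    have hm' : ∀ (φ χ : List V → W) (s : R) (Θ : List W → U),
        codAux p η f l φ χ (fun q => s • Θ q) = s • codAux p η f l φ χ Θ :=
      fun φ χ s Θ => codAux_map (DistribSMul.toAddMonoidHom U s) p η f l φ χ Θ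
    simp only [codAux, ih hΘ, hΘ.head, pullAux_add, codAux_add, hm, hm', smul_add]
    abel

theorem MultiLin.codAux (hp : MultiLin R p) (hη : MultiLin R η) (hf : MultiLin R f) (l : List V) :
    ∀ {φ χ : List V → W} {Θ : List W → U},
    MultiLin R φ → MultiLin R χ → MultiLin R Θ → ∀ (q : List V) (c : R) (x y : V),
    AInf.codAux p η f (l ++ (c • x + y) :: q) φ χ Θ
      = c • AInf.codAux p η f (l ++ x :: q) φ χ Θ + AInf.codAux p η f (l ++ y :: q) φ χ Θ := by
  induction l with
  | nil =>
    intro φ χ Θ hφ hχ hΘ q c x y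
    simp only [List.nil_append, AInf.codAux, hf.head, hp.head, hη.head, hφ.head, hχ.head]
    rw [pullAux_comb q (hΘ.tail _), codAux_comb q (hΘ.tail _), codAux_comb q hΘ]
    simp only [smul_add]; abel
  | cons z l ih =>
    intro φ χ Θ hφ hχ hΘ q c x y
    simp only [List.cons_append, AInf.codAux]
    rw [ih (hp.tail z) (hη.tail z) (hΘ.tail _), ih (hφ.tail z) (hχ.tail z) hΘ,
      hf.pullAux l (hf.tail z) (hΘ.tail _)]
    simp only [smul_add]; abel

theorem MultiLin.cod (hp : MultiLin R p) (hη : MultiLin R η) (hf : MultiLin R f)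
    (hΘ : MultiLin R Θ) : MultiLin R (cod p η f Θ) := by
  intro l q c x y
  cases l with
  | nil =>
    simp only [List.nil_append, AInf.cod, hp.head, hη.head]
    rw [codAux_comb q hΘ]
  | cons z l => exact hp.codAux hη hf l (hp.tail z) (hη.tail z) hΘ q c x y

/-- The module of multilinear functions on lists. -/
def multiLinSubmodule (R V U : Type*) [CommRing R] [AddCommGroup V] [Module R V] [AddCommGroup U]
    [Module R U] : Submodule R (List V → U) where
  carrier := {θ | MultiLin R θ}
  add_mem' h h' := h.add h'
  zero_mem' := MultiLin.zero
  smul_mem' c _ h := h.smul c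

end multilinear

/-- A multilinear function on lists factors through products in some associative algebra. -/
theorem exists_universal {R : Type u} {W : Type v} {U : Type w} [CommRing R] [AddCommGroup W]
    [Module R W] [AddCommGroup U] [Module R U] {θ : List W → U} (hθ : MultiLin R θ) :
    ∃ (S : Type (max v w)) (_ : Ring S) (_ : _root_.Algebra R S) (ι : W →ₗ[R] S) (ev : S →ₗ[R] U),
      ∀ l, ev ((l.map ι).prod) = θ l := by
  let M := multiLinSubmodule R W U
  -- A letter acts on multilinear functions by inserting itself as first argument. The opposite ring
  -- is taken so that in a product the first letter acts first.
  let D : W →ₗ[R] Module.End R M :=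
    { toFun := fun x =>
        { toFun := fun ψ => ⟨fun l => ψ.1 (x :: l), ψ.2.tail x⟩
          map_add' := fun _ _ => rfl
          map_smul' := fun _ _ => rfl }
      map_add' := fun x y => by ext ψ l; exact ψ.2.map_add [] l x y
      map_smul' := fun c x => by ext ψ l; exact ψ.2.map_smul [] l c x }
  let ev : (Module.End R M)ᵐᵒᵖ →ₗ[R] U :=
    { toFun := fun s => (s.unop ⟨θ, hθ⟩).1 []
      map_add' := fun _ _ => rfl
      map_smul' := fun _ _ => rfl }
  refine ⟨(Module.End R M)ᵐᵒᵖ, inferInstance, inferInstance,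
    (MulOpposite.opLinearEquiv R).toLinearMap ∘ₗ D, ev, fun l => ?_⟩
  have key : ∀ (l : List W) (ψ : M) (q : List W),
      ((((l.map ((MulOpposite.opLinearEquiv R).toLinearMap ∘ₗ D)).prod).unop) ψ).1 q
        = ψ.1 (l ++ q) := by
    intro l
    induction l with
    | nil => intro ψ q; rfl
    | cons x l ih =>
      intro ψ q
      rw [List.map_cons, List.prod_cons, MulOpposite.unop_mul]
      exact ih (D x ψ) q
  have := key l ⟨θ, hθ⟩ []
  rw [List.append_nil] at this
  exact this

/-! ### Families concentrated in length one -/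

section support

variable {V W S : Type*} [AddCommGroup S]

theorem pullAux_eq_zero_of_cons {f : List V → W} (l : List V) : ∀ {φ : List V → W}
    {Θ : List W → S}, (∀ x q, Θ (x :: q) = 0) → pullAux f l φ Θ = 0 := by
  induction l with
  | nil => intro φ Θ h; exact h _ _
  | cons y l ih =>
    intro φ Θ h
    exact (congrArg₂ (· + ·) (ih (φ := fun q => f (y :: q)) (Θ := fun q => Θ (φ [] :: q))
      fun x q => h _ _) (ih (φ := fun q => φ (y :: q)) h)).trans (add_zero _)

theorem codAux_eq_zero_of_cons {p η f : List V → W} (l : List V) : ∀ {φ χ : List V → W}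
    {Θ : List W → S}, (∀ x q, Θ (x :: q) = 0) → codAux p η f l φ χ Θ = 0 := by
  induction l with
  | nil => intro φ χ Θ h; exact h _ _
  | cons y l ih =>
    intro φ χ Θ h
    have h1 := congrArg₂ (· + ·) (ih (φ := fun q => p (y :: q)) (χ := fun q => η (y :: q))
      (Θ := fun q => Θ (φ [] :: q)) fun x q => h _ _) (pullAux_eq_zero_of_cons (f := f) l
      (φ := fun q => f (y :: q)) (Θ := fun q => Θ (χ [] :: q)) fun x q => h _ _)
    exact (congrArg₂ (· + ·) h1 (ih h)).trans (by simp)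

theorem cod_eq_zero_of_cons {p η f : List V → W} (l : List V)
    {Θ : List W → S} (h : ∀ x q, Θ (x :: q) = 0) : cod p η f Θ l = 0 := by
  cases l with
  | nil => rfl
  | cons y l => exact codAux_eq_zero_of_cons l h

theorem pull_eq_zero_of_cons {f : List V → W} (x : V) (l : List V)
    {Θ : List W → S} (h : ∀ x q, Θ (x :: q) = 0) : pull f Θ (x :: l) = 0 :=
  pullAux_eq_zero_of_cons l h

theorem pullAux_single {f : List V → W} (e : W → S) (l : List V) : ∀ {φ : List V → W},
    pullAux f l φ (single e) = e (φ l) := by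
  induction l with
  | nil => intro φ; rfl
  | cons y l ih =>
    intro φ
    rw [pullAux, ih, pullAux_eq_zero_of_cons l (fun x q => rfl), zero_add]

theorem codAux_single {p η f : List V → W} (e : W → S) (l : List V) : ∀ {φ χ : List V → W},
    codAux p η f l φ χ (single e) = e (χ l) := by
  induction l with
  | nil => intro φ χ; rfl
  | cons y l ih =>
    intro φ χ
    rw [codAux, ih, codAux_eq_zero_of_cons l (fun x q => rfl),
      pullAux_eq_zero_of_cons l (fun x q => rfl), zero_add, zero_add]

theorem pull_single_right [AddCommGroup W] {f : List V → W} (hf : f [] = 0) (e : W →+ S) :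
    pull f (single e) = fun l => e (f l) := by
  funext l
  cases l with
  | nil => simp [pull, hf]
  | cons x l => exact pullAux_single e l

theorem cod_single_right [AddCommGroup W] {p η f : List V → W} (hη : η [] = 0) (e : W →+ S) :
    cod p η f (single e) = fun l => e (η l) := by
  funext l
  cases l with
  | nil => simp [cod, hη]
  | cons x l => exact codAux_single e l

end support

section multilinear

variable {R V W U : Type*} [CommRing R] [AddCommGroup V] [Module R V] [AddCommGroup W] [Module R W]
  [AddCommGroup U] [Module R U]

theorem pullAux_single_left (e : V →ₗ[R] W) (l : List V) : ∀ {φ : List V → W} {Θ : List W → U},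
    MultiLin R Θ → (∀ x q, φ (x :: q) = 0) →
    pullAux (single e) l φ Θ = Θ (φ [] :: l.map e) := by
  induction l with
  | nil => intro φ Θ _ _; rfl
  | cons y l ih =>
    intro φ Θ hΘ hφ
    have h := ih (φ := fun q => φ (y :: q)) hΘ (fun x q => hφ _ _)
    simp only [hφ y []] at h
    exact (congrArg₂ (· + ·) (ih (hΘ.tail _) (fun x q => rfl))
      (h.trans (hΘ.map_zero [] (l.map e)))).trans (add_zero _)

theorem pull_single_left (e : V →ₗ[R] W) {Θ : List W → U} (hΘ : MultiLin R Θ) (l : List V) :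
    pull (single e) Θ l = Θ (l.map e) := by
  cases l with
  | nil => rfl
  | cons x l => exact pullAux_single_left e l hΘ (fun x q => rfl)

end multilinear

/-- The identity family. -/
abbrev proj (V : Type*) [AddCommGroup V] : List V → V := single (fun x => x)

/-! ### Coalgebra maps and coderivations in the convolution ring -/

section ringhom

variable {V W Y S : Type*} [Ring S]

/-- The ring homomorphism given by pulling back. -/
def Conv.pull (f : List V → W) : Conv W S →+* Conv V S where
  toFun Φ := AInf.pull f Φ
  map_one' := by
    funext l
    cases l with
    | nil => rfl
    | cons x l => exact pull_eq_zero_of_cons x l (fun _ _ => rfl)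
  map_mul' Φ Ψ := funext fun l => pull_convMul f Φ Ψ l
  map_zero' := funext fun l => pull_zero f l
  map_add' Φ Ψ := funext fun l => pull_add f Φ Ψ l

/-- The twisted derivation given by `cod`. -/
def Conv.cod (p η f : List V → W) : Conv W S →+ Conv V S where
  toFun Φ := AInf.cod p η f Φ
  map_zero' := funext fun l => cod_zero p η f l
  map_add' Φ Ψ := funext fun l => cod_add p η f Φ Ψ l

theorem Conv.cod_mul (p η f : List V → W) (Φ Ψ : Conv W S) :
    Conv.cod p η f (Φ * Ψ) = Conv.pull p Φ * Conv.cod p η f Ψ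
      + Conv.cod p η f Φ * Conv.pull f Ψ :=
  funext fun l => cod_convMul p η f Φ Ψ l

theorem Conv.cod_one (p η f : List V → W) : Conv.cod p η f (1 : Conv W S) = 0 :=
  funext fun l => cod_eq_zero_of_cons l (fun _ _ => rfl)

variable {R : Type*} [CommRing R] [_root_.Algebra R S] [AddCommGroup W] [Module R W]
  [AddCommGroup Y] [Module R Y]

/-- The function on lists of products of images. -/
def uni (ι : W →ₗ[R] S) : Conv W S := fun l => (l.map ι).prod

/-- A vector-valued function on lists, seen in the convolution ring. -/
def lft (ι : W →ₗ[R] S) (φ : List V → W) : Conv V S := fun l => ι (φ l)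

theorem lft_add (ι : W →ₗ[R] S) (φ φ' : List V → W) :
    lft ι (fun l => φ l + φ' l) = lft ι φ + lft ι φ' := funext fun _ => map_add ι _ _

theorem lft_sub (ι : W →ₗ[R] S) (φ φ' : List V → W) :
    lft ι (fun l => φ l - φ' l) = lft ι φ - lft ι φ' := funext fun _ => map_sub ι _ _

theorem lft_neg (ι : W →ₗ[R] S) (φ : List V → W) :
    lft ι (fun l => -φ l) = -lft ι φ := funext fun _ => map_neg ι _

/-- Splitting the first letter off a nonempty product shows that `uni ι` is the geometric series of
the letters. The next statement splits off the last letter instead. -/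
theorem lft_proj_mul_uni (ι : W →ₗ[R] S) : (1 - lft ι (proj W)) * uni ι = 1 := by
  rw [sub_mul, one_mul, sub_eq_iff_eq_add]
  funext l
  cases l with
  | nil =>
    change (1 : S) = 1 + ι 0 * 1
    simp
  | cons x l =>
    change ((x :: l).map ι).prod = 0 + (ι 0 * _ + convMul l (fun q => ι (proj W (x :: q))) (uni ι))
    have h : (fun q => ι (proj W (x :: q))) = fun q => ι x * (1 : Conv W S) q := by
      funext q
      cases q with
      | nil => exact (mul_one _).symm
      | cons y q => simp [Conv.one_cons]
    have h' := convMul_mul_left (ι x) l (1 : Conv W S) (uni ι)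
    have h'' : convMul l (1 : Conv W S) (uni ι) = uni ι l := congrFun (one_mul (uni ι)) l
    rw [h'', ← h] at h'
    refine Eq.trans ?_ (congrArg (fun z => 0 + (ι 0 * uni ι (x :: l) + z)) h'.symm)
    simp [uni]

theorem uni_mul_lft_proj (ι : W →ₗ[R] S) : uni ι * (1 - lft ι (proj W)) = 1 := by
  rw [mul_sub, mul_one, sub_eq_iff_eq_add]
  funext l
  induction l with
  | nil =>
    change (1 : S) = 1 + 1 * ι 0
    simp
  | cons x l ih =>
    change _ = 0 + (1 * ι (proj W (x :: l))
      + convMul l (fun q => ((x :: q).map ι).prod) (lft ι (proj W)))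
    have h : (fun q => ((x :: q).map ι).prod) = fun q => ι x * uni ι q := by
      funext q; simp [uni]
    have h' := convMul_mul_left (ι x) l (uni ι) (lft ι (proj W))
    rw [← h] at h'
    refine Eq.trans ?_ (congrArg (fun z => 0 + (1 * ι (proj W (x :: l)) + z)) h'.symm)
    have h0 : ((x :: l).map ι).prod = ι x * uni ι l := by simp [uni]
    refine h0.trans ?_
    cases l with
    | nil =>
      change ι x * 1 = 0 + (1 * ι x + ι x * (1 * ι 0))
      simp
    | cons y q =>
      have h2 : uni ι (y :: q) = convMul (y :: q) (uni ι) (lft ι (proj W)) :=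
        ih.trans (zero_add _)
      rw [h2]
      simp

/-- The geometric series of a family of operations: the associated map of tensor coalgebras. -/
def geom (ι : W →ₗ[R] S) (f : List V → W) : Conv V S := Conv.pull f (uni ι)

theorem pull_lft (f : List V → W) (ι : Y →ₗ[R] S) (θ : List W → Y) :
    Conv.pull f (lft ι θ) = lft ι (pull f θ) :=
  funext fun l => pull_map ι.toAddMonoidHom f θ l

theorem cod_lft (p η f : List V → W) (ι : Y →ₗ[R] S) (θ : List W → Y) :
    Conv.cod p η f (lft ι θ) = lft ι (cod p η f θ) :=
  funext fun l => cod_map ι.toAddMonoidHom p η f θ l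

theorem pull_proj {f : List V → W} (hf : f [] = 0) : pull f (proj W) = f :=
  pull_single_right hf (AddMonoidHom.id W)

theorem cod_proj {p η f : List V → W} (hη : η [] = 0) : cod p η f (proj W) = η :=
  cod_single_right hη (AddMonoidHom.id W)

/-- The image of `lft_proj_mul_uni` under the ring homomorphism `Conv.pull f`. -/
theorem one_sub_mul_geom (ι : W →ₗ[R] S) {f : List V → W} (hf : f [] = 0) :
    (1 - lft ι f) * geom ι f = 1 := by
  have h := congrArg (Conv.pull f) (lft_proj_mul_uni ι)
  rwa [map_mul, map_sub, map_one, pull_lft, pull_proj hf] at h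

theorem geom_mul_one_sub (ι : W →ₗ[R] S) {f : List V → W} (hf : f [] = 0) :
    geom ι f * (1 - lft ι f) = 1 := by
  have h := congrArg (Conv.pull f) (uni_mul_lft_proj ι)
  rwa [map_mul, map_sub, map_one, pull_lft, pull_proj hf] at h

theorem geom_nil (ι : W →ₗ[R] S) (f : List V → W) : geom ι f [] = 1 := rfl

/-- Both sides are inverse to `1 - lft ι (pull g f)`. -/
theorem pull_geom (ι : Y →ₗ[R] S) (g : List V → W) {f : List W → Y} (hf : f [] = 0) :
    Conv.pull g (geom ι f) = geom ι (pull g f) := by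
  have h := congrArg (Conv.pull g) (geom_mul_one_sub ι hf)
  rw [map_mul, map_sub, map_one, pull_lft] at h
  have h' := one_sub_mul_geom ι (f := pull g f) hf
  exact left_inv_eq_right_inv h h'

/-- The rule for the derivative of an inverse: the twisted derivation is applied to `(1 - lft ι g) *
geom ι g = 1`. -/
theorem cod_geom (ι : Y →ₗ[R] S) {p η f : List V → W} {g : List W → Y} (hg : g [] = 0) :
    Conv.cod p η f (geom ι g)
      = geom ι (pull p g) * lft ι (cod p η f g) * geom ι (pull f g) := by
  have h := congrArg (Conv.cod p η f) (one_sub_mul_geom ι hg)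
  rw [Conv.cod_mul, Conv.cod_one, map_sub, map_sub, map_one, Conv.cod_one, pull_lft, cod_lft,
    zero_sub, neg_mul, add_neg_eq_zero, pull_geom ι f hg] at h
  have h' := congrArg (fun X => geom ι (pull p g) * X) h
  simp only [← mul_assoc] at h'
  rwa [geom_mul_one_sub ι (f := pull p g) hg, one_mul] at h'

/-- The resolvent identity `a⁻¹ - b⁻¹ = b⁻¹ (b - a) a⁻¹`. -/
theorem geom_sub_geom (ι : W →ₗ[R] S) {f f' : List V → W} (hf : f [] = 0) (hf' : f' [] = 0) :
    geom ι f - geom ι f' = geom ι f' * lft ι (fun l => f l - f' l) * geom ι f := by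
  rw [lft_sub]
  have h : lft ι f - lft ι f' = (1 - lft ι f') - (1 - lft ι f) := by abel
  rw [h, mul_sub, sub_mul, geom_mul_one_sub ι hf', one_mul, mul_assoc, one_sub_mul_geom ι hf,
    mul_one]

end ringhom

section identities

variable {R V W Y U : Type*} [CommRing R] [AddCommGroup V] [Module R V] [AddCommGroup W]
  [Module R W] [AddCommGroup Y] [Module R Y] [AddCommGroup U] [Module R U]
  {S : Type*} [Ring S] [_root_.Algebra R S]

theorem geom_proj (ι : W →ₗ[R] S) : geom ι (proj W) = uni ι := by
  have h := one_sub_mul_geom ι (f := proj W) rfl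
  exact (left_inv_eq_right_inv (uni_mul_lft_proj ι) h).symm

theorem pull_proj_left {f : List V → W} (hf : MultiLin R f) : pull (proj V) f = f :=
  funext fun l => (pull_single_left (R := R) LinearMap.id hf l).trans (by simp)

variable {ι : W →ₗ[R] S} {ev : S →ₗ[R] U} {θ : List W → U}

/-- The list operations are natural for additive maps, so an identity for `uni ι` in the convolution
ring yields, after `ev`, the identity for the given multilinear function. -/
theorem ev_pull (h : ∀ l, ev ((l.map ι).prod) = θ l) (f : List V → W) (l : List V) :
    pull f θ l = ev (geom ι f l) := by
  rw [show θ = fun l => ev ((l.map ι).prod) from funext fun l => (h l).symm]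
  exact pull_map ev.toAddMonoidHom f (uni ι) l

theorem ev_cod_eq (h : ∀ l, ev ((l.map ι).prod) = θ l) (p η f : List V → W) (l : List V) :
    cod p η f θ l = ev (Conv.cod p η f (uni ι) l) := by
  rw [show θ = fun l => ev ((l.map ι).prod) from funext fun l => (h l).symm]
  exact cod_map ev.toAddMonoidHom p η f (uni ι) l

theorem cod_uni {p η f : List V → W} (hp : p [] = 0) (hη : η [] = 0) (hf : f [] = 0) :
    Conv.cod p η f (uni ι) = geom ι p * lft ι η * geom ι f := by
  rw [← geom_proj, cod_geom ι rfl, pull_proj hp, pull_proj hf, cod_proj hη]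

theorem ev_cod (h : ∀ l, ev ((l.map ι).prod) = θ l) {p η f : List V → W} (hp : p [] = 0)
    (hη : η [] = 0) (hf : f [] = 0) (l : List V) :
    cod p η f θ l = ev ((geom ι p * lft ι η * geom ι f) l) := by
  rw [ev_cod_eq h, cod_uni hp hη hf]

end identities

/-! ### Identities between coderivations, coalgebra maps and homotopies -/

section bianchi

variable {R : Type u} {V : Type v} {V' : Type*} {W : Type v} {U : Type w} [CommRing R] [AddCommGroup V]
  [Module R V] [AddCommGroup V'] [Module R V'] [AddCommGroup W]
  [Module R W] [AddCommGroup U] [Module R U]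
  {eV : V →ₗ[R] V} {eW : W →ₗ[R] W}

theorem pull_pull {g : List V → V'} {f : List V' → W} (hf : f [] = 0) {θ : List W → U}
    (hθ : MultiLin R θ) : pull g (pull f θ) = pull (pull g f) θ := by
  obtain ⟨S, _, _, ι, ev, h⟩ := exists_universal hθ
  have h1 : pull f θ = fun l => ev (geom ι f l) := funext (ev_pull h f)
  funext l
  rw [h1, ev_pull h, ← pull_geom ι g hf]
  exact pull_map ev.toAddMonoidHom g (geom ι f) l

/-- The coderivation of the tensor coalgebra with component `m` and grading involution `e`, acting
on functions on lists. -/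
abbrev coder {U : Type*} [AddCommGroup U] (e : V → V) (m : List V → V) (θ : List V → U) :
    List V → U := cod (single e) m (proj V) θ

theorem coder_uni {S : Type*} [Ring S] [_root_.Algebra R S] (ι : W →ₗ[R] S) (e : W →ₗ[R] W)
    {m : List W → W} (hm : m [] = 0) :
    Conv.cod (single e) m (proj W) (uni ι) = geom ι (single e) * lft ι m * uni ι := by
  rw [cod_uni rfl hm rfl, geom_proj]

theorem coder_geom {S : Type*} [Ring S] [_root_.Algebra R S] (ι : W →ₗ[R] S)
    {m : List V → V} {f : List V → W} (hf0 : f [] = 0) (hf : MultiLin R f) :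
    Conv.cod (single eV) m (proj V) (geom ι f)
      = geom ι (fun l => f (l.map eV)) * lft ι (coder eV m f) * geom ι f := by
  have h : pull (single eV) f = fun l => f (l.map eV) := funext (pull_single_left eV hf)
  rw [cod_geom ι hf0, pull_proj_left hf, h]

/-- A family of operations commutes with coderivations up to the coderivation along it that is
given by its defect. -/
theorem pull_coder {m : List W → W} {m' : List V → V} {f : List V → W}
    (hm0 : m [] = 0) (hf0 : f [] = 0) (hf : MultiLin R f)
    (hfe : ∀ l, f (l.map eV) = eW (f l)) {θ : List W → U} (hθ : MultiLin R θ) (l : List V) :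
    pull f (coder eW m θ) l = coder eV m' (pull f θ) l
      + cod (fun l => eW (f l)) (fun l => pull f m l - coder eV m' f l) f θ l := by
  obtain ⟨S, _, _, ι, ev, h⟩ := exists_universal hθ
  have h1 : coder eW m θ = fun l => ev ((geom ι (single eW) * lft ι m * uni ι) l) :=
    funext fun l => by rw [coder, ev_cod_eq h, coder_uni ι eW hm0]
  have h2 : pull f θ = fun l => ev (geom ι f l) := funext (ev_pull h f)
  have hE : pull f m [] - coder eV m' f [] = 0 := by simp [pull, cod, hm0]
  rw [ev_cod h (by simp [hf0]) hE hf0, h1, h2]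
  have e1 := pull_map ev.toAddMonoidHom f (geom ι (single eW) * lft ι m * uni ι) l
  have e2 := cod_map ev.toAddMonoidHom (single eV) m' (proj V) (geom ι f) l
  refine e1.trans ?_
  rw [coder]
  refine Eq.trans ?_ (congrArg (fun z => z + _) e2.symm)
  -- Both sides are now values of `ev`. The two products `geom * (middle factor) * geom` have the
  -- same outer factors because `f` commutes with the involutions; they differ only in the middle,
  -- by the defect.
  change ev (Conv.pull f (geom ι (single eW) * lft ι m * uni ι) l)
    = ev (Conv.cod (single eV) m' (proj V) (geom ι f) l) + _
  rw [coder_geom ι hf0 hf, ← map_add, ← Conv.add_apply, map_mul, map_mul, pull_lft,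
    pull_geom ι f (by rfl), lft_sub]
  have h3 : pull f (single eW) = fun l => eW (f l) := pull_single_right hf0 eW.toAddMonoidHom
  rw [h3, show Conv.pull f (uni ι) = geom ι f from rfl, funext hfe]
  refine congrArg ev (congrFun ?_ l)
  simp only [mul_sub, sub_mul]
  abel

/-- The square of a coderivation. -/
theorem coder_coder {m : List V → V} (hm0 : m [] = 0) (hm : MultiLin R m)
    (he : ∀ x, eV (eV x) = x) (hme : ∀ l, m (l.map eV) = -eV (m l))
    {θ : List V → U} (hθ : MultiLin R θ) (l : List V) :
    coder eV m (coder eV m θ) l = cod (proj V) (coder eV m m) (proj V) θ l := by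
  obtain ⟨S, _, _, ι, ev, h⟩ := exists_universal hθ
  have h1 : coder eV m θ = fun l => ev ((geom ι (single eV) * lft ι m * uni ι) l) :=
    funext fun l => by rw [coder, ev_cod_eq h, coder_uni ι eV hm0]
  rw [h1, ev_cod h (by rfl) (by rfl) (by rfl)]
  have e1 := cod_map ev.toAddMonoidHom (single eV) m (proj V)
    (geom ι (single eV) * lft ι m * uni ι) l
  refine e1.trans (congrArg ev ?_)
  change Conv.cod (single eV) m (proj V) (geom ι (single eV) * lft ι m * uni ι) l = _
  have h2 : pull (single eV) (single eV) = proj V :=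
    funext fun l => by
      rw [pull_single_left eV (multiLin_single eV)]
      match l with
      | [] => rfl
      | [x] => exact he x
      | _ :: _ :: _ => rfl
  have h3 : coder eV m (single eV) = fun l => eV (m l) := cod_single_right hm0 eV.toAddMonoidHom
  have h4 : pull (single eV) m = fun l => -eV (m l) :=
    funext fun l => (pull_single_left eV hm l).trans (hme l)
  -- The Leibniz rule produces two terms with two factors `m`. They cancel by the sign in `hme`,
  -- that is because `m` is odd, and only the term with `coder eV m m` survives.
  rw [Conv.cod_mul, Conv.cod_mul, cod_geom ι rfl, coder_uni ι eV hm0, map_mul,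
    pull_geom ι _ (by rfl), h2, pull_lft, h4, cod_lft, pull_lft, pull_proj_left hm]
  simp only [geom_proj]
  rw [show Conv.pull (proj V) (uni ι) = uni ι from geom_proj ι]
  rw [show cod (single eV) m (proj V) (single eV) = fun l => eV (m l) from h3, lft_neg,
    pull_proj_left (multiLin_single eV)]
  refine congrFun ?_ l
  noncomm_ring

theorem coder_sub {U : Type*} [AddCommGroup U] (e : V → V) (m : List V → V) (θ θ' : List V → U)
    (l : List V) : coder e m (fun q => θ q - θ' q) l = coder e m θ l - coder e m θ' l :=
  cod_sub _ _ _ θ θ' l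

/-- For a morphism `f`, a family of operations `p` and a `(p, f)`-homotopy with components `η`, the
commutator of the homotopy with the coderivations is `f - p`, up to the coderivation along `(p, f)`
given by the defect and a term that contains the defect of `p` as a morphism. -/
theorem homotopy_coder {S : Type*} [Ring S] [_root_.Algebra R S] {ι : W →ₗ[R] S} {ev : S →ₗ[R] U}
    {θ : List W → U} (h : ∀ l, ev ((l.map ι).prod) = θ l)
    {m : List W → W} {m' : List V → V} {p η f : List V → W}
    (hm0 : m [] = 0) (hp0 : p [] = 0) (hη0 : η [] = 0) (hf0 : f [] = 0)
    (hm : MultiLin R m) (hp : MultiLin R p) (hη : MultiLin R η) (hf : MultiLin R f)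
    (he : ∀ x, eW (eW x) = x) (hme : ∀ l, m (l.map eW) = -eW (m l))
    (hpe : ∀ l, p (l.map eV) = eW (p l)) (hηe : ∀ l, η (l.map eV) = -eW (η l))
    (hfe : ∀ l, f (l.map eV) = eW (f l)) (hfm : ∀ l, pull f m l = coder eV m' f l) (l : List V) :
    pull f θ l - pull p θ l - cod (fun l => eW (p l)) η f (coder eW m θ) l
        - coder eV m' (cod (fun l => eW (p l)) η f θ) l
      = cod p (fun l => f l - p l - cod (fun l => eW (p l)) η f m l - coder eV m' η l) f θ l
        + ev ((geom ι p * lft ι (fun l => eW (pull p m l - coder eV m' p l)) *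
            (geom ι (fun l => eW (p l)) * lft ι η * geom ι f)) l) := by
  have hp0' : (fun l => eW (p l)) [] = 0 := by simp [hp0]
  have h1 : coder eW m θ = fun l => ev ((geom ι (single eW) * lft ι m * uni ι) l) :=
    funext fun l => by rw [coder, ev_cod_eq h, coder_uni ι eW hm0]
  have h2 : cod (fun l => eW (p l)) η f θ
      = fun l => ev ((geom ι (fun l => eW (p l)) * lft ι η * geom ι f) l) :=
    funext fun l => by rw [ev_cod h hp0' hη0 hf0]
  have hE : (fun l => f l - p l - cod (fun l => eW (p l)) η f m l - coder eV m' η l) [] = 0 := by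
    simp [cod, hf0, hp0]
  rw [ev_cod h hp0 hE hf0, ev_pull h, ev_pull h, h1, h2]
  have e1 := cod_map ev.toAddMonoidHom (fun l => eW (p l)) η f
    (geom ι (single eW) * lft ι m * uni ι) l
  have e2 := cod_map ev.toAddMonoidHom (single eV) m' (proj V)
    (geom ι (fun l => eW (p l)) * lft ι η * geom ι f) l
  refine (congrArg₂ (fun y z => ev (geom ι f l) - ev (geom ι p l) - y - z) e1 e2).trans ?_
  change ev (geom ι f l) - ev (geom ι p l)
    - ev (Conv.cod (fun l => eW (p l)) η f (geom ι (single eW) * lft ι m * uni ι) l)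
    - ev (Conv.cod (single eV) m' (proj V)
        (geom ι (fun l => eW (p l)) * lft ι η * geom ι f) l) = _
  rw [← map_add, ← map_sub, ← map_sub, ← map_sub]
  refine congrArg ev ?_
  have hpp : pull (single eV) (fun l => eW (p l)) = p := funext fun l => by
    rw [pull_single_left eV (hp.comp_left eW), hpe, he]
  have hpη : pull (single eV) η = fun l => -eW (η l) := funext fun l => by
    rw [pull_single_left eV hη, hηe]
  have hpf : pull (single eV) f = fun l => eW (f l) := funext fun l => by
    rw [pull_single_left eV hf, hfe]
  have hps : pull (fun l => eW (p l)) (single eW) = p := by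
    refine (pull_single_right (f := fun l => eW (p l)) hp0' eW.toAddMonoidHom).trans ?_
    exact funext fun l => he _
  have hfs : pull f (single eW) = fun l => eW (f l) := pull_single_right hf0 eW.toAddMonoidHom
  have hcs : cod (fun l => eW (p l)) η f (single eW) = fun l => eW (η l) :=
    cod_single_right hη0 eW.toAddMonoidHom
  have hpm : pull (fun l => eW (p l)) m = fun l => -eW (pull p m l) := by
    have hpe' : (fun l => eW (p l)) = pull p (single eW) :=
      (pull_single_right hp0 eW.toAddMonoidHom).symm
    rw [hpe', ← pull_pull rfl hm]
    rw [show pull (single eW) m = fun l => -eW (m l) from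
      funext fun l => (pull_single_left eW hm l).trans (hme l)]
    exact funext fun l => pull_map (-eW.toAddMonoidHom) p m l
  have hde : cod (single eV) m' (proj V) (fun l => eW (p l))
      = fun l => eW (coder eV m' p l) :=
    funext fun l => cod_map eW.toAddMonoidHom _ _ _ p l
  rw [Conv.cod_mul, Conv.cod_mul, Conv.cod_mul, Conv.cod_mul, cod_geom ι rfl, cod_geom ι hf0,
    cod_geom ι hp0', map_mul, map_mul, pull_geom ι _ rfl, pull_geom ι _ hp0', pull_geom ι _ hf0,
    cod_lft, cod_lft, pull_lft, pull_lft, pull_lft, pull_lft, cod_uni hp0' hη0 hf0, hpp, hpη, hpf, hps, hfs,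
    hcs, hpm, hde, pull_proj_left hη, pull_proj_left hf, pull_proj_left (hp.comp_left eW),
    show Conv.pull f (uni ι) = geom ι f from rfl, funext hfm, lft_neg, lft_neg]
  -- By the resolvent identity the difference of the two pullbacks is `geom ι p * (f - p) * geom ι
  -- f`, which has the shape of a coderivation along `(p, f)` and joins the other terms.
  have hgg := geom_sub_geom ι hf0 hp0
  rw [show lft ι (fun l => eW (pull p m l - coder eV m' p l))
      = lft ι (fun l => eW (pull p m l)) - lft ι (fun l => eW (coder eV m' p l)) from by
    rw [← lft_sub]; simp only [map_sub], lft_sub, lft_sub]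
  rw [← Conv.sub_apply, hgg, lft_sub]
  rw [← Conv.sub_apply, ← Conv.sub_apply, ← Conv.add_apply]
  refine congrFun ?_ l
  simp only [coder]
  noncomm_ring

end bianchi

/-! ### Divisibility estimates -/

section divisible

variable {R U U' : Type*} [CommRing R] [AddCommGroup U] [Module R U] [AddCommGroup U'] [Module R U']

/-- `x` is a multiple of the scalar `r`. -/
def Div (r : R) (x : U) : Prop := ∃ y, x = r • y

namespace Div

variable {r : R} {x y : U}

theorem zero : Div r (0 : U) := ⟨0, by simp⟩

theorem add (hx : Div r x) (hy : Div r y) : Div r (x + y) := by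
  obtain ⟨a, rfl⟩ := hx
  obtain ⟨b, rfl⟩ := hy
  exact ⟨a + b, by simp⟩

theorem neg (hx : Div r x) : Div r (-x) := by
  obtain ⟨a, rfl⟩ := hx
  exact ⟨-a, by simp⟩

theorem sub (hx : Div r x) (hy : Div r y) : Div r (x - y) := by
  rw [sub_eq_add_neg]; exact hx.add hy.neg

theorem map (hx : Div r x) (e : U →ₗ[R] U') : Div r (e x) := by
  obtain ⟨a, rfl⟩ := hx
  exact ⟨e a, by simp⟩

theorem sum {ι : Type*} (s : Finset ι) (g : ι → U) (h : ∀ i ∈ s, Div r (g i)) :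
    Div r (∑ i ∈ s, g i) := by
  classical
  induction s using Finset.induction_on with
  | empty => simpa using Div.zero
  | insert a s ha ih =>
    rw [Finset.sum_insert ha]
    exact (h a (Finset.mem_insert_self a s)).add (ih fun i hi => h i (Finset.mem_insert_of_mem hi))

theorem of_sub_left (h : Div r (x - y)) (hy : Div r y) : Div r x := by
  simpa using h.add hy

theorem trans_sub {z : U} (h : Div r (x - y)) (h' : Div r (y - z)) : Div r (x - z) := by
  simpa using h.add h'

theorem multiLin {V : Type*} [AddCommGroup V] [Module R V] {θ : List V → U} (hθ : MultiLin R θ)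
    {x : V} (hx : Div r x) (p q : List V) : Div r (θ (p ++ x :: q)) := by
  obtain ⟨a, rfl⟩ := hx
  exact ⟨_, hθ.map_smul p q r a⟩

theorem mono {a b : ℕ} (hab : a ≤ b) (h : Div (r ^ b) x) : Div (r ^ a) x := by
  obtain ⟨y, rfl⟩ := h
  exact ⟨r ^ (b - a) • y, by rw [smul_smul, ← pow_add, Nat.add_sub_cancel' hab]⟩

end Div

variable {V W S : Type*} [Ring S] [_root_.Algebra R S] {r : R}

theorem Div.mul_left {x : S} (hx : Div r x) (y : S) : Div r (y * x) := by
  obtain ⟨a, rfl⟩ := hx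
  exact ⟨y * a, by simp⟩

theorem Div.mul_right {x : S} (hx : Div r x) (y : S) : Div r (x * y) := by
  obtain ⟨a, rfl⟩ := hx
  exact ⟨a * y, by simp⟩

theorem div_convMul_of_right (l : List V) : ∀ {Φ Ψ : List V → S},
    (∀ q, q.length ≤ l.length → Div r (Ψ q)) → Div r (convMul l Φ Ψ) := by
  induction l with
  | nil => intro Φ Ψ h; exact (h [] le_rfl).mul_left _
  | cons x l ih =>
    intro Φ Ψ h
    exact ((h _ le_rfl).mul_left _).add (ih fun q hq => h q (hq.trans (by simp)))

/-- The right factor sees the whole list only in the splitting whose left part is empty. -/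
theorem div_convMul_sub_right (l : List V) {Φ Ψ : List V → S}
    (h : ∀ q, q.length < l.length → Div r (Ψ q)) : Div r (convMul l Φ Ψ - Φ [] * Ψ l) := by
  cases l with
  | nil => simpa [convMul] using Div.zero
  | cons x l =>
    simp only [convMul, add_sub_cancel_left]
    exact div_convMul_of_right l fun q hq => h q (Nat.lt_succ_of_le hq)

theorem div_convMul_sub_left (l : List V) : ∀ {Φ Ψ : List V → S},
    (∀ q, q.length < l.length → Div r (Φ q)) → Div r (convMul l Φ Ψ - Φ l * Ψ []) := by
  induction l with
  | nil => intro Φ Ψ _; simpa [convMul] using Div.zero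
  | cons x l ih =>
    intro Φ Ψ h
    simp only [convMul, add_sub_assoc]
    exact ((h [] (by simp)).mul_right _).add (ih fun q hq => h (x :: q) (by simpa using hq))

end divisible

/-! ### Leading terms of pullbacks and coderivations -/

section estimates

variable {R : Type u} {V : Type v} {W : Type v} {U : Type w} [CommRing R] [AddCommGroup V]
  [Module R V] [AddCommGroup W] [Module R W] [AddCommGroup U] [Module R U] {r : R}
  {p p' η f f' : List V → W} {θ : List W → U}

/-- Only the leading term of a coderivation whose components on shorter lists are small matters. -/
theorem cod_lead (hθ : MultiLin R θ) (hp0 : p [] = 0) (hη0 : η [] = 0) (hf0 : f [] = 0)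
    (l : List V) (h : ∀ q, q.length < l.length → Div r (η q)) :
    Div r (cod p η f θ l - θ [η l]) := by
  obtain ⟨S, _, _, ι, ev, hev⟩ := exists_universal hθ
  rw [ev_cod hev hp0 hη0 hf0, show θ [η l] = ev (ι (η l)) by rw [← hev]; simp, ← map_sub]
  refine Div.map ?_ ev
  have h1 : ∀ q, q.length ≤ l.length → Div r ((geom ι p * lft ι η) q - ι (η q)) := by
    intro q hq
    have := div_convMul_sub_right (r := r) q (Φ := geom ι p) (Ψ := lft ι η)
      (fun q' hq' => (h q' (hq'.trans_le hq)).map ι)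
    rwa [geom_nil, one_mul] at this
  have h2 : Div r ((geom ι p * lft ι η * geom ι f) l - (geom ι p * lft ι η) l * geom ι f []) :=
    div_convMul_sub_left l fun q hq => (h1 q hq.le).of_sub_left ((h q hq).map ι)
  rw [geom_nil, mul_one] at h2
  exact h2.trans_sub (h1 l le_rfl)

/-- As `X` vanishes on the empty list, it uses up at least one entry, and `κ` is only evaluated on
strictly shorter lists. -/
theorem div_ev_mul_of_nil {S : Type*} [Ring S] [_root_.Algebra R S] (ι : W →ₗ[R] S) (ev : S →ₗ[R] U)
    (A : Conv V S) (κ : List V → W) {X : Conv V S} (hX : X [] = 0) (l : List V)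
    (h : ∀ q, q.length < l.length → Div r (κ q)) :
    Div r (ev ((A * lft ι κ * X) l)) := by
  refine Div.map ?_ ev
  have h2 : Div r ((A * lft ι κ * X) l - (A * lft ι κ) l * X []) :=
    div_convMul_sub_left l fun q hq => div_convMul_of_right q fun q' hq' =>
      (h q' (hq'.trans_lt hq)).map ι
  rwa [hX, mul_zero, sub_zero] at h2

/-- The resolvent identity again: the difference of two coalgebra maps is a coderivation along the
pair. -/
theorem pull_sub_pull (hθ : MultiLin R θ) (hf0 : f [] = 0) (hf0' : f' [] = 0) (l : List V) :
    pull f' θ l - pull f θ l = cod f (fun l => f' l - f l) f' θ l := by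
  obtain ⟨S, _, _, ι, ev, hev⟩ := exists_universal hθ
  rw [ev_cod hev hf0 (by simp [hf0, hf0']) hf0', ev_pull hev, ev_pull hev, ← map_sub,
    ← Conv.sub_apply, geom_sub_geom ι hf0' hf0]

/-- The change of `geom ι p` contains the factor `p' - p`. The marked piece `η` takes at least one
entry, so this factor sees shorter lists only. -/
theorem div_cod_sub_cod (hθ : MultiLin R θ) (hp0 : p [] = 0) (hp0' : p' [] = 0) (hη0 : η [] = 0)
    (hf0 : f [] = 0) (l : List V) (h : ∀ q, q.length < l.length → Div r (p' q - p q)) :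
    Div r (cod p' η f θ l - cod p η f θ l) := by
  obtain ⟨S, _, _, ι, ev, hev⟩ := exists_universal hθ
  rw [ev_cod hev hp0 hη0 hf0, ev_cod hev hp0' hη0 hf0, ← map_sub, ← Conv.sub_apply, ← sub_mul,
    ← sub_mul, geom_sub_geom ι hp0' hp0, mul_assoc, mul_assoc]
  refine div_ev_mul_of_nil ι ev _ _ ?_ l h
  simp [Conv.mul_nil, lft, hη0]

theorem cod_add_mid (hθ : MultiLin R θ) {χ : List V → W} (hp0 : p [] = 0) (hη0 : η [] = 0)
    (hχ0 : χ [] = 0) (hf0 : f [] = 0) (l : List V) :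
    cod p (fun l => η l + χ l) f θ l = cod p η f θ l + cod p χ f θ l := by
  obtain ⟨S, _, _, ι, ev, hev⟩ := exists_universal hθ
  rw [ev_cod hev hp0 hη0 hf0, ev_cod hev hp0 hχ0 hf0, ev_cod hev hp0 (by simp [hη0, hχ0]) hf0,
    ← map_add, ← Conv.add_apply, lft_add, mul_add, add_mul]

end estimates

/-! ### The explicit form of a coderivation -/

section explicit

variable {R V U : Type*} [CommRing R] [AddCommGroup V] [Module R V] [AddCommGroup U] [Module R U]
  {e : V →ₗ[R] V} {m : List V → V} {θ : List V → U}

/-- The sum of `Θ (χ p :: q)` over all splittings `l = p ++ q`. -/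
def insAux (χ : List V → V) (Θ : List V → U) : List V → U
  | [] => Θ [χ []]
  | y :: l => Θ (χ [] :: y :: l) + insAux (fun q => χ (y :: q)) Θ l

theorem codAux_coder (l : List V) : ∀ {φ χ : List V → V} {Θ : List V → U}, MultiLin R Θ →
    (∀ x q, φ (x :: q) = 0) → codAux (single e) m (proj V) l φ χ Θ
      = coder e m (fun q => Θ (φ [] :: q)) l + insAux χ Θ l := by
  induction l with
  | nil => intro φ χ Θ hΘ hφ; simp [codAux, insAux, coder, cod]
  | cons y l ih =>
    intro φ χ Θ hΘ hφ
    have h1 := ih (φ := fun q => φ (y :: q)) (χ := fun q => χ (y :: q)) hΘ fun x q => hφ _ _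
    rw [show (fun q => Θ (φ [y] :: q)) = fun _ => 0 from funext fun q => by
      rw [hφ]; exact hΘ.map_zero [] q, coder, cod_zero, zero_add] at h1
    have h2 := pull_single_left (LinearMap.id : V →ₗ[R] V) (hΘ.tail (χ [])) (y :: l)
    rw [LinearMap.id_coe, List.map_id] at h2
    rw [codAux, h1, insAux, ← add_assoc]
    exact congrArg (fun z => coder e m (fun q => Θ (φ [] :: q)) (y :: l) + z
      + insAux (fun q => χ (y :: q)) Θ l) h2

/-- The first entry either stays and acquires the sign `e`, or it begins the block that is fed to
`m`. -/
theorem coder_cons (hθ : MultiLin R θ) (x : V) (l : List V) :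
    coder e m θ (x :: l) = coder e m (fun q => θ (e x :: q)) l + insAux (fun q => m (x :: q)) θ l :=
  codAux_coder l hθ fun _ _ => rfl

theorem insAux_eq_sum (l : List V) : ∀ (χ : List V → V) (Θ : List V → U),
    insAux χ Θ l = ∑ s ∈ Finset.range (l.length + 1), Θ (χ (l.take s) :: l.drop s) := by
  induction l with
  | nil => intro χ Θ; simp [insAux]
  | cons y l ih =>
    intro χ Θ
    rw [insAux, ih, List.length_cons, Finset.sum_range_succ' _ (l.length + 1), add_comm]
    rfl

theorem coder_eq_sum (hθ : MultiLin R θ) (l : List V) :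
    coder e m θ l = ∑ r ∈ Finset.range l.length, ∑ s ∈ Finset.range (l.length - r),
      θ ((l.take r).map e ++ m ((l.drop r).take (s + 1)) :: l.drop (r + (s + 1))) := by
  induction l generalizing θ with
  | nil => rfl
  | cons x l ih =>
    rw [coder_cons hθ, ih (hθ.tail _), insAux_eq_sum, List.length_cons]
    refine Eq.trans ?_ (Finset.sum_range_succ' _ l.length).symm
    refine congrArg₂ (fun a b => a + b) (Finset.sum_congr rfl fun r _ => ?_)
      (Finset.sum_congr rfl fun s _ => ?_)
    · rw [Nat.succ_sub_succ]
      refine Finset.sum_congr rfl fun s _ => ?_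
      rw [Nat.succ_add r (s + 1)]
      rfl
    · rw [zero_add]
      rfl

/-- Blocks of length at least two shorten the list and fall under `h`; only blocks of length one
need `h1`. -/
theorem div_coder {r : R} (hθ : MultiLin R θ) (l : List V)
    (h : ∀ q, q.length < l.length → Div r (θ q))
    (h1 : ∀ p x q, p.length + q.length + 1 = l.length → Div r (θ (p ++ m [x] :: q))) :
    Div r (coder e m θ l) := by
  rw [coder_eq_sum hθ]
  refine Div.sum _ _ fun i hi => Div.sum _ _ fun s hs => ?_
  rw [Finset.mem_range] at hi hs
  rcases Nat.eq_zero_or_pos s with rfl | hs0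
  · have : (l.drop i).take (0 + 1) = [l[i]] := by
      rw [List.drop_eq_getElem_cons hi]; rfl
    rw [this]
    refine h1 _ _ _ ?_
    simp only [List.length_map, List.length_take, List.length_drop]
    omega
  · refine h _ ?_
    simp only [List.length_map, List.length_take, List.length_drop, List.length_append,
      List.length_cons]
    omega

end explicit

/-! ### Lists that contain a strict unit -/

section unit

variable {R V W U : Type*} [CommRing R] [AddCommGroup V] [Module R V] [AddCommGroup W] [Module R W]
  [AddCommGroup U] [Module R U]

/-- The strict unit conditions for suspended operations. -/
structure UnitalOp (e : V → V) (m : List V → V) (u : V) : Prop where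
  parity : e u = -u
  one : m [u] = 0
  left : ∀ x, m [u, x] = x
  right : ∀ x, m [x, u] = -e x
  other : ∀ p q, 2 ≤ p.length + q.length → m (p ++ u :: q) = 0

theorem pullAux_congr_cons {f : List V → W} (l : List V) : ∀ {φ : List V → W} {Θ Θ' : List W → U},
    (∀ x q, Θ (x :: q) = Θ' (x :: q)) → pullAux f l φ Θ = pullAux f l φ Θ' := by
  induction l with
  | nil => intro φ Θ Θ' h; exact h _ _
  | cons y l ih =>
    intro φ Θ Θ' h
    rw [pullAux, pullAux, ih h, show (fun q => Θ (φ [] :: q)) = fun q => Θ' (φ [] :: q) from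
      funext fun q => h _ _]

theorem codAux_congr_cons {p η f : List V → W} (l : List V) : ∀ {φ χ : List V → W}
    {Θ Θ' : List W → U}, (∀ x q, Θ (x :: q) = Θ' (x :: q)) →
    codAux p η f l φ χ Θ = codAux p η f l φ χ Θ' := by
  induction l with
  | nil => intro φ χ Θ Θ' h; exact h _ _
  | cons y l ih =>
    intro φ χ Θ Θ' h
    rw [codAux, codAux, ih h, show (fun q => Θ (φ [] :: q)) = fun q => Θ' (φ [] :: q) from
      funext fun q => h _ _, show (fun q => Θ (χ [] :: q)) = fun q => Θ' (χ [] :: q) from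
      funext fun q => h _ _]

theorem pull_congr_cons {f : List V → W} (x : V) (l : List V) {Θ Θ' : List W → U}
    (h : ∀ x q, Θ (x :: q) = Θ' (x :: q)) : pull f Θ (x :: l) = pull f Θ' (x :: l) :=
  pullAux_congr_cons l h

theorem cod_congr_cons {p η f : List V → W} (l : List V) {Θ Θ' : List W → U}
    (h : ∀ x q, Θ (x :: q) = Θ' (x :: q)) : cod p η f Θ l = cod p η f Θ' l := by
  cases l with
  | nil => rfl
  | cons x l => exact codAux_congr_cons l h

theorem pullAux_zero_left {f : List V → W} {Θ : List W → U} (hΘ : MultiLin R Θ) (l : List V) :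
    pullAux f l (fun _ => 0) Θ = 0 := by
  simpa using pullAux_comb (f := f) l (φ := fun _ => 0) (φ' := fun _ => 0) hΘ 1

theorem codAux_zero_left {p η f : List V → W} {Θ : List W → U} (hΘ : MultiLin R Θ) (l : List V) :
    codAux p η f l (fun _ => 0) (fun _ => 0) Θ = 0 := by
  simpa using codAux_comb (p := p) (η := η) (f := f) l (φ := fun _ => 0) (φ' := fun _ => 0)
    (χ := fun _ => 0) (χ' := fun _ => 0) hΘ 1

/-- The open piece cannot grow, so it is closed at once. -/
theorem pullAux_of_supp {f : List V → W} {Θ : List W → U} (hΘ : MultiLin R Θ) (l : List V)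
    {φ : List V → W} (hφ : ∀ x q, φ (x :: q) = 0) :
    pullAux f l φ Θ = pull f (fun q => Θ (φ [] :: q)) l := by
  cases l with
  | nil => rfl
  | cons y l =>
    rw [pullAux, show (fun q => φ (y :: q)) = fun _ => 0 from funext (hφ y),
      pullAux_zero_left hΘ, add_zero]
    rfl

theorem codAux_of_supp {p η f : List V → W} {Θ : List W → U} (hΘ : MultiLin R Θ) (l : List V)
    {φ : List V → W} (hφ : ∀ x q, φ (x :: q) = 0) :
    codAux p η f l φ (fun _ => 0) Θ = cod p η f (fun q => Θ (φ [] :: q)) l := by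
  cases l with
  | nil => exact hΘ.map_zero [] []
  | cons y l =>
    rw [codAux, show (fun q => φ (y :: q)) = fun _ => 0 from funext (hφ y),
      codAux_zero_left hΘ, add_zero, show (fun q => Θ (0 :: q)) = fun _ => 0 from
      funext (hΘ.map_zero []), pullAux_zero, add_zero]
    rfl

theorem pull_single_linear {f : List V → W} (hf : f [] = 0) (e : W →ₗ[R] U) :
    pull f (single e) = fun l => e (f l) := pull_single_right hf e.toAddMonoidHom

theorem cod_single_linear {p η f : List V → W} (hη : η [] = 0) (e : W →ₗ[R] U) :
    cod p η f (single e) = fun l => e (η l) := cod_single_right hη e.toAddMonoidHom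

variable {u : V} {v v' : W}

theorem pullAux_unit {f : List V → W} (hfu : f [u] = v)
    (hf : ∀ p q, p ++ q ≠ [] → f (p ++ u :: q) = 0) (q : List V) (p : List V) :
    ∀ {φ : List V → W} {Θ : List W → U}, MultiLin R Θ → (∀ p q, φ (p ++ u :: q) = 0) →
    pullAux f (p ++ u :: q) φ Θ
      = pullAux f p φ (fun l₁ => pull f (fun l₂ => Θ (l₁ ++ v :: l₂)) q) := by
  induction p with
  | nil =>
    intro φ Θ hΘ hφ
    change pullAux f q (fun q => f (u :: q)) (fun q => Θ (φ [] :: q))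
      + pullAux f q (fun q => φ (u :: q)) Θ = _
    rw [show (fun q => φ (u :: q)) = fun _ => 0 from funext (hφ []),
      pullAux_zero_left hΘ, add_zero, pullAux_of_supp (hΘ.tail _) q, hfu]
    · rfl
    · exact fun x q => hf [] (x :: q) (by simp)
  | cons y p ih =>
    intro φ Θ hΘ hφ
    rw [List.cons_append, pullAux, pullAux, ih hΘ (fun p q => hφ (y :: p) q), ih (hΘ.tail _)]
    · rfl
    · exact fun p q => hf (y :: p) q (by simp)

/-- A piece that contains `u` and another entry contributes zero. Hence `u` is a piece by itself,
and the two sides of it are decomposed independently. -/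
theorem pull_unit {f : List V → W} (hfu : f [u] = v)
    (hf : ∀ p q, p ++ q ≠ [] → f (p ++ u :: q) = 0) (q : List V) (p : List V)
    {Θ : List W → U} (hΘ : MultiLin R Θ) :
    pull f Θ (p ++ u :: q) = pull f (fun l₁ => pull f (fun l₂ => Θ (l₁ ++ v :: l₂)) q) p := by
  cases p with
  | nil =>
    change pullAux f q (fun q => f (u :: q)) Θ = _
    rw [pullAux_of_supp hΘ q, hfu]
    · rfl
    · exact fun x q => hf [] (x :: q) (by simp)
  | cons y p =>
    exact pullAux_unit hfu hf q p hΘ fun p q => hf (y :: p) q (by simp)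

theorem codAux_unit {p' η f : List V → W} (hfu : f [u] = v)
    (hf : ∀ p q, p ++ q ≠ [] → f (p ++ u :: q) = 0) (hpu : p' [u] = v')
    (hp : ∀ p q, p ++ q ≠ [] → p' (p ++ u :: q) = 0) (hη : ∀ p q, η (p ++ u :: q) = 0)
    (q : List V) (p : List V) :
    ∀ {φ χ : List V → W} {Θ : List W → U}, MultiLin R Θ → (∀ p q, φ (p ++ u :: q) = 0) →
    (∀ p q, χ (p ++ u :: q) = 0) → codAux p' η f (p ++ u :: q) φ χ Θ
      = pullAux p' p φ (fun l₁ => cod p' η f (fun l₂ => Θ (l₁ ++ v' :: l₂)) q)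
        + codAux p' η f p φ χ (fun l₁ => pull f (fun l₂ => Θ (l₁ ++ v :: l₂)) q) := by
  induction p with
  | nil =>
    intro φ χ Θ hΘ hφ hχ
    change codAux p' η f q (fun q => p' (u :: q)) (fun q => η (u :: q)) (fun q => Θ (φ [] :: q))
      + pullAux f q (fun q => f (u :: q)) (fun q => Θ (χ [] :: q))
      + codAux p' η f q (fun q => φ (u :: q)) (fun q => χ (u :: q)) Θ = _
    rw [show (fun q => φ (u :: q)) = fun _ => 0 from funext (hφ []),
      show (fun q => χ (u :: q)) = fun _ => 0 from funext (hχ []),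
      codAux_zero_left hΘ, add_zero, pullAux_of_supp (hΘ.tail _) q, hfu,
      show (fun q => η (u :: q)) = fun _ => 0 from funext (hη []), codAux_of_supp (hΘ.tail _), hpu]
    · rfl
    · exact fun x q => hp [] (x :: q) (by simp)
    · exact fun x q => hf [] (x :: q) (by simp)
  | cons y p ih =>
    intro φ χ Θ hΘ hφ hχ
    rw [List.cons_append, codAux, codAux, pullAux,
      ih hΘ (fun p q => hφ (y :: p) q) (fun p q => hχ (y :: p) q), ih (hΘ.tail _),
      pullAux_unit hfu hf q p (hΘ.tail _)]
    · simp only [List.cons_append]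
      abel
    · exact fun p q => hf (y :: p) q (by simp)
    · exact fun p q => hp (y :: p) q (by simp)
    · exact fun p q => hη (y :: p) q

/-- Again `u` is a piece by itself, and it is not the marked one. It is of type `p'` if the marked
piece lies to its right, and of type `f` if it lies to its left. -/
theorem cod_unit {p' η f : List V → W} (hfu : f [u] = v)
    (hf : ∀ p q, p ++ q ≠ [] → f (p ++ u :: q) = 0) (hpu : p' [u] = v')
    (hp : ∀ p q, p ++ q ≠ [] → p' (p ++ u :: q) = 0) (hη : ∀ p q, η (p ++ u :: q) = 0)
    (q : List V) (p : List V) {Θ : List W → U} (hΘ : MultiLin R Θ) :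
    cod p' η f Θ (p ++ u :: q)
      = pull p' (fun l₁ => cod p' η f (fun l₂ => Θ (l₁ ++ v' :: l₂)) q) p
        + cod p' η f (fun l₁ => pull f (fun l₂ => Θ (l₁ ++ v :: l₂)) q) p := by
  cases p with
  | nil =>
    change codAux p' η f q (fun q => p' (u :: q)) (fun q => η (u :: q)) Θ = _
    rw [show (fun q => η (u :: q)) = fun _ => 0 from funext (hη []),
      codAux_of_supp hΘ, hpu]
    · simp [cod, pull]
    · exact fun x q => hp [] (x :: q) (by simp)
  | cons y p =>
    exact codAux_unit hfu hf hpu hp hη q p hΘ (fun p q => hp (y :: p) q (by simp))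
      (fun p q => hη (y :: p) q)

/-- The terms of a morphism equation that contain a strict unit, on the side of the target. -/
theorem pull_unit_op {e : W →ₗ[R] W} {m : List W → W} (hm : MultiLin R m) (hmv : UnitalOp e m v)
    {f : List V → W} (hf0 : f [] = 0) (hfu : f [u] = v)
    (hf : ∀ p q, p ++ q ≠ [] → f (p ++ u :: q) = 0) (p q : List V) :
    pull f m (p ++ u :: q)
      = (if p = [] then f q else 0) - (if p ≠ [] ∧ q = [] then e (f p) else 0) := by
  rw [pull_unit hfu hf q p hm]
  cases p with
  | nil =>
    have : (fun l₂ => m ([] ++ v :: l₂)) = proj W := funext fun l => by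
      match l with
      | [] => exact hmv.one
      | [x] => exact hmv.left x
      | x :: y :: l => exact hmv.other [] (x :: y :: l) (by simp)
    rw [pull, this, pull_proj hf0]
    simp
  | cons y p =>
    -- With at least one piece in front of `v`, only the product `m [x, v]` survives, and this
    -- requires `q` to be empty.
    have h2 : ∀ x l, pull f (fun l₂ => m ((x :: l) ++ v :: l₂)) q
        = single (if q = [] then -e else 0 : W →ₗ[R] W) (x :: l) := by
      intro x l
      cases q with
      | nil =>
        cases l with
        | nil => simpa [pull] using hmv.right x
        | cons z l => exact hmv.other (x :: z :: l) [] (by simp)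
      | cons z q =>
        rw [pull_eq_zero_of_cons]
        · cases l <;> simp
        · exact fun x' q' => hmv.other (x :: l) (x' :: q') (by simp; omega)
    rw [pull_congr_cons y p h2,
      pull_single_linear hf0 (if q = [] then -e else 0 : W →ₗ[R] W)]
    by_cases hq : q = [] <;> simp [hq]

/-- The value `-v` of `p'` at `u` is what the suspended parity makes of the unit: in the application
`p'` is a strictly unitary morphism followed by the sign. -/
theorem cod_unit_op {e : W →ₗ[R] W} {m : List W → W} (hm : MultiLin R m) (hmv : UnitalOp e m v)
    {p' η f : List V → W} (hη0 : η [] = 0) (hfu : f [u] = v)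
    (hf : ∀ p q, p ++ q ≠ [] → f (p ++ u :: q) = 0) (hpu : p' [u] = -v)
    (hp : ∀ p q, p ++ q ≠ [] → p' (p ++ u :: q) = 0) (hη : ∀ p q, η (p ++ u :: q) = 0)
    (p q : List V) :
    cod p' η f m (p ++ u :: q)
      = -(if p = [] then η q else 0) - (if q = [] then e (η p) else 0) := by
  rw [cod_unit hfu hf hpu hp hη q p hm]
  have h2 : ∀ x l, pull f (fun l₂ => m ((x :: l) ++ v :: l₂)) q
      = single (if q = [] then -e else 0 : W →ₗ[R] W) (x :: l) := by
    intro x l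
    cases q with
    | nil =>
      cases l with
      | nil => simpa [pull] using hmv.right x
      | cons z l => exact hmv.other (x :: z :: l) [] (by simp)
    | cons z q =>
      rw [pull_eq_zero_of_cons]
      · cases l <;> simp
      · exact fun x' q' => hmv.other (x :: l) (x' :: q') (by simp; omega)
  rw [cod_congr_cons p h2,
    cod_single_linear hη0 (if q = [] then -e else 0 : W →ₗ[R] W)]
  have h3 : (if q = [] then -e else 0 : W →ₗ[R] W) (η p)
      = -(if q = [] then e (η p) else 0) := by
    by_cases hq : q = [] <;> simp [hq]
  beta_reduce
  rw [h3, ← sub_eq_add_neg]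
  congr 1
  have h4 : ∀ l₁ l₂, m (l₁ ++ -v :: l₂) = -m (l₁ ++ v :: l₂) := fun l₁ l₂ => hm.map_neg l₁ l₂ v
  cases p with
  | nil =>
    have : (fun l₂ => m ([] ++ -v :: l₂)) = single (-LinearMap.id : W →ₗ[R] W) :=
      funext fun l => by
        rw [h4]
        match l with
        | [] => simp [hmv.one]
        | [x] => simp [hmv.left x]
        | x :: y :: l => simpa using hmv.other [] (x :: y :: l) (by simp)
    rw [pull, this, cod_single_linear hη0 (-LinearMap.id : W →ₗ[R] W)]
    simp
  | cons y p =>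
    rw [pull_eq_zero_of_cons]
    · simp
    · intro x l
      refine cod_eq_zero_of_cons q fun x' q' => ?_
      rw [h4, hmv.other (x :: l) (x' :: q') (by simp; omega), neg_zero]

/-- A block that misses the leading `u` leaves it in a longer list, where `θ` vanishes; among the
blocks through `u` only `m [u, y] = y` survives. -/
theorem coder_unit_left {e : V →ₗ[R] V} {m : List V → V} (hmu : UnitalOp e m u) {θ : List V → U}
    (hθ : MultiLin R θ) (hu : ∀ p q, p ++ q ≠ [] → θ (p ++ u :: q) = 0) (q : List V) :
    coder e m θ (u :: q) = if q = [] then 0 else θ q := by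
  rw [coder_cons hθ, coder, cod_eq_zero_of_cons, zero_add]
  · cases q with
    | nil =>
      change θ [m [u]] = _
      rw [hmu.one]; simpa using hθ.map_zero [] []
    | cons y q =>
      rw [insAux, hmu.one]
      have h0 := hθ.map_zero [] (y :: q)
      rw [List.nil_append] at h0
      rw [h0, zero_add]
      cases q with
      | nil =>
        change θ [m [u, y]] = _
        rw [hmu.left]; simp
      | cons z q =>
        rw [insAux, hmu.left, insAux_eq_sum, Finset.sum_eq_zero]
        · simp
        · intro s _
          have := hmu.other [] (y :: z :: (q.take s)) (by simp)
          rw [List.nil_append] at this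
          change θ (m (u :: y :: z :: q.take s) :: q.drop s) = 0
          rw [this]
          exact hθ.map_zero [] _
  · intro x q'
    rw [hmu.parity]
    have := hθ.map_neg [] (x :: q') u
    have h2 := hu [] (x :: q') (by simp)
    simp only [List.nil_append] at this h2
    rw [this, h2, neg_zero]

/-- The products of `u` with its left and with its right neighbour cancel. If `u` is the last entry
there is no right neighbour, and one term remains. -/
theorem coder_unit {e : V →ₗ[R] V} {m : List V → V} (hmu : UnitalOp e m u) (q : List V)
    (p : List V) : ∀ {θ : List V → U}, MultiLin R θ → (∀ p q, p ++ q ≠ [] → θ (p ++ u :: q) = 0) →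
    p ≠ [] → coder e m θ (p ++ u :: q) = if q = [] then -θ (p.map e) else 0 := by
  have hm0 : ∀ (θ : List V → U), MultiLin R θ → ∀ l, θ (0 :: l) = 0 := fun θ hθ l =>
    hθ.map_zero [] l
  induction p with
  | nil => intro θ _ _ h; exact absurd rfl h
  | cons x p ih =>
    intro θ hθ hu _
    rw [List.cons_append, coder_cons hθ]
    cases p with
    | nil =>
      rw [List.nil_append, coder_unit_left hmu (hθ.tail _) (fun p q _ => hu (e x :: p) q (by simp)),
        insAux]
      have h1 := hu [m [x]] q (by simp)
      rw [List.singleton_append] at h1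
      rw [h1, zero_add]
      have h2 : insAux (fun q => m (x :: u :: q)) θ q = -θ (e x :: q) := by
        have h3 := hθ.map_neg [] q (e x)
        rw [List.nil_append, List.nil_append] at h3
        cases q with
        | nil =>
          rw [insAux, hmu.right]
          exact h3
        | cons z q =>
          rw [insAux, hmu.right, h3, insAux_eq_sum, Finset.sum_eq_zero, add_zero]
          intro s _
          have := hmu.other [x] (z :: q.take s) (by simp; omega)
          rw [List.singleton_append] at this
          rw [this, hm0 _ hθ]
      rw [h2]
      by_cases hq : q = [] <;> simp [hq]
    | cons y p =>
      rw [ih (hθ.tail _) (fun p q _ => hu (e x :: p) q (by simp)) (by simp), insAux_eq_sum,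
        Finset.sum_eq_zero, add_zero]
      · rfl
      · intro s _
        -- Either the block ends before `u`, which then survives inside a longer list, or it
        -- contains `x`, `y` and `u`, hence at least three entries.
        rcases le_or_gt s (y :: p).length with hs | hs
        · rw [List.drop_append_of_le_length hs]
          exact hu (m (x :: ((y :: p) ++ u :: q).take s) :: (y :: p).drop s) q (by simp)
        · have : ((y :: p) ++ u :: q).take s = (y :: p) ++ u :: q.take (s - (y :: p).length - 1) := by
            rw [List.take_append, List.take_of_length_le hs.le]
            congr 1
            obtain ⟨t, ht⟩ : ∃ t, s - (y :: p).length = t + 1 := ⟨s - (y :: p).length - 1, by omega⟩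
            rw [ht]
            rfl
          have h4 := hmu.other (x :: y :: p) (q.take (s - (y :: p).length - 1)) (by simp; omega)
          rw [List.cons_append] at h4
          rw [this, h4, hm0 _ hθ]

end unit

/-! ### Homogeneous lists, signs and suspension -/

section graded

variable {k R V W U : Type*} [CommRing k] [CommRing R] [AddCommGroup V] [Module k V] [Module R V]
  [AddCommGroup W] [Module k W] [Module R W] [AddCommGroup U] [Module R U]
  {gr : ℤ × ℤ → Submodule k V} {gr' : ℤ × ℤ → Submodule k W}

/-- The entries of `l` are homogeneous, of bidegrees `ds`. -/
abbrev HomList (gr : ℤ × ℤ → Submodule k V) (l : List V) (ds : List (ℤ × ℤ)) : Prop :=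
  List.Forall₂ (fun a d => a ∈ gr d) l ds

/-- `e` multiplies the elements of cohomological degree `n` by `(-1)^n`. -/
def IsParity (gr : ℤ × ℤ → Submodule k V) (e : V → V) : Prop :=
  ∀ d, ∀ a ∈ gr d, e a = (totalDeg d).negOnePow • a

/-- The sum of the cohomological degrees. -/
def degSum : List (ℤ × ℤ) → ℤ
  | [] => 0
  | d :: ds => totalDeg d + degSum ds

/-- The exponent of the suspension sign. -/
def tau : List (ℤ × ℤ) → ℤ
  | [] => 0
  | d :: ds => ds.length * totalDeg d + tau ds

theorem degSum_append (ds ds' : List (ℤ × ℤ)) : degSum (ds ++ ds') = degSum ds + degSum ds' := by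
  induction ds with
  | nil => simp [degSum]
  | cons d ds ih => simp [degSum, ih, add_assoc]

theorem tau_append (ds ds' : List (ℤ × ℤ)) :
    tau (ds ++ ds') = tau ds + tau ds' + ds'.length * degSum ds := by
  induction ds with
  | nil => simp [tau, degSum]
  | cons d ds ih => simp only [List.cons_append, tau, degSum, ih, List.length_append]; push_cast; ring

theorem totalDeg_add (a b : ℤ × ℤ) : totalDeg (a + b) = totalDeg a + totalDeg b := by
  simp only [totalDeg, Prod.fst_add, Prod.snd_add]; ring

theorem totalDeg_sub (a b : ℤ × ℤ) : totalDeg (a - b) = totalDeg a - totalDeg b := by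
  simp only [totalDeg, Prod.fst_sub, Prod.snd_sub]; ring

theorem totalDeg_smul (n : ℤ) (a : ℤ × ℤ) : totalDeg (n • a) = n * totalDeg a := by
  simp only [totalDeg, Prod.smul_fst, Prod.smul_snd, smul_eq_mul]; ring

theorem totalDeg_sum (ds : List (ℤ × ℤ)) : totalDeg ds.sum = degSum ds := by
  induction ds with
  | nil => rfl
  | cons d ds ih => rw [List.sum_cons, totalDeg_add, ih, degSum]

theorem unit_smul_mem (z : ℤˣ) {d : ℤ × ℤ} {a : V} (ha : a ∈ gr d) : z • a ∈ gr d := by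
  rcases Int.units_eq_one_or z with rfl | rfl
  · simpa using ha
  · simpa using ha

theorem MultiLin.map_units {θ : List V → U} (h : MultiLin R θ) (p q : List V) (z : ℤˣ) (x : V) :
    θ (p ++ (z • x) :: q) = z • θ (p ++ x :: q) := by
  rcases Int.units_eq_one_or z with rfl | rfl
  · simp
  · simp [h.map_neg]

/-- The `i`-th entry from the end is acted on by the `i`-th power of `e`. -/
def twist (e : V → V) : List V → List V
  | [] => []
  | x :: l => e^[l.length] x :: twist e l

@[simp] theorem twist_length (e : V → V) (l : List V) : (twist e l).length = l.length := by
  induction l with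
  | nil => rfl
  | cons x l ih => simp [twist, ih]

theorem iterate_parity {e : V →ₗ[R] V} (he : IsParity gr e) {d : ℤ × ℤ} {a : V} (ha : a ∈ gr d)
    (n : ℕ) : e^[n] a = ((n : ℤ) * totalDeg d).negOnePow • a := by
  induction n with
  | zero => simp
  | succ n ih =>
    rw [Function.iterate_succ_apply', ih, he d _ (unit_smul_mem _ ha), smul_smul,
      ← Int.negOnePow_add]
    congr 2
    push_cast; ring

theorem MultiLin.twist {θ : List V → U} (h : MultiLin R θ) (e : V →ₗ[R] V) :
    MultiLin R (fun l => θ (twist e l)) := by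
  intro p q c x y
  induction p generalizing θ with
  | nil =>
    simp only [List.nil_append, AInf.twist]
    rw [← Module.End.pow_apply, _root_.map_add, _root_.map_smul, h.head]
    simp only [← Module.End.pow_apply]
  | cons z p ih =>
    simp only [List.cons_append, AInf.twist, List.length_append, List.length_cons]
    exact ih (h.tail _)

theorem twist_eq {θ : List V → U} (h : MultiLin R θ) {e : V →ₗ[R] V} (he : IsParity gr e)
    {l : List V} {ds : List (ℤ × ℤ)} (hl : HomList gr l ds) :
    θ (twist e l) = (tau ds).negOnePow • θ l := by
  induction hl generalizing θ with
  | nil => simp [tau, twist]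
  | @cons x d l ds hx hl ih =>
    rw [twist, ih (h.tail _), iterate_parity he hx]
    have := h.map_units [] l ((l.length : ℤ) * totalDeg d).negOnePow x
    rw [List.nil_append, List.nil_append] at this
    rw [this, smul_smul, ← Int.negOnePow_add, hl.length_eq, tau, add_comm]

/-- The operator `-e` is the parity of the suspension, where every degree is lowered by one; this
accounts for the length in the exponent. -/
theorem map_neg_parity {θ : List V → U} (h : MultiLin R θ) {e : V →ₗ[R] V} (he : IsParity gr e)
    {l : List V} {ds : List (ℤ × ℤ)} (hl : HomList gr l ds) (q : List V) :
    θ (l.map (-e) ++ q) = (degSum ds - ds.length).negOnePow • θ (l ++ q) := by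
  induction hl generalizing θ with
  | nil => simp [degSum]
  | @cons x d l ds hx hl ih =>
    rw [List.map_cons, List.cons_append, ih (h.tail _), LinearMap.neg_apply, he d x hx]
    have h1 := h.map_units [] (l ++ q) (totalDeg d - 1).negOnePow x
    rw [List.nil_append, List.nil_append] at h1
    have h2 : -((totalDeg d).negOnePow • x) = (totalDeg d - 1).negOnePow • x := by
      rw [Int.negOnePow_sub, Int.negOnePow_one]; simp
    rw [h2, h1, smul_smul, ← Int.negOnePow_add, degSum, List.cons_append, List.length_cons]
    congr 2
    push_cast; ring

theorem homList_map_neg {e : V →ₗ[R] V} (he : IsParity gr e)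
    {l : List V} {ds : List (ℤ × ℤ)} (hl : HomList gr l ds) : HomList gr (l.map (-e)) ds := by
  induction hl with
  | nil => exact List.Forall₂.nil
  | cons hx hl ih =>
    refine List.Forall₂.cons ?_ ih
    rw [LinearMap.neg_apply, he _ _ hx]
    exact (gr _).neg_mem (unit_smul_mem _ hx)

theorem homList_twist {e : V →ₗ[R] V} (he : IsParity gr e)
    {l : List V} {ds : List (ℤ × ℤ)} (hl : HomList gr l ds) : HomList gr (twist e l) ds := by
  induction hl with
  | nil => exact List.Forall₂.nil
  | cons hx hl ih =>
    refine List.Forall₂.cons ?_ ih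
    rw [iterate_parity he hx]
    exact unit_smul_mem _ hx

/-- The bidegree of `m_n`, `f_n`, … drops by `σ = (s, 1 - s)` with every argument: on lists of length
`n` the function `θ` is homogeneous of bidegree `δ - n σ`. -/
def Homog (gr : ℤ × ℤ → Submodule k V) (gr' : ℤ × ℤ → Submodule k W) (σ δ : ℤ × ℤ)
    (θ : List V → W) : Prop :=
  ∀ l ds, HomList gr l ds → θ l ∈ gr' (ds.sum + δ - (l.length : ℤ) • σ)

theorem Homog.tail {σ δ : ℤ × ℤ} {θ : List V → W} (h : Homog gr gr' σ δ θ) {x : V} {d : ℤ × ℤ}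
    (hx : x ∈ gr d) : Homog gr gr' σ (δ + d - σ) (fun l => θ (x :: l)) := by
  intro l ds hl
  have := h (x :: l) (d :: ds) (List.Forall₂.cons hx hl)
  convert this using 2
  rw [List.sum_cons, List.length_cons]
  push_cast
  rw [add_smul, one_smul]; abel

theorem Homog.twist {σ δ : ℤ × ℤ} {θ : List V → W} (h : Homog gr gr' σ δ θ) {e : V →ₗ[R] V}
    (he : IsParity gr e) : Homog gr gr' σ δ (fun l => θ (twist e l)) := by
  intro l ds hl
  simpa using h _ _ (homList_twist he hl)

/-! ### Families of functions of finite sequences as functions on lists -/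

/-- A family of functions of finite sequences as a function on lists. -/
def ofList (g : (n : ℕ) → (Fin n → V) → W) (l : List V) : W :=
  g l.length fun i => l.getD i 0

/-- The list `a r, …, a (r + n - 1)`. -/
def seg {T : Type*} (a : ℕ → T) (r n : ℕ) : List T := (List.range n).map fun j => a (r + j)

section seg

variable {T : Type*}

@[simp] theorem seg_length (a : ℕ → T) (r n : ℕ) : (seg a r n).length = n := by simp [seg]

theorem seg_getElem (a : ℕ → T) (r n i : ℕ) (h : i < (seg a r n).length) :
    (seg a r n)[i] = a (r + i) := by simp [seg]

theorem seg_take (a : ℕ → T) (r n s : ℕ) (h : s ≤ n) : (seg a r n).take s = seg a r s := by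
  refine List.ext_getElem (by simp [h]) fun i h1 h2 => ?_
  simp [seg]

theorem seg_drop (a : ℕ → T) (r n s : ℕ) : (seg a r n).drop s = seg a (r + s) (n - s) := by
  refine List.ext_getElem (by simp) fun i h1 h2 => ?_
  simp [seg, add_assoc]

theorem seg_append (a : ℕ → T) (r n n' : ℕ) : seg a r n ++ seg a (r + n) n' = seg a r (n + n') := by
  rw [← List.take_append_drop n (seg a r (n + n')), seg_take _ _ _ _ (by omega), seg_drop,
    Nat.add_sub_cancel_left]

theorem seg_succ (a : ℕ → T) (r n : ℕ) : seg a r (n + 1) = a r :: seg a (r + 1) n := by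
  refine List.ext_getElem (by simp) fun i h1 h2 => ?_
  cases i with
  | zero => simp [seg]
  | succ i => simp [seg, Nat.add_left_comm, Nat.add_comm]

theorem homList_seg {a : ℕ → V} {d : ℕ → ℤ × ℤ} (h : ∀ i, a i ∈ gr (d i)) (r n : ℕ) :
    HomList gr (seg a r n) (seg d r n) := by
  induction n generalizing r with
  | zero => exact List.Forall₂.nil
  | succ n ih =>
    rw [seg_succ, seg_succ]
    exact List.Forall₂.cons (h r) (ih (r + 1))

theorem degSum_seg (d : ℕ → ℤ × ℤ) (r n : ℕ) :
    degSum (seg d r n) = ∑ i ∈ Finset.range n, totalDeg (d (r + i)) := by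
  induction n generalizing r with
  | zero => rfl
  | succ n ih =>
    rw [seg_succ, degSum, ih, Finset.sum_range_succ' _ n, add_comm]
    simp [add_assoc, add_comm 1]

end seg

theorem ofList_eq (g : (n : ℕ) → (Fin n → V) → W) (l : List V) (n : ℕ) (b : ℕ → V)
    (hn : l.length = n) (hb : ∀ i, i < n → l.getD i 0 = b i) :
    ofList g l = g n (fun i => b i) := by
  subst hn
  exact congrArg (g l.length) (funext fun i => hb i i.2)

theorem ofList_seg (g : (n : ℕ) → (Fin n → V) → W) (a : ℕ → V) (r n : ℕ) :
    ofList g (seg a r n) = g n (fun j => a (r + j)) := by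
  refine ofList_eq g _ n (fun j => a (r + j)) (seg_length _ _ _) fun i hi => ?_
  rw [List.getD_eq_getElem _ _ (by simpa using hi), seg_getElem]

theorem multiLin_ofList (g : (n : ℕ) → MultilinearMap R (fun _ : Fin n => V) W) :
    MultiLin R (ofList fun n => g n) := by
  intro p q c x y
  have h : ∀ z : V, ofList (fun n => ⇑(g n)) (p ++ z :: q)
      = g (p.length + (q.length + 1)) (Function.update
        (fun i : Fin (p.length + (q.length + 1)) => (p ++ 0 :: q).getD i 0)
        ⟨p.length, by omega⟩ z) := by
    intro z
    have h1 := ofList_eq (fun n => ⇑(g n)) (p ++ z :: q) (p.length + (q.length + 1))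
      (fun i => (p ++ z :: q).getD i 0) (by simp) (fun i _ => rfl)
    rw [h1]
    congr 1
    funext i
    rcases eq_or_ne i ⟨p.length, by omega⟩ with rfl | hi
    · simp
    · rw [Function.update_of_ne hi]
      have hi' : (i : ℕ) ≠ p.length := fun h => hi (Fin.ext h)
      rcases Nat.lt_or_gt_of_ne hi' with h2 | h2
      · rw [List.getD_append _ _ _ _ h2, List.getD_append _ _ _ _ h2]
      · rw [List.getD_append_right _ _ _ _ h2.le, List.getD_append_right _ _ _ _ h2.le]
        obtain ⟨t, ht⟩ : ∃ t, (i : ℕ) - p.length = t + 1 := ⟨i - p.length - 1, by omega⟩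
        rw [ht]; rfl
  rw [h, h, h, MultilinearMap.map_update_add, MultilinearMap.map_update_smul]

theorem homog_ofList {σ : ℤ × ℤ} {c : ℤ} {g : (n : ℕ) → (Fin n → V) → W}
    (h : ∀ (n : ℕ) (d : Fin n → ℤ × ℤ) (a : Fin n → V), (∀ i, a i ∈ gr (d i)) →
      g n a ∈ gr' (∑ i, d i + (c - (n : ℤ)) • σ)) :
    Homog gr gr' σ (c • σ) (ofList g) := by
  intro l ds hl
  have hlen := hl.length_eq
  have h1 := h l.length (fun i => ds.getD i 0) (fun i => l.getD i 0) (fun i => by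
    rw [List.getD_eq_getElem _ _ i.2, List.getD_eq_getElem _ _ (hlen ▸ i.2)]
    exact hl.get i.2 (hlen ▸ i.2))
  have h2 : ∑ i : Fin l.length, ds.getD i 0 = ds.sum := by
    rw [hlen, ← List.sum_ofFn]
    congr 1
    refine List.ext_getElem (by simp) fun i h1 h2 => ?_
    simp
  rw [h2] at h1
  have h3 : ds.sum + c • σ - (l.length : ℤ) • σ = ds.sum + (c - (l.length : ℤ)) • σ := by
    rw [sub_smul]; abel
  rw [h3]
  exact h1

end graded

/-! ### Insertion sums as coderivations -/

section insertion

variable {k R V W : Type*} [CommRing k] [CommRing R] [AddCommGroup V] [Module k V] [Module R V]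
  [AddCommGroup W] [Module R W] {gr : ℤ × ℤ → Submodule k V}

theorem sum_Icc_one (n : ℕ) (F : ℕ → W) :
    ∑ s ∈ Finset.Icc 1 n, F s = ∑ s ∈ Finset.range n, F (s + 1) := by
  induction n with
  | zero => simp
  | succ n ih => rw [Finset.sum_Icc_succ_top (by omega), ih, Finset.sum_range_succ]

theorem negOnePow_congr {a b : ℤ} (c : ℤ) (h : a - b = 2 * c) : a.negOnePow = b.negOnePow := by
  rw [Int.negOnePow_eq_iff, h]; exact even_two_mul c

/-- Insertion sums are coderivations, up to the suspension signs. -/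
theorem coder_twist_eq_insertionSum {σ : ℤ × ℤ} (hσ : totalDeg σ = 1)
    {g : (n : ℕ) → (Fin n → V) → W} {m : (n : ℕ) → (Fin n → V) → V}
    (hg : MultiLin R (ofList g)) (hm : MultiLin R (ofList m))
    (hmh : Homog gr gr σ ((2 : ℤ) • σ) (ofList m))
    {e : V →ₗ[R] V} (he : IsParity gr e) (n : ℕ) {d : ℕ → ℤ × ℤ} {a : ℕ → V}
    (ha : ∀ i, a i ∈ gr (d i)) :
    coder (-e) (fun l => ofList m (twist e l)) (fun l => ofList g (twist e l)) (seg a 0 n)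
      = (tau (seg d 0 n)).negOnePow • insertionSum g m n d a := by
  have hco := coder_eq_sum (e := -e) (m := fun l => ofList m (twist e l)) (hg.twist e) (seg a 0 n)
  refine hco.trans ?_
  rw [insertionSum, Finset.smul_sum, seg_length]
  refine Finset.sum_congr rfl fun r hr => ?_
  -- From here on the inserted block has length `s + 1`.
  rw [sum_Icc_one, Finset.smul_sum]
  refine Finset.sum_congr rfl fun s hs => ?_
  rw [Finset.mem_range] at hr hs
  rw [seg_take _ _ _ _ hr.le, seg_drop, seg_drop, seg_take _ _ _ _ (by omega), zero_add, zero_add]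
  obtain ⟨t, rfl⟩ : ∃ t, n = r + (s + 1) + t := ⟨n - (r + (s + 1)), by omega⟩
  have e1 : r + (s + 1) + t - (r + (s + 1)) = t := by omega
  have e2 : r + (s + 1) + t - r - (s + 1) = t := by omega
  rw [e1, e2, twist_eq hm he (homList_seg ha r (s + 1))]
  set x := ofList m (seg a r (s + 1)) with hx
  have hxh : x ∈ gr ((seg d r (s + 1)).sum + (2 : ℤ) • σ - ((s + 1 : ℕ) : ℤ) • σ) := by
    have := hmh _ _ (homList_seg ha r (s + 1))
    rwa [seg_length] at this
  set D := (seg d r (s + 1)).sum + (2 : ℤ) • σ - ((s + 1 : ℕ) : ℤ) • σ with hD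
  have hl := (List.rel_append (R := fun a d => a ∈ gr d)) (homList_map_neg he (homList_seg ha 0 r))
    (List.Forall₂.cons (unit_smul_mem (tau (seg d r (s + 1))).negOnePow hxh)
      (homList_seg ha (r + (s + 1)) t))
  rw [twist_eq hg he hl, map_neg_parity hg he (homList_seg ha 0 r), hg.map_units]
  have hval : ofList g (seg a 0 r ++ x :: seg a (r + (s + 1)) t)
      = g (r + 1 + t) (fun i => replaceBlock r (s + 1) a
        (m (s + 1) (fun j => a (r + (j : ℕ)))) (i : ℕ)) := by
    refine ofList_eq g _ _ (replaceBlock r (s + 1) a (m (s + 1) (fun j => a (r + (j : ℕ)))))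
      (by simp; omega) fun i hi => ?_
    rw [replaceBlock]
    split_ifs with h1 h2
    · rw [List.getD_append _ _ _ _ (by simpa using h1), List.getD_eq_getElem _ _ (by simpa using h1),
        seg_getElem, zero_add]
    · rw [List.getD_append_right _ _ _ _ (by simp; omega), seg_length, h2, Nat.sub_self, hx,
        ofList_seg]
      rfl
    · rw [List.getD_append_right _ _ _ _ (by simp; omega), seg_length]
      obtain ⟨j, rfl⟩ : ∃ j, i = r + 1 + j := ⟨i - r - 1, by omega⟩
      rw [show r + 1 + j - r = j + 1 by omega, List.getD_cons_succ,
        List.getD_eq_getElem _ _ (by simp; omega), seg_getElem]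
      congr 1; omega
  rw [hval, smul_smul, smul_smul, smul_smul, ← Int.negOnePow_add, ← Int.negOnePow_add,
    ← Int.negOnePow_add]
  congr 1
  have h1 : seg d 0 (r + (s + 1) + t) = seg d 0 r ++ (seg d r (s + 1) ++ seg d (r + (s + 1)) t) := by
    have := seg_append d 0 r (s + 1 + t)
    rw [zero_add] at this
    rw [seg_append, this, add_assoc]
  have hDt : totalDeg D = degSum (seg d r (s + 1)) + 2 - (s + 1) := by
    rw [hD, totalDeg_sub, totalDeg_add, totalDeg_smul, totalDeg_smul, hσ, totalDeg_sum]
    push_cast; ring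
  have hr0 : ∑ i ∈ Finset.range r, totalDeg (d i) = degSum (seg d 0 r) := by
    rw [degSum_seg]; simp
  rw [h1, tau_append, tau_append, tau_append, tau, hDt, hr0]
  simp only [seg_length, List.length_cons, List.length_append]
  -- The witness is half the difference of the two exponents; `t` is the number of entries behind
  -- the block.
  refine negOnePow_congr ((t : ℤ) - t * (s + 1) - r) ?_
  push_cast
  ring

end insertion

/-! ### Sums over compositions -/

section blocks

variable {V W U : Type*}

/-- Application of `f` to the consecutive pieces of `l` of the given lengths. -/
def blockList (f : List V → W) : List ℕ → List V → List W
  | [], _ => []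
  | b :: bs, l => f (l.take b) :: blockList f bs (l.drop b)

theorem blockList_length (f : List V → W) (bs : List ℕ) (l : List V) :
    (blockList f bs l).length = bs.length := by
  induction bs generalizing l with
  | nil => rfl
  | cons b bs ih => simp [blockList, ih]

/-- Compositions of `n + 1`, sorted by their first block. -/
def consComposition (n : ℕ) (c : Σ i : Fin (n + 1), Composition (n - i)) : Composition (n + 1) where
  blocks := ((c.1 : ℕ) + 1) :: c.2.blocks
  blocks_pos := by
    intro i hi
    rcases List.mem_cons.1 hi with rfl | h
    · omega
    · exact c.2.blocks_pos h
  blocks_sum := by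
    rw [List.sum_cons, c.2.blocks_sum]
    have := c.1.2
    omega

theorem consComposition_bijective (n : ℕ) : Function.Bijective (consComposition n) := by
  constructor
  · rintro ⟨i, c⟩ ⟨j, c'⟩ h
    have h1 := congrArg Composition.blocks h
    simp only [consComposition, List.cons.injEq, add_left_inj] at h1
    obtain ⟨h2, h3⟩ := h1
    have h4 : i = j := Fin.ext h2
    subst h4
    rw [Composition.ext h3]
  · intro c
    have hne : c.blocks ≠ [] := by
      intro h
      have := c.blocks_sum
      rw [h] at this
      simp at this
    obtain ⟨b, bs, hb⟩ := List.exists_cons_of_ne_nil hne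
    have hpos : 0 < b := c.blocks_pos (by rw [hb]; simp)
    have hsum : b + bs.sum = n + 1 := by rw [← List.sum_cons, ← hb, c.blocks_sum]
    refine ⟨⟨⟨b - 1, by omega⟩, ⟨bs, fun {i} hi => c.blocks_pos (by rw [hb]; simp [hi]), ?_⟩⟩, ?_⟩
    · change bs.sum = n - (b - 1)
      omega
    · refine Composition.ext ?_
      refine Eq.trans ?_ hb.symm
      change (b - 1 + 1) :: bs = b :: bs
      rw [Nat.sub_add_cancel hpos]

variable [AddCommGroup U]

theorem sum_composition_succ (n : ℕ) (F : List ℕ → U) :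
    ∑ c : Composition (n + 1), F c.blocks
      = ∑ s ∈ Finset.range (n + 1), ∑ c : Composition (n - s), F ((s + 1) :: c.blocks) := by
  rw [Finset.sum_range, ← Fintype.sum_sigma'
    (f := fun (i : Fin (n + 1)) (c : Composition (n - i)) => F (((i : ℕ) + 1) :: c.blocks))]
  exact (Fintype.sum_bijective _ (consComposition_bijective n) _ _ fun _ => rfl).symm

theorem pullAux_eq_sum (f : List V → W) (l : List V) : ∀ (φ : List V → W) (Θ : List W → U),
    pullAux f l φ Θ = ∑ s ∈ Finset.range (l.length + 1),
      pull f (fun q => Θ (φ (l.take s) :: q)) (l.drop s) := by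
  induction l with
  | nil => intro φ Θ; simp [pullAux, pull]
  | cons y l ih =>
    intro φ Θ
    rw [pullAux, ih (fun q => φ (y :: q)), List.length_cons,
      Finset.sum_range_succ' _ (l.length + 1), add_comm]
    rfl

/-- Both sides are sorted by the length of the first piece. -/
theorem pull_eq_sum (f : List V → W) (n : ℕ) : ∀ (l : List V), l.length = n →
    ∀ (Θ : List W → U), pull f Θ l = ∑ c : Composition n, Θ (blockList f c.blocks l) := by
  induction n using Nat.strong_induction_on with
  | _ n ih =>
    intro l hl Θ
    cases l with
    | nil =>
      obtain rfl : n = 0 := hl.symm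
      have : ∀ c : Composition 0, Θ (blockList f c.blocks []) = Θ [] := by
        intro c
        have h : c.blocks = [] := by
          rcases hb : c.blocks with _ | ⟨b, bs⟩
          · rfl
          · have h1 := c.blocks_sum
            have h2 : 0 < b := c.blocks_pos (by rw [hb]; simp)
            rw [hb, List.sum_cons] at h1
            omega
        rw [h]; rfl
      rw [Finset.sum_congr rfl fun c _ => this c]
      simp [pull, composition_card]
    | cons x l =>
      obtain rfl : n = l.length + 1 := by simpa using hl.symm
      have h1 := sum_composition_succ l.length fun bs => Θ (blockList f bs (x :: l))
      rw [h1, pull, pullAux_eq_sum]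
      refine Finset.sum_congr rfl fun s hs => ?_
      rw [ih (l.length - s) (by omega) (l.drop s) (by simp)]
      rfl

end blocks

/-! ### Block sums as pullbacks: comparison of signs -/

section signs

variable {k R V W U : Type*} [CommRing k] [CommRing R] [AddCommGroup V] [Module k V] [Module R V]
  [AddCommGroup W] [Module k W] [Module R W] [AddCommGroup U] [Module R U]
  {gr : ℤ × ℤ → Submodule k V} {gr' : ℤ × ℤ → Submodule k W}

/-- The exponent of the sign of a term of `blockSum`, where `D` is the total degree of the
arguments that come before. -/
def blockSign (D : ℤ) : List ℕ → List (ℤ × ℤ) → ℤ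
  | [], _ => 0
  | b :: bs, ds => bs.length * ((b : ℤ) - 1) + (1 - (b : ℤ)) * D
      + blockSign (D + degSum (ds.take b)) bs (ds.drop b)

/-- The bidegrees of the values on the pieces. -/
def blockDegs (σ : ℤ × ℤ) : List ℕ → List (ℤ × ℤ) → List (ℤ × ℤ)
  | [], _ => []
  | b :: bs, ds => ((ds.take b).sum + σ - (b : ℤ) • σ) :: blockDegs σ bs (ds.drop b)

/-- The sum of the suspension signs of the pieces. -/
def blockTau : List ℕ → List (ℤ × ℤ) → ℤ
  | [], _ => 0
  | b :: bs, ds => tau (ds.take b) + blockTau bs (ds.drop b)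

theorem blockDegs_length (σ : ℤ × ℤ) (bs : List ℕ) (ds : List (ℤ × ℤ)) :
    (blockDegs σ bs ds).length = bs.length := by
  induction bs generalizing ds with
  | nil => rfl
  | cons b bs ih => simp [blockDegs, ih]

/-- At `D = 0` this says that the suspension signs of the pieces and of their values agree, modulo
2, with the suspension sign of the whole list and the sign in `blockSum`. General `D` is needed for
the induction, as later blocks have arguments in front of them. -/
theorem blockSign_parity {σ : ℤ × ℤ} (hσ : totalDeg σ = 1) (bs : List ℕ) :
    ∀ (D : ℤ) (ds : List (ℤ × ℤ)), ds.length = bs.sum →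
    ∃ c : ℤ, blockTau bs ds + tau (blockDegs σ bs ds) - (tau ds + blockSign D bs ds)
      = D * ((ds.length : ℤ) - bs.length) + 2 * c := by
  induction bs with
  | nil =>
    intro D ds h
    have : ds = [] := List.length_eq_zero_iff.1 h
    subst this
    exact ⟨0, by simp [blockTau, tau, blockDegs, blockSign]⟩
  | cons b bs ih =>
    intro D ds h
    rw [List.sum_cons] at h
    have hdl : (ds.drop b).length = bs.sum := by rw [List.length_drop]; omega
    obtain ⟨c, hc⟩ := ih (D + degSum (ds.take b)) (ds.drop b) hdl
    have h1 : tau ds = tau (ds.take b) + tau (ds.drop b)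
        + (bs.sum : ℤ) * degSum (ds.take b) := by
      conv_lhs => rw [← List.take_append_drop b ds]
      rw [tau_append, hdl]
    have h2 : totalDeg ((ds.take b).sum + σ - (b : ℤ) • σ) = degSum (ds.take b) + 1 - b := by
      rw [totalDeg_sub, totalDeg_add, totalDeg_smul, hσ, totalDeg_sum, mul_one]
    simp only [blockTau, blockDegs, tau, blockSign, blockDegs_length, h1, h2, h, List.length_cons]
    rw [hdl] at hc
    -- The term `bs.length * (1 - b)` occurs in `tau` of the values, and its negative in
    -- `blockSign`; so it appears twice in the difference.
    refine ⟨c + (bs.length : ℤ) * (1 - b), ?_⟩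
    have h3 : blockTau bs (ds.drop b) + tau (blockDegs σ bs (ds.drop b))
        = tau (ds.drop b) + blockSign (D + degSum (ds.take b)) bs (ds.drop b)
          + ((D + degSum (ds.take b)) * ((bs.sum : ℤ) - bs.length) + 2 * c) := by linarith
    clear hdl h ih hc h1
    generalize bs.sum = N at *
    push_cast
    linear_combination h3

theorem homList_take {l : List V} {ds : List (ℤ × ℤ)} (h : HomList gr l ds) (b : ℕ) :
    HomList gr (l.take b) (ds.take b) := List.forall₂_take b h

theorem homList_drop {l : List V} {ds : List (ℤ × ℤ)} (h : HomList gr l ds) (b : ℕ) :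
    HomList gr (l.drop b) (ds.drop b) := List.forall₂_drop b h

theorem homList_blockList {σ : ℤ × ℤ} {f : List V → W} (hf : Homog gr gr' σ σ f) (bs : List ℕ) :
    ∀ {l : List V} {ds : List (ℤ × ℤ)}, HomList gr l ds → bs.sum = l.length →
      HomList gr' (blockList f bs l) (blockDegs σ bs ds) := by
  induction bs with
  | nil => intro l ds _ _; exact List.Forall₂.nil
  | cons b bs ih =>
    intro l ds hl h
    rw [List.sum_cons] at h
    refine List.Forall₂.cons ?_ (ih (homList_drop hl b) (by rw [List.length_drop]; omega))
    have := hf _ _ (homList_take hl b)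
    rwa [List.length_take, min_eq_left (by omega)] at this

theorem blockList_twist {f : List V → W} (hf : MultiLin R f) {e : V →ₗ[R] V} (he : IsParity gr e)
    (bs : List ℕ) : ∀ {l : List V} {ds : List (ℤ × ℤ)} {θ : List W → U}, MultiLin R θ →
    HomList gr l ds → θ (blockList (fun q => f (twist e q)) bs l)
      = (blockTau bs ds).negOnePow • θ (blockList f bs l) := by
  induction bs with
  | nil => intro l ds θ _ _; simp [blockList, blockTau]
  | cons b bs ih =>
    intro l ds θ hθ hl
    have h1 := ih (hθ.tail (f (twist e (l.take b)))) (homList_drop hl b)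
    refine h1.trans ?_
    rw [twist_eq hf he (homList_take hl b)]
    have h2 := hθ.map_units [] (blockList f bs (l.drop b)) (tau (ds.take b)).negOnePow (f (l.take b))
    rw [List.nil_append, List.nil_append] at h2
    rw [h2, smul_smul, ← Int.negOnePow_add, blockTau, add_comm]
    rfl

theorem blockList_getD (f : List V → W) (bs : List ℕ) (z : W) : ∀ (l : List V) (j : ℕ),
    (hj : j < bs.length) → (blockList f bs l).getD j z
      = f ((l.drop (bs.take j).sum).take bs[j]) := by
  induction bs with
  | nil => intro l j hj; simp at hj
  | cons b bs ih =>
    intro l j hj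
    cases j with
    | zero => simp [blockList]
    | succ j =>
      rw [blockList, List.getD_cons_succ, ih _ _ (by simpa using hj), List.drop_drop]
      simp

theorem sum_blockSign (d : ℕ → ℤ × ℤ) (bs : List ℕ) : ∀ (D : ℤ) (o : ℕ),
    ∑ j : Fin bs.length, (((bs.length : ℤ) - 1 - (j : ℕ)) * (((bs[(j : ℕ)] : ℕ) : ℤ) - 1)
      + (1 - ((bs[(j : ℕ)] : ℕ) : ℤ)) * (D + degSum (seg d o (bs.take j).sum)))
      = blockSign D bs (seg d o bs.sum) := by
  induction bs with
  | nil => intro D o; simp [blockSign]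
  | cons b bs ih =>
    intro D o
    have h1 := ih (D + degSum (seg d o b)) (o + b)
    rw [blockSign, List.sum_cons, seg_take _ _ _ _ (by omega), seg_drop, Nat.add_sub_cancel_left,
      ← h1]
    refine (Fin.sum_univ_succ (n := bs.length) _).trans ?_
    refine congrArg₂ (fun x y : ℤ => x + y) ?_ (Finset.sum_congr rfl fun j _ => ?_)
    · simp [seg, degSum]
    · simp only [Fin.val_succ, List.getElem_cons_succ, List.take_succ_cons, List.sum_cons,
        List.length_cons]
      rw [← seg_append, degSum_append]
      push_cast
      ring

/-- Block sums are pullbacks, up to the suspension signs. -/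
theorem pull_twist_eq_blockSum {σ : ℤ × ℤ} (hσ : totalDeg σ = 1)
    {f : (n : ℕ) → (Fin n → V) → W} {m : (n : ℕ) → (Fin n → W) → W}
    (hf : MultiLin R (ofList f)) (hm : MultiLin R (ofList m))
    (hfh : Homog gr gr' σ σ (ofList f))
    {e : V →ₗ[R] V} (he : IsParity gr e) {e' : W →ₗ[R] W} (he' : IsParity gr' e')
    (n : ℕ) {d : ℕ → ℤ × ℤ} {a : ℕ → V} (ha : ∀ i, a i ∈ gr (d i)) :
    pull (fun l => ofList f (twist e l)) (fun l => ofList m (twist e' l)) (seg a 0 n)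
      = (tau (seg d 0 n)).negOnePow • blockSum f m n d a := by
  rw [pull_eq_sum _ n _ (seg_length _ _ _), blockSum, Finset.smul_sum]
  refine Finset.sum_congr rfl fun c _ => ?_
  have hl := homList_seg ha 0 n
  have hsum : c.blocks.sum = (seg a 0 n).length := by rw [seg_length, c.blocks_sum]
  have hft : Homog gr gr' σ σ (fun q => ofList f (twist e q)) := hfh.twist he
  rw [twist_eq hm he' (homList_blockList hft c.blocks hl hsum), blockList_twist hf he c.blocks hm hl]
  have hval : ofList m (blockList (ofList f) c.blocks (seg a 0 n)) = m c.length (fun j =>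
      f (c.blocksFun j) (fun l => a (c.sizeUpTo (j : ℕ) + (l : ℕ)))) := by
    have h1 := ofList_eq m (blockList (ofList f) c.blocks (seg a 0 n)) c.length
      (fun i => (blockList (ofList f) c.blocks (seg a 0 n)).getD i 0)
      (blockList_length _ _ _) fun i _ => rfl
    rw [h1]
    congr 1
    funext j
    have hj : (j : ℕ) < c.blocks.length := j.2
    have h2 : (c.blocks.take j).sum + c.blocks[(j : ℕ)] ≤ n := by
      have h3 := c.sizeUpTo_le (j + 1)
      rwa [c.sizeUpTo_succ hj] at h3
    rw [blockList_getD _ _ _ _ _ hj, seg_drop, seg_take _ _ _ _ (by omega), ofList_seg, zero_add]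
    rfl
  have hsign : (∑ j : Fin c.length, (((c.length : ℤ) - 1 - (j : ℕ)) * ((c.blocksFun j : ℤ) - 1)
      + (1 - (c.blocksFun j : ℤ)) * ∑ i ∈ Finset.range (c.sizeUpTo (j : ℕ)), totalDeg (d i)))
      = blockSign 0 c.blocks (seg d 0 n) := by
    have h1 := sum_blockSign d c.blocks 0 0
    rw [c.blocks_sum] at h1
    rw [← h1]
    refine Finset.sum_congr rfl fun j _ => ?_
    rw [degSum_seg]
    simp only [zero_add]
    rfl
  rw [hval, hsign, smul_smul, smul_smul, ← Int.negOnePow_add, ← Int.negOnePow_add]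
  congr 1
  obtain ⟨x, hx⟩ := blockSign_parity hσ c.blocks 0 (seg d 0 n) (by rw [seg_length, c.blocks_sum])
  refine negOnePow_congr x ?_
  linarith

end signs

/-! ### `A_∞`-algebras and morphisms as functions on lists -/

section translate

variable {k : Type u} {R : Type v} [CommRing k] [CommRing R]
  {V : Type w} [AddCommGroup V] [Module k V] [Module R V] {gr : ℤ × ℤ → Submodule k V}
  {W : Type w} [AddCommGroup W] [Module k W] [Module R W] {gr' : ℤ × ℤ → Submodule k W}
  {U : Type*} [AddCommGroup U] [Module R U]
  {s : ℕ}

/-- By additivity the entries are replaced one after another by homogeneous ones; `p` collects those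
already treated. -/
theorem MultiLin.mem_of_homog {θ : List V → U} (hθ : MultiLin R θ) (hspan : ⨆ d, gr d = ⊤)
    (N : AddSubgroup U) (h : ∀ l ds, HomList gr l ds → θ l ∈ N) (l : List V) : θ l ∈ N := by
  suffices H : ∀ q p ds, HomList gr p ds → θ (p ++ q) ∈ N from H l [] [] List.Forall₂.nil
  intro q
  induction q with
  | nil => intro p ds hp; rw [List.append_nil]; exact h p ds hp
  | cons x q ih =>
    intro p ds hp
    have hx : x ∈ ⨆ d, gr d := by rw [hspan]; trivial
    refine Submodule.iSup_induction gr (motive := fun x => θ (p ++ x :: q) ∈ N) hx ?_ ?_ ?_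
    · intro d y hy
      have := ih (p ++ [y]) (ds ++ [d]) (List.rel_append hp (List.Forall₂.cons hy List.Forall₂.nil))
      rwa [List.append_assoc, List.singleton_append] at this
    · rw [hθ.map_zero]; exact N.zero_mem
    · intro y z hy hz
      rw [hθ.map_add]; exact N.add_mem hy hz

theorem MultiLin.ext_homog {θ θ' : List V → U} (hθ : MultiLin R θ) (hθ' : MultiLin R θ')
    (hspan : ⨆ d, gr d = ⊤) (h : ∀ l ds, HomList gr l ds → θ l = θ' l) (l : List V) :
    θ l = θ' l := by
  have := (hθ.sub hθ').mem_of_homog hspan ⊥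
    (fun l ds hl => by rw [AddSubgroup.mem_bot, h l ds hl, sub_self]) l
  rwa [AddSubgroup.mem_bot, sub_eq_zero] at this

/-- A grading that spans, together with the linear involution that records parities. -/
structure IsGrading (gr : ℤ × ℤ → Submodule k V) (e : V →ₗ[R] V) : Prop where
  parity : IsParity gr e
  span : ⨆ d, gr d = ⊤

theorem exists_seg {l : List V} {ds : List (ℤ × ℤ)} (hl : HomList gr l ds) :
    ∃ (a : ℕ → V) (d : ℕ → ℤ × ℤ), (∀ i, a i ∈ gr (d i)) ∧ l = seg a 0 l.length := by
  have hlen := hl.length_eq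
  refine ⟨fun i => l.getD i 0, fun i => ds.getD i 0, fun i => ?_, ?_⟩
  · by_cases hi : i < l.length
    · simp only [List.getD_eq_getElem _ _ hi, List.getD_eq_getElem _ _ (hlen ▸ hi)]
      exact hl.get hi (hlen ▸ hi)
    · beta_reduce
      rw [List.getD_eq_default _ _ (not_lt.1 hi)]
      exact Submodule.zero_mem _
  · refine List.ext_getElem (by simp) fun i h1 h2 => ?_
    rw [seg_getElem, zero_add, List.getD_eq_getElem _ _ h1]

theorem IsGrading.invol {e : V →ₗ[R] V} (he : IsGrading gr e) (x : V) : e (e x) = x := by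
  have h := MultiLin.ext_homog (R := R) (multiLin_single (e ∘ₗ e))
    (multiLin_single (LinearMap.id : V →ₗ[R] V)) he.span (fun l ds hl => by
      match l, ds, hl with
      | [], _, _ => rfl
      | [x], [d], hl =>
        have hx : x ∈ gr d := by simpa [HomList] using hl
        simp only [single_one, LinearMap.comp_apply, LinearMap.id_apply]
        rw [he.parity d x hx, he.parity d _ (unit_smul_mem _ hx), smul_smul, ← Int.negOnePow_add,
          Int.negOnePow_even _ (Even.add_self _), one_smul]
      | _ :: _ :: _, _, _ => rfl) [x]
  exact h

theorem IsGrading.neg_invol {e : V →ₗ[R] V} (he : IsGrading gr e) (x : V) : (-e) ((-e) x) = x := by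
  simp [he.invol]

theorem iterate_invol {e : V →ₗ[R] V} (he : IsGrading gr e) (n : ℕ) (x : V) :
    e^[n] (e^[n] x) = x := by
  induction n generalizing x with
  | zero => rfl
  | succ n ih =>
    rw [Function.iterate_succ_apply, Function.iterate_succ_apply', he.invol, ih]

theorem twist_twist {e : V →ₗ[R] V} (he : IsGrading gr e) (l : List V) :
    twist e (twist e l) = l := by
  induction l with
  | nil => rfl
  | cons x l ih => rw [twist, twist, ih, twist_length, iterate_invol he]

/-- Between suspensions the function has degree `totalDeg δ - 1`. So the components of morphisms,
with `δ` odd, commute with the sign `-e`, whereas operations, with `δ` even, anticommute with it. -/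
theorem Homog.odd {σ δ : ℤ × ℤ} {θ : List V → W} (hh : Homog gr gr' σ δ θ) (hσ : totalDeg σ = 1)
    (hδ : Odd (totalDeg δ)) (h : MultiLin R θ) {e : V →ₗ[R] V} (he : IsGrading gr e)
    {e' : W →ₗ[R] W} (he' : IsGrading gr' e') (l : List V) :
    θ (l.map (-e)) = (-e') (θ l) := by
  refine MultiLin.ext_homog (R := R) (h.comp_map (-e)) (h.comp_left (-e')) he.span ?_ l
  intro l ds hl
  have h1 := map_neg_parity h he.parity hl []
  rw [List.append_nil, List.append_nil] at h1
  rw [h1, LinearMap.neg_apply, he'.parity _ _ (hh l ds hl), ← Units.neg_smul]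
  congr 1
  rw [totalDeg_sub, totalDeg_add, totalDeg_smul, hσ, totalDeg_sum, hl.length_eq, mul_one,
    ← neg_one_mul, ← Int.negOnePow_one, ← Int.negOnePow_add]
  obtain ⟨c, hc⟩ := hδ
  refine negOnePow_congr (-c - 1) ?_
  rw [hc]; ring

theorem Homog.even {σ δ : ℤ × ℤ} {θ : List V → W} (hh : Homog gr gr' σ δ θ) (hσ : totalDeg σ = 1)
    (hδ : Even (totalDeg δ)) (h : MultiLin R θ) {e : V →ₗ[R] V} (he : IsGrading gr e)
    {e' : W →ₗ[R] W} (he' : IsGrading gr' e') (l : List V) :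
    θ (l.map (-e)) = -(-e') (θ l) := by
  refine MultiLin.ext_homog (R := R) (h.comp_map (-e)) ((h.comp_left (-e')).neg) he.span ?_ l
  intro l ds hl
  have h1 := map_neg_parity h he.parity hl []
  rw [List.append_nil, List.append_nil] at h1
  rw [h1, LinearMap.neg_apply, he'.parity _ _ (hh l ds hl), neg_neg]
  congr 1
  rw [totalDeg_sub, totalDeg_add, totalDeg_smul, hσ, totalDeg_sum, hl.length_eq, mul_one]
  obtain ⟨c, hc⟩ := hδ
  refine negOnePow_congr (-c) ?_
  rw [hc]; ring

/-- The bidegree `(s, 1 - s)`. -/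
abbrev typ (s : ℕ) : ℤ × ℤ := ((s : ℤ), 1 - (s : ℤ))

theorem totalDeg_typ (s : ℕ) : totalDeg (typ s) = 1 := by simp [totalDeg]

/-- The suspended operations of an `A_∞`-algebra. -/
def Algebra.op (X : Algebra k R gr s) (e : V →ₗ[R] V) (l : List V) : V :=
  ofList (fun n => X.m n) (twist e l)

/-- The suspended components of a morphism. -/
def Hom.op {X : Algebra k R gr s} {Y : Algebra k R gr' s} (f : Hom X Y) (e : V →ₗ[R] V)
    (l : List V) : W :=
  ofList (fun n => f.f n) (twist e l)

section

variable (X : Algebra k R gr s) (e : V →ₗ[R] V)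

theorem Algebra.multiLin_op : MultiLin R (X.op e) := (multiLin_ofList X.m).twist e

theorem Algebra.op_nil : X.op e [] = 0 := by
  change X.m 0 _ = 0
  rw [X.m_zero]; rfl

theorem Algebra.op_one (x : V) : X.op e [x] = X.d x := by
  change X.m 1 _ = X.m 1 _
  congr 1
  funext i
  fin_cases i
  rfl

theorem Algebra.homog_ofList : Homog gr gr (typ s) ((2 : ℤ) • typ s) (ofList fun n => X.m n) :=
  AInf.homog_ofList X.homogeneous

variable {e}

theorem Algebra.homog_op (he : IsGrading gr e) :
    Homog gr gr (typ s) ((2 : ℤ) • typ s) (X.op e) :=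
  X.homog_ofList.twist he.parity

theorem Algebra.op_even (he : IsGrading gr e) (l : List V) :
    X.op e (l.map (-e)) = -(-e) (X.op e l) :=
  (X.homog_op he).even (totalDeg_typ s) (by rw [totalDeg_smul]; exact even_two_mul _)
    (X.multiLin_op e) he he l

/-- On homogeneous lists this is the Stasheff identity up to the suspension sign, and homogeneous
lists suffice by multilinearity. -/
theorem Algebra.coder_op (he : IsGrading gr e) (l : List V) :
    coder (-e) (X.op e) (X.op e) l = 0 := by
  have hm := X.multiLin_op e
  refine MultiLin.ext_homog (R := R) ((multiLin_single (-e)).cod hm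
    (multiLin_single LinearMap.id) hm) MultiLin.zero he.span ?_ l
  intro l ds hl
  obtain ⟨a, d, ha, hl'⟩ := exists_seg hl
  rw [hl']
  refine (coder_twist_eq_insertionSum (totalDeg_typ s) (multiLin_ofList X.m) (multiLin_ofList X.m)
    X.homog_ofList he.parity _ ha).trans ?_
  rw [X.stasheff _ d a ha, smul_zero]

end

section

variable {X : Algebra k R gr s} {Y : Algebra k R gr' s} (f : Hom X Y) (e : V →ₗ[R] V)

theorem Hom.multiLin_op : MultiLin R (f.op e) := (multiLin_ofList f.f).twist e

theorem Hom.op_nil : f.op e [] = 0 := by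
  change f.f 0 _ = 0
  rw [f.f_zero]; rfl

theorem Hom.op_one (x : V) : f.op e [x] = f.linear x := by
  change f.f 1 _ = f.f 1 _
  congr 1
  funext i
  fin_cases i
  rfl

theorem Hom.homog_ofList : Homog gr gr' (typ s) (typ s) (ofList fun n => f.f n) := by
  have := AInf.homog_ofList (c := 1) f.homogeneous
  rwa [one_smul] at this

variable {e}

theorem Hom.homog_op (he : IsGrading gr e) : Homog gr gr' (typ s) (typ s) (f.op e) :=
  f.homog_ofList.twist he.parity

theorem Hom.op_odd (he : IsGrading gr e) {e' : W →ₗ[R] W} (he' : IsGrading gr' e') (l : List V) :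
    f.op e (l.map (-e)) = (-e') (f.op e l) :=
  (f.homog_op he).odd (totalDeg_typ s) (by rw [totalDeg_typ]; exact odd_one)
    (f.multiLin_op e) he he' l

theorem Hom.pull_op (he : IsGrading gr e) {e' : W →ₗ[R] W} (he' : IsGrading gr' e') (l : List V) :
    pull (f.op e) (Y.op e') l = coder (-e) (X.op e) (f.op e) l := by
  refine MultiLin.ext_homog (R := R) ((f.multiLin_op e).pull (Y.multiLin_op e'))
    ((multiLin_single (-e)).cod (X.multiLin_op e) (multiLin_single LinearMap.id) (f.multiLin_op e))
    he.span ?_ l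
  intro l ds hl
  obtain ⟨a, d, ha, hl'⟩ := exists_seg hl
  rw [hl']
  refine (pull_twist_eq_blockSum (totalDeg_typ s) (multiLin_ofList f.f) (multiLin_ofList Y.m)
    f.homog_ofList he.parity he'.parity _ ha).trans ?_
  refine Eq.trans ?_ (coder_twist_eq_insertionSum (totalDeg_typ s) (multiLin_ofList f.f)
    (multiLin_ofList X.m) X.homog_ofList he.parity _ ha).symm
  rw [f.stasheff _ d a ha]

end

/-- The multilinear map given by a multilinear function on lists. -/
def toMulti {θ : List V → W} (hθ : MultiLin R θ) (n : ℕ) :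
    MultilinearMap R (fun _ : Fin n => V) W :=
  have key : ∀ (a : Fin n → V) (i : Fin n), ∃ p q : List V, ∀ x,
      List.ofFn (Function.update a i x) = p ++ x :: q := by
    intro a i
    refine ⟨(List.ofFn a).take i, (List.ofFn a).drop (i + 1), fun x => ?_⟩
    have hset : List.ofFn (Function.update a i x) = (List.ofFn a).set i x := by
      refine List.ext_getElem (by simp) fun j h1 h2 => ?_
      rw [List.getElem_set, List.getElem_ofFn, List.getElem_ofFn]
      by_cases hij : (i : ℕ) = j
      · subst hij; simp
      · rw [if_neg hij, Function.update_of_ne]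
        exact fun h => hij (by rw [← h])
    rw [hset, List.set_eq_take_append_cons_drop, if_pos (by simp)]
  { toFun := fun a => θ (List.ofFn a)
    map_update_add' := by
      intro inst a i x y
      obtain rfl : inst = instDecidableEqFin n := Subsingleton.elim _ _
      obtain ⟨p, q, h⟩ := key a i
      simp only [h, hθ.map_add]
    map_update_smul' := by
      intro inst a i c x
      obtain rfl : inst = instDecidableEqFin n := Subsingleton.elim _ _
      obtain ⟨p, q, h⟩ := key a i
      simp only [h, hθ.map_smul] }

theorem ofList_toMulti {θ : List V → W} (hθ : MultiLin R θ) :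
    (ofList fun n => toMulti hθ n) = θ := by
  funext l
  change θ (List.ofFn fun i : Fin l.length => l.getD i 0) = θ l
  congr 1
  refine List.ext_getElem (by simp) fun i h1 h2 => ?_
  simp

theorem Homog.toMulti {σ : ℤ × ℤ} {c : ℤ} {θ : List V → W} (hh : Homog gr gr' σ (c • σ) θ)
    (hθ : MultiLin R θ) (n : ℕ) (d : Fin n → ℤ × ℤ) (a : Fin n → V) (ha : ∀ i, a i ∈ gr (d i)) :
    AInf.toMulti hθ n a ∈ gr' (∑ i, d i + (c - (n : ℤ)) • σ) := by
  have := hh (List.ofFn a) (List.ofFn d) (by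
    refine List.forall₂_iff_get.2 ⟨by simp, fun i h1 h2 => ?_⟩
    simpa using ha ⟨i, by simpa using h1⟩)
  rw [List.sum_ofFn, List.length_ofFn] at this
  rw [sub_smul, ← add_sub_assoc]
  exact this

variable {e : V →ₗ[R] V} {e' : W →ₗ[R] W}

/-- The `A_∞`-algebra with given suspended operations. -/
def Algebra.ofOp (he : IsGrading gr e) {b : List V → V} (hb : MultiLin R b) (hb0 : b [] = 0)
    (hh : Homog gr gr (typ s) ((2 : ℤ) • typ s) b) (hbb : ∀ l, coder (-e) b b l = 0) :
    Algebra k R gr s where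
  m := toMulti (hb.twist e)
  m_zero := by ext a; exact hb0
  homogeneous := (hh.twist he.parity).toMulti (hb.twist e)
  stasheff n d a ha := by
    have h := coder_twist_eq_insertionSum (g := fun n => toMulti (hb.twist e) n)
      (m := fun n => toMulti (hb.twist e) n) (totalDeg_typ s) (multiLin_ofList _)
      (multiLin_ofList _) (by rw [ofList_toMulti]; exact hh.twist he.parity) he.parity n ha
    simp only [ofList_toMulti, twist_twist he] at h
    have h2 := h.symm.trans (hbb _)
    rwa [smul_eq_zero_iff_eq] at h2

theorem Algebra.ofOp_op (he : IsGrading gr e) {b : List V → V} (hb : MultiLin R b)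
    (hb0 : b [] = 0) (hh : Homog gr gr (typ s) ((2 : ℤ) • typ s) b)
    (hbb : ∀ l, coder (-e) b b l = 0) : (Algebra.ofOp he hb hb0 hh hbb).op e = b := by
  funext l
  change (ofList fun n => toMulti (hb.twist e) n) (twist e l) = b l
  rw [ofList_toMulti, twist_twist he]

/-- The morphism with given suspended components. -/
def Hom.ofOp (he : IsGrading gr e) (he' : IsGrading gr' e') {X : Algebra k R gr s}
    {Y : Algebra k R gr' s} {f : List V → W} (hf : MultiLin R f) (hf0 : f [] = 0)
    (hh : Homog gr gr' (typ s) (typ s) f)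
    (hff : ∀ l, pull f (Y.op e') l = coder (-e) (X.op e) f l) : Hom X Y where
  f := toMulti (hf.twist e)
  f_zero := by ext a; exact hf0
  homogeneous := by
    refine Homog.toMulti (c := 1) ?_ (hf.twist e)
    rw [one_smul]; exact hh.twist he.parity
  stasheff n d a ha := by
    have h := coder_twist_eq_insertionSum (g := fun n => toMulti (hf.twist e) n)
      (m := fun n => X.m n) (totalDeg_typ s) (multiLin_ofList _)
      (multiLin_ofList _) X.homog_ofList he.parity n ha
    have h' := pull_twist_eq_blockSum (f := fun n => toMulti (hf.twist e) n)
      (m := fun n => Y.m n) (gr' := gr') (totalDeg_typ s) (multiLin_ofList _)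
      (multiLin_ofList _) (by rw [ofList_toMulti]; exact hh.twist he.parity) he.parity
      he'.parity n ha
    simp only [ofList_toMulti, twist_twist he] at h h'
    have h2 := h.symm.trans ((hff _).symm.trans h')
    exact smul_left_cancel _ h2

theorem Hom.ofOp_op (he : IsGrading gr e) (he' : IsGrading gr' e') {X : Algebra k R gr s}
    {Y : Algebra k R gr' s} {f : List V → W} (hf : MultiLin R f) (hf0 : f [] = 0)
    (hh : Homog gr gr' (typ s) (typ s) f)
    (hff : ∀ l, pull f (Y.op e') l = coder (-e) (X.op e) f l) :
    (Hom.ofOp he he' hf hf0 hh hff).op e = f := by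
  funext l
  change (ofList fun n => toMulti (hf.twist e) n) (twist e l) = f l
  rw [ofList_toMulti, twist_twist he]

end translate

/-! ### Naturality of the list operations -/

section natural

variable {V V' W W' S : Type*} [AddCommGroup S]

theorem pullAux_comap {a : V' → V} {b : W' → W} {F : List V' → W'} {f : List V → W}
    (hF : ∀ l, b (F l) = f (l.map a)) (l : List V') : ∀ {Φ : List V' → W'} {φ : List V → W}
    {Θ : List W → S}, (∀ l, b (Φ l) = φ (l.map a)) →
    pullAux F l Φ (fun q => Θ (q.map b)) = pullAux f (l.map a) φ Θ := by
  induction l with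
  | nil =>
    intro Φ φ Θ h
    change Θ [b (Φ [])] = Θ [φ []]
    rw [h]; rfl
  | cons x l ih =>
    intro Φ φ Θ h
    rw [List.map_cons, pullAux, pullAux, ih (φ := fun q => φ (a x :: q)) (fun q => h (x :: q)),
      ← ih (Φ := fun q => F (x :: q)) (Θ := fun q => Θ (φ [] :: q)) (fun q => hF (x :: q))]
    simp only [List.map_cons, h, List.map_nil]

/-- In the application `a` and `b` are the reductions modulo `ħ`. -/
theorem pull_comap {a : V' → V} {b : W' → W} {F : List V' → W'} {f : List V → W}
    (hF : ∀ l, b (F l) = f (l.map a)) (Θ : List W → S) (l : List V') :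
    pull F (fun q => Θ (q.map b)) l = pull f Θ (l.map a) := by
  cases l with
  | nil => rfl
  | cons x l => exact pullAux_comap hF l fun q => hF (x :: q)

theorem codAux_comap {a : V' → V} {b : W' → W} {P H F : List V' → W'} {p η f : List V → W}
    (hP : ∀ l, b (P l) = p (l.map a)) (hH : ∀ l, b (H l) = η (l.map a))
    (hF : ∀ l, b (F l) = f (l.map a)) (l : List V') :
    ∀ {Φ Χ : List V' → W'} {φ χ : List V → W} {Θ : List W → S}, (∀ l, b (Φ l) = φ (l.map a)) →
    (∀ l, b (Χ l) = χ (l.map a)) →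
    codAux P H F l Φ Χ (fun q => Θ (q.map b)) = codAux p η f (l.map a) φ χ Θ := by
  induction l with
  | nil =>
    intro Φ Χ φ χ Θ h h'
    change Θ [b (Χ [])] = Θ [χ []]
    rw [h']; rfl
  | cons x l ih =>
    intro Φ Χ φ χ Θ h h'
    rw [List.map_cons, codAux, codAux, ih (φ := fun q => φ (a x :: q)) (χ := fun q => χ (a x :: q))
        (fun q => h (x :: q)) (fun q => h' (x :: q)),
      ← ih (Φ := fun q => P (x :: q)) (Χ := fun q => H (x :: q)) (Θ := fun q => Θ (φ [] :: q))
        (fun q => hP (x :: q)) (fun q => hH (x :: q)),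
      ← pullAux_comap hF l (Φ := fun q => F (x :: q)) (Θ := fun q => Θ (χ [] :: q))
        (fun q => hF (x :: q))]
    simp only [List.map_cons, h, h', List.map_nil]

theorem cod_comap {a : V' → V} {b : W' → W} {P H F : List V' → W'} {p η f : List V → W}
    (hP : ∀ l, b (P l) = p (l.map a)) (hH : ∀ l, b (H l) = η (l.map a))
    (hF : ∀ l, b (F l) = f (l.map a)) (Θ : List W → S) (l : List V') :
    cod P H F (fun q => Θ (q.map b)) l = cod p η f Θ (l.map a) := by
  cases l with
  | nil => rfl
  | cons x l => exact codAux_comap hP hH hF l (fun q => hP (x :: q)) (fun q => hH (x :: q))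

end natural

/-! ### Bigraded series -/

section series

variable {k : Type u} [CommRing k] {V : Type w} [AddCommGroup V] [Module k V]
  {gr : ℤ × ℤ → Submodule k V}
  {W : Type w} [AddCommGroup W] [Module k W] {gr' : ℤ × ℤ → Submodule k W}

local notation "ħ" => (Polynomial.X : Polynomial k)

/-- The bidegree by which the coefficients of a homogeneous series change. -/
abbrev hdeg : ℤ × ℤ := (1, -1)

theorem totalDeg_hdeg : totalDeg hdeg = 0 := rfl

theorem mem_homogeneousSeries {d : ℤ × ℤ} {v : ℕ → V} :
    v ∈ homogeneousSeries gr d ↔ ∀ r : ℕ, v r ∈ gr (d + (r : ℤ) • hdeg) := by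
  rw [homogeneousSeries, Submodule.mem_pi]
  have : ∀ r : ℕ, ((d.1 + (r : ℤ), d.2 - (r : ℤ)) : ℤ × ℤ) = d + (r : ℤ) • hdeg := by
    intro r; ext <;> simp [hdeg, sub_eq_add_neg]
  simp only [Set.mem_univ, true_implies, this]

/-- The sequence of coefficients. -/
def toSeq : BgrSeries gr →ₗ[k] (ℕ → V) := (seriesSubmodule gr).subtype

/-- The series with given coefficients. -/
def mkSeries (v : ℕ → V) (hv : v ∈ seriesSubmodule gr) : BgrSeries gr := ⟨v, hv⟩

variable (gr) in
/-- The coefficient of `ħ^N`. -/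
def coeff (N : ℕ) : BgrSeries gr →ₗ[k] V := (LinearMap.proj N).comp toSeq

theorem toSeq_mem (x : BgrSeries gr) : toSeq x ∈ seriesSubmodule gr := x.2

theorem coeff_mkSeries (N : ℕ) (v : ℕ → V) (hv : v ∈ seriesSubmodule gr) :
    coeff gr N (mkSeries v hv) = v N := rfl

theorem coeff_ext {x y : BgrSeries gr} (h : ∀ N, coeff gr N x = coeff gr N y) : x = y :=
  Subtype.ext (funext h)

theorem coeff_zero (x : BgrSeries gr) : coeff gr 0 x = constCoeff gr x := rfl

theorem mem_seriesGrading {d : ℤ × ℤ} {x : BgrSeries gr} :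
    x ∈ seriesGrading gr d ↔ ∀ r : ℕ, coeff gr r x ∈ gr (d + (r : ℤ) • hdeg) :=
  mem_homogeneousSeries

theorem C_smul (c : k) (x : BgrSeries gr) : Polynomial.C c • x = c • x := by
  change (Polynomial.aeval (R := k) (mulHbar gr)) (Polynomial.C c) x = _
  rw [Polynomial.aeval_C]; rfl

theorem X_smul (x : BgrSeries gr) : ħ • x = mulHbar gr x := by
  change (Polynomial.aeval (R := k) (mulHbar gr)) Polynomial.X x = _
  rw [Polynomial.aeval_X]

theorem coeff_X_smul_zero (x : BgrSeries gr) : coeff gr 0 (ħ • x) = 0 := by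
  rw [X_smul]; rfl

theorem coeff_X_smul_succ (x : BgrSeries gr) (N : ℕ) :
    coeff gr (N + 1) (ħ • x) = coeff gr N x := by
  rw [X_smul]; rfl

theorem X_smul_injective {x y : BgrSeries gr} (h : ħ • x = ħ • y) : x = y :=
  coeff_ext fun N => by rw [← coeff_X_smul_succ, h, coeff_X_smul_succ]

theorem X_pow_smul_injective (N : ℕ) {x y : BgrSeries gr} (h : ħ ^ N • x = ħ ^ N • y) : x = y := by
  induction N with
  | zero => simpa using h
  | succ N ih =>
    rw [pow_succ', mul_smul, mul_smul] at h
    exact ih (X_smul_injective h)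

theorem seriesGrading_span : ⨆ d, seriesGrading gr d = ⊤ := by
  refine eq_top_iff.2 fun x _ => ?_
  have h : seriesSubmodule gr ≤ (⨆ d, seriesGrading gr d).map toSeq := by
    refine iSup_le fun d v hv => ?_
    exact ⟨mkSeries v (le_iSup (homogeneousSeries gr) d hv), le_iSup (seriesGrading gr) d hv, rfl⟩
  obtain ⟨y, hy, hyx⟩ := h (toSeq_mem x)
  rwa [show x = y from coeff_ext fun N => (congrFun hyx N).symm]

/-- Division by `ħ` of a series without constant term. -/
def unshift : BgrSeries gr →ₗ[k] BgrSeries gr :=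
  LinearMap.restrict (LinearMap.funLeft k V Nat.succ) (p := seriesSubmodule gr)
    (q := seriesSubmodule gr) (by
      intro x hx
      have h : seriesSubmodule gr ≤ (seriesSubmodule gr).comap (LinearMap.funLeft k V Nat.succ) := by
        refine iSup_le fun d v hv => ?_
        refine (le_iSup (homogeneousSeries gr) (d + hdeg)) ?_
        rw [mem_homogeneousSeries] at hv ⊢
        intro r
        have := hv (r + 1)
        rw [show d + ((r + 1 : ℕ) : ℤ) • hdeg = d + hdeg + (r : ℤ) • hdeg by
          push_cast; rw [add_smul, one_smul]; abel] at this
        exact this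
      exact h hx)

theorem coeff_unshift (x : BgrSeries gr) (N : ℕ) : coeff gr N (unshift x) = coeff gr (N + 1) x :=
  rfl

/-- The constant series. -/
def constLin (h : ⨆ d, gr d = ⊤) : V →ₗ[k] BgrSeries gr :=
  (LinearMap.single k (fun _ : ℕ => V) 0).codRestrict (seriesSubmodule gr) (by
    intro v
    have hv : v ∈ ⨆ d, gr d := by rw [h]; trivial
    have hle : ⨆ d, gr d ≤ (seriesSubmodule gr).comap (LinearMap.single k (fun _ : ℕ => V) 0) :=
      iSup_le fun d v hv => (constSeries (⟨v, hv⟩ : gr d)).2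
    exact hle hv)

variable (hs : ⨆ d, gr d = ⊤)

theorem coeff_constLin_zero (v : V) : coeff gr 0 (constLin hs v) = v := rfl

theorem coeff_constLin_succ (v : V) (N : ℕ) : coeff gr (N + 1) (constLin hs v) = 0 := rfl

theorem constLin_mem {d : ℤ × ℤ} {v : V} (hv : v ∈ gr d) : constLin hs v ∈ seriesGrading gr d := by
  rw [mem_seriesGrading]
  rintro (_ | r)
  · rw [coeff_constLin_zero]; simpa using hv
  · rw [coeff_constLin_succ]; exact Submodule.zero_mem _

theorem eq_constLin_add (x : BgrSeries gr) :
    x = constLin hs (coeff gr 0 x) + ħ • unshift x := by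
  refine coeff_ext fun N => ?_
  rw [map_add]
  cases N with
  | zero => rw [coeff_constLin_zero, coeff_X_smul_zero, add_zero]
  | succ N => rw [coeff_constLin_succ, coeff_X_smul_succ, zero_add, coeff_unshift]

theorem unshift_mem {d : ℤ × ℤ} {x : BgrSeries gr} (hx : x ∈ seriesGrading gr d) :
    unshift x ∈ seriesGrading gr (d + hdeg) := by
  rw [mem_seriesGrading] at hx ⊢
  intro r
  have := hx (r + 1)
  rwa [show d + ((r + 1 : ℕ) : ℤ) • hdeg = d + hdeg + (r : ℤ) • hdeg by
    push_cast; rw [add_smul, one_smul]; abel] at this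

theorem coeff_X_pow_smul_lt (x : BgrSeries gr) (j N : ℕ) (h : N < j) :
    coeff gr N (ħ ^ j • x) = 0 := by
  induction j generalizing N with
  | zero => omega
  | succ j ih =>
    rw [pow_succ', mul_smul]
    cases N with
    | zero => exact coeff_X_smul_zero _
    | succ N => rw [coeff_X_smul_succ]; exact ih N (by omega)

theorem coeff_X_pow_smul_add (x : BgrSeries gr) (j N : ℕ) :
    coeff gr (N + j) (ħ ^ j • x) = coeff gr N x := by
  induction j with
  | zero => simp
  | succ j ih => rw [pow_succ', mul_smul, ← add_assoc, coeff_X_smul_succ, ih]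

theorem div_X_pow_iff {j : ℕ} {x : BgrSeries gr} :
    Div (ħ ^ j) x ↔ ∀ N < j, coeff gr N x = 0 := by
  constructor
  · rintro ⟨y, rfl⟩ N hN
    exact coeff_X_pow_smul_lt y j N hN
  · intro h
    refine ⟨unshift^[j] x, ?_⟩
    have key : ∀ (j N : ℕ), coeff gr N (unshift^[j] x) = coeff gr (N + j) x := by
      intro j
      induction j with
      | zero => intro N; rfl
      | succ j ih =>
        intro N
        rw [Function.iterate_succ_apply', coeff_unshift, ih]
        congr 2; omega
    refine coeff_ext fun N => ?_
    by_cases hN : N < j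
    · rw [h N hN, coeff_X_pow_smul_lt _ _ _ hN]
    · obtain ⟨M, rfl⟩ := Nat.exists_eq_add_of_le' (not_lt.1 hN)
      rw [coeff_X_pow_smul_add, key]

theorem eq_zero_of_div {x : BgrSeries gr} (h : ∀ j : ℕ, Div (ħ ^ j) x) : x = 0 :=
  coeff_ext fun N => by rw [div_X_pow_iff.1 (h (N + 1)) N (by omega), map_zero]

/-- A multilinear function on lists of series is determined modulo `ħ^j` by constant series. -/
theorem MultiLin.div_of_const {U : Type*} [AddCommGroup U] [Module (Polynomial k) U]
    {θ : List (BgrSeries gr) → U} (hθ : MultiLin (Polynomial k) θ) {j : ℕ}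
    (T : List (BgrSeries gr) → Prop)
    (hT : ∀ p x q, T (p ++ x :: q) → (∀ h, T (p ++ constLin hs h :: q)) ∨ ∃ h, x = constLin hs h)
    (h : ∀ l : List V, T (l.map (constLin hs)) → Div (ħ ^ j) (θ (l.map (constLin hs))))
    (l : List (BgrSeries gr)) (hl : T l) : Div (ħ ^ j) (θ l) := by
  suffices H : ∀ (q : List (BgrSeries gr)) (p : List V), T (p.map (constLin hs) ++ q) →
      Div (ħ ^ j) (θ (p.map (constLin hs) ++ q)) from H l [] hl
  intro q
  induction q with
  | nil => intro p hp; rw [List.append_nil] at hp ⊢; exact h p hp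
  | cons x q ih =>
    intro p hp
    have step : ∀ h, T (p.map (constLin hs) ++ constLin hs h :: q) →
        Div (ħ ^ j) (θ (p.map (constLin hs) ++ constLin hs h :: q)) := by
      intro h hh
      have := ih (p ++ [h])
      rw [List.map_append, List.map_singleton, List.append_assoc, List.singleton_append] at this
      exact this hh
    rcases hT _ x q hp with h' | ⟨h', rfl⟩
    -- The series `x` is a constant plus `ħ` times a series. The constant is covered by `step`, and
    -- the remainder gains one factor `ħ` in each of `j` rounds.
    · have main : ∀ i ≤ j, ∀ x, Div (ħ ^ i) (θ (p.map (constLin hs) ++ x :: q)) := by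
        intro i
        induction i with
        | zero => intro _ x; exact ⟨_, by rw [pow_zero, one_smul]⟩
        | succ i ihi =>
          intro hi x
          rw [eq_constLin_add hs x, hθ.map_add, hθ.map_smul]
          refine ((step _ (h' _)).mono hi).add ?_
          obtain ⟨y, hy⟩ := ihi (by omega) (unshift x)
          exact ⟨y, by rw [hy, pow_succ', mul_smul]⟩
      exact main j le_rfl x
    · exact step _ hp

theorem MultiLin.div_of_const_length {U : Type*} [AddCommGroup U] [Module (Polynomial k) U]
    {θ : List (BgrSeries gr) → U} (hθ : MultiLin (Polynomial k) θ) {j : ℕ}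
    (l : List (BgrSeries gr))
    (h : ∀ l' : List V, l'.length = l.length → Div (ħ ^ j) (θ (l'.map (constLin hs)))) :
    Div (ħ ^ j) (θ l) := by
  refine hθ.div_of_const hs (fun q => q.length = l.length) (fun p x q hq => Or.inl fun y => ?_)
    (fun q hq => h q (by simpa using hq)) l rfl
  simpa using hq

theorem MultiLin.eq_of_const {θ θ' : List (BgrSeries gr) → BgrSeries gr'}
    (hθ : MultiLin (Polynomial k) θ) (hθ' : MultiLin (Polynomial k) θ')
    (h : ∀ l : List V, θ (l.map (constLin hs)) = θ' (l.map (constLin hs)))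
    (l : List (BgrSeries gr)) : θ l = θ' l := by
  rw [← sub_eq_zero]
  refine eq_zero_of_div fun j => (hθ.sub hθ').div_of_const_length hs l fun l' _ => ?_
  rw [h, sub_self]
  exact Div.zero

/-- A function that vanishes on all lists of constants through `u` vanishes on all lists through
`u`. -/
theorem MultiLin.eq_zero_of_const_mem {θ : List (BgrSeries gr) → BgrSeries gr'}
    (hθ : MultiLin (Polynomial k) θ) (u : V) (n : ℕ → Prop)
    (h : ∀ l : List V, u ∈ l → n l.length → θ (l.map (constLin hs)) = 0)
    (l : List (BgrSeries gr)) (hl : constLin hs u ∈ l) (hn : n l.length) : θ l = 0 := by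
  refine eq_zero_of_div fun j => hθ.div_of_const hs
    (fun q => constLin hs u ∈ q ∧ n q.length) ?_ ?_ l ⟨hl, hn⟩
  · rintro p x q ⟨hq, hq'⟩
    by_cases hx : constLin hs u = x
    · exact Or.inr ⟨u, hx.symm⟩
    · refine Or.inl fun y => ⟨?_, by simpa using hq'⟩
      simp only [List.mem_append, List.mem_cons, hx, false_or] at hq ⊢
      tauto
  · rintro q ⟨hq, hq'⟩
    obtain ⟨v, hv, hvu⟩ := List.mem_map.1 hq
    have : v = u := congrArg (coeff gr 0) hvu
    rw [h q (this ▸ hv) (by simpa using hq')]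
    exact Div.zero

theorem MultiLin.of_X_smul {θ : List (BgrSeries gr) → BgrSeries gr'} (hθ : MultiLin k θ)
    (h : ∀ p x q, θ (p ++ (ħ • x) :: q) = ħ • θ (p ++ x :: q)) : MultiLin (Polynomial k) θ := by
  refine MultiLin.of_add_smul (fun p q x y => hθ.map_add p q x y) fun p q c x => ?_
  induction c using Polynomial.induction_on' with
  | add a b ha hb => rw [add_smul, hθ.map_add, ha, hb, add_smul]
  | monomial n a =>
    rw [← Polynomial.C_mul_X_pow_eq_monomial, mul_smul, mul_smul, C_smul, C_smul, hθ.map_smul]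
    congr 1
    induction n generalizing x with
    | zero => simp
    | succ n ih => rw [pow_succ', mul_smul, mul_smul, h, ih]

variable (gr) in
/-- A linear map acting on coefficients. -/
def mapCoeff (e : V →ₗ[k] W) (he : ∀ d, ∀ x ∈ gr d, e x ∈ gr' d) :
    BgrSeries gr →ₗ[Polynomial k] BgrSeries gr' :=
  have hmem : ∀ x ∈ seriesSubmodule gr, (fun n => e (x n)) ∈ seriesSubmodule gr' := by
    intro x hx
    have h : seriesSubmodule gr ≤ (seriesSubmodule gr').comap (e.compLeft ℕ) := by
      refine iSup_le fun d v hv => ?_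
      refine (le_iSup (homogeneousSeries gr') d) ?_
      rw [mem_homogeneousSeries] at hv ⊢
      exact fun r => he _ _ (hv r)
    exact h hx
  let φ : BgrSeries gr →ₗ[k] BgrSeries gr' :=
    { toFun := fun x => mkSeries (fun n => e (toSeq x n)) (hmem _ (toSeq_mem x))
      map_add' := fun x y => coeff_ext fun n => e.map_add _ _
      map_smul' := fun c x => coeff_ext fun n => e.map_smul _ _ }
  { toFun := φ
    map_add' := φ.map_add
    map_smul' := by
      intro c x
      have hX : ∀ x : BgrSeries gr, φ (ħ • x) = ħ • φ x := by
        intro x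
        refine coeff_ext fun N => ?_
        change e (coeff gr N (ħ • x)) = _
        cases N with
        | zero => rw [coeff_X_smul_zero, coeff_X_smul_zero, map_zero]
        | succ N => rw [coeff_X_smul_succ, coeff_X_smul_succ]; rfl
      rw [RingHom.id_apply]
      induction c using Polynomial.induction_on' generalizing x with
      | add a b ha hb => rw [add_smul, map_add, ha, hb, add_smul]
      | monomial n a =>
        rw [← Polynomial.C_mul_X_pow_eq_monomial, mul_smul, mul_smul, C_smul, C_smul, map_smul]
        congr 1
        induction n generalizing x with
        | zero => simp
        | succ n ih => rw [pow_succ', mul_smul, mul_smul, hX, ih] }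

theorem coeff_mapCoeff (e : V →ₗ[k] W) (he : ∀ d, ∀ x ∈ gr d, e x ∈ gr' d) (N : ℕ)
    (x : BgrSeries gr) : coeff gr' N (mapCoeff gr e he x) = e (coeff gr N x) := rfl

theorem IsGrading.apply_mem {R : Type*} [CommRing R] [Module R V] {e : V →ₗ[R] V}
    (he : IsGrading gr e) (d : ℤ × ℤ) (x : V) (hx : x ∈ gr d) : e x ∈ gr d := by
  rw [he.parity d x hx]
  exact unit_smul_mem _ hx

theorem IsGrading.series {e : V →ₗ[k] V} (he : IsGrading gr e) :
    IsGrading (seriesGrading gr) (mapCoeff gr e he.apply_mem) where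
  span := seriesGrading_span
  parity d x hx := by
    refine coeff_ext fun N => ?_
    rw [coeff_mapCoeff, he.parity _ _ (mem_seriesGrading.1 hx N), totalDeg_add, totalDeg_smul,
      totalDeg_hdeg, mul_zero, add_zero]
    rcases Int.units_eq_one_or (totalDeg d).negOnePow with h | h <;> rw [h] <;> simp

/-! ### Multilinear functions with given coefficients -/

/-- The values, on lists of sequences, of the function with coefficients `b`. -/
def ext : (ℕ → List V → W) → List (ℕ → V) → ℕ → W
  | b, [], M => b M []
  | b, x :: l, M => ∑ i ∈ Finset.HasAntidiagonal.antidiagonal M, ext (fun N t => b N (x i.1 :: t)) l i.2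

theorem ext_comb (c : k) (l : List (ℕ → V)) : ∀ (b b' : ℕ → List V → W) (M : ℕ),
    ext (fun N t => c • b N t + b' N t) l M = c • ext b l M + ext b' l M := by
  induction l with
  | nil => intro b b' M; rfl
  | cons x l ih =>
    intro b b' M
    simp only [ext]
    rw [Finset.smul_sum, ← Finset.sum_add_distrib]
    exact Finset.sum_congr rfl fun i _ => ih _ _ _

theorem ext_zero (l : List (ℕ → V)) (M : ℕ) : ext (fun _ _ => (0 : W)) l M = 0 := by
  induction l generalizing M with
  | nil => rfl
  | cons x l ih => exact Finset.sum_eq_zero fun i _ => ih _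

theorem multiLin_ext {b : ℕ → List V → W} (hb : ∀ N, MultiLin k (b N)) (M : ℕ) :
    MultiLin k (fun l => ext b l M) := by
  intro p q c x y
  induction p generalizing b M with
  | nil =>
    simp only [List.nil_append, ext]
    rw [Finset.smul_sum, ← Finset.sum_add_distrib]
    refine Finset.sum_congr rfl fun i _ => ?_
    rw [← ext_comb]
    congr 1
    funext N t
    exact (hb N).head c _ _ t
  | cons z p ih =>
    simp only [List.cons_append, ext]
    rw [Finset.smul_sum, ← Finset.sum_add_distrib]
    exact Finset.sum_congr rfl fun i _ => ih (fun N => (hb N).tail _) _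

theorem ext_shift {b : ℕ → List V → W} (hb : ∀ N, MultiLin k (b N)) (p : List (ℕ → V)) (x : ℕ → V)
    (q : List (ℕ → V)) (M : ℕ) :
    ext b (p ++ shift (k := k) x :: q) M = shift (k := k) (ext b (p ++ x :: q)) M := by
  induction p generalizing b M with
  | nil =>
    have h0 : ∀ j, ext (fun N t => b N ((0 : V) :: t)) q j = 0 := fun j => by
      rw [show (fun N t => b N ((0 : V) :: t)) = fun _ _ => 0 from
        funext fun N => funext fun t => (hb N).map_zero [] t]
      exact ext_zero q j
    simp only [List.nil_append, ext]
    cases M with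
    | zero =>
      rw [Finset.Nat.antidiagonal_zero, Finset.sum_singleton]
      exact h0 0
    | succ M =>
      rw [Finset.Nat.sum_antidiagonal_succ]
      refine (congrArg (· + _) (h0 _)).trans ?_
      rw [zero_add]
      rfl
  | cons z p ih =>
    simp only [List.cons_append, ext]
    have h1 : ∀ (i : ℕ × ℕ), ext (fun N t => b N (z i.1 :: t)) (p ++ shift (k := k) x :: q) i.2
        = shift (k := k) (ext (fun N t => b N (z i.1 :: t)) (p ++ x :: q)) i.2 :=
      fun i => ih (fun N => (hb N).tail _) _
    rw [Finset.sum_congr rfl fun i _ => h1 i]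
    cases M with
    | zero =>
      rw [Finset.Nat.antidiagonal_zero, Finset.sum_singleton]
      rfl
    | succ M =>
      rw [Finset.Nat.sum_antidiagonal_succ']
      refine (congrArg (· + _) ?_).trans (zero_add _) |>.trans ?_
      · rfl
      · rfl

theorem ext_single {b : ℕ → List V → W} (hb : ∀ N, MultiLin k (b N)) (l : List V) (M : ℕ) :
    ext b (l.map fun v => Pi.single 0 v) M = b M l := by
  induction l generalizing b M with
  | nil => rfl
  | cons x l ih =>
    rw [List.map_cons, ext, Finset.sum_eq_single (0, M)]
    · exact ih (fun N => (hb N).tail _) M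
    · rintro ⟨i, j⟩ hij hne
      have hi : i ≠ 0 := by
        rintro rfl
        exact hne (by rw [Finset.HasAntidiagonal.mem_antidiagonal, zero_add] at hij; rw [← hij])
      rw [show (fun N t => b N ((Pi.single 0 x : ℕ → V) i :: t)) = fun _ _ => 0 from
        funext fun N => funext fun t => by
          rw [Pi.single_eq_of_ne hi]; exact (hb N).map_zero [] t]
      exact ext_zero _ _
    · intro h
      exact absurd (Finset.HasAntidiagonal.mem_antidiagonal.2 (zero_add M)) h

theorem ext_coeff_zero (b : ℕ → List V → W) (l : List (ℕ → V)) :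
    ext b l 0 = b 0 (l.map fun x => x 0) := by
  induction l generalizing b with
  | nil => rfl
  | cons x l ih =>
    rw [ext, Finset.Nat.antidiagonal_zero, Finset.sum_singleton, ih]
    rfl

theorem ext_mem {σ D : ℤ × ℤ} {b : ℕ → List V → W}
    (hb : ∀ (N : ℕ) t ds, HomList gr t ds →
      b N t ∈ gr' (ds.sum + D - (t.length : ℤ) • σ + (N : ℤ) • hdeg))
    {l : List (ℕ → V)} {ds : List (ℤ × ℤ)}
    (hl : List.Forall₂ (fun x d => x ∈ homogeneousSeries gr d) l ds) (M : ℕ) :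
    ext b l M ∈ gr' (ds.sum + D - (l.length : ℤ) • σ + (M : ℤ) • hdeg) := by
  induction hl generalizing b D M with
  | nil => exact hb M [] [] List.Forall₂.nil
  | @cons x d l ds hx hl ih =>
    rw [ext]
    refine Submodule.sum_mem _ fun i hi => ?_
    -- The coefficient `x i.1` has bidegree `d + i.1 • hdeg`, which moves into `D`; the shift is
    -- recovered at the end from `i.1 + i.2 = M`.
    have := ih (D := D + (d + (i.1 : ℤ) • hdeg) - σ) (b := fun N t => b N (x i.1 :: t))
      (fun N t ds' ht => by
        have := hb N (x i.1 :: t) ((d + (i.1 : ℤ) • hdeg) :: ds')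
          (List.Forall₂.cons (mem_homogeneousSeries.1 hx _) ht)
        rw [List.sum_cons, List.length_cons] at this
        convert this using 2
        push_cast
        rw [add_smul, one_smul]
        abel) i.2
    rw [Finset.HasAntidiagonal.mem_antidiagonal] at hi
    convert this using 2
    rw [List.sum_cons, List.length_cons, ← hi]
    push_cast
    rw [add_smul, add_smul, one_smul]
    abel

/-- Coefficients of a homogeneous multilinear function on lists of series. -/
structure IsCoeffs (gr : ℤ × ℤ → Submodule k V) (gr' : ℤ × ℤ → Submodule k W) (σ δ : ℤ × ℤ)
    (b : ℕ → List V → W) : Prop where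
  multiLin : ∀ N, MultiLin k (b N)
  homog : ∀ N : ℕ, Homog gr gr' σ (δ + (N : ℤ) • hdeg) (b N)

theorem IsCoeffs.ext_mem {σ δ : ℤ × ℤ} {b : ℕ → List V → W} (hb : IsCoeffs gr gr' σ δ b)
    {l : List (BgrSeries gr)} {ds : List (ℤ × ℤ)} (hl : HomList (seriesGrading gr) l ds) :
    ext b (l.map toSeq) ∈ homogeneousSeries gr' (ds.sum + δ - (l.length : ℤ) • σ) := by
  rw [mem_homogeneousSeries]
  intro r
  have := AInf.ext_mem (gr := gr) (gr' := gr') (σ := σ) (D := δ) (b := b) (fun N t ds ht => by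
    convert hb.homog N t ds ht using 2; abel) (l := l.map toSeq) (ds := ds)
    (List.forall₂_map_left_iff.2 hl) r
  rwa [List.length_map] at this

theorem IsCoeffs.multiLin_ext {σ δ : ℤ × ℤ} {b : ℕ → List V → W} (hb : IsCoeffs gr gr' σ δ b) :
    MultiLin k (fun l : List (BgrSeries gr) => ext b (l.map toSeq)) := by
  intro p q c x y
  funext M
  have := (AInf.multiLin_ext hb.multiLin M).comp_map (toSeq : BgrSeries gr →ₗ[k] _)
  exact this p q c x y

theorem IsCoeffs.mem {σ δ : ℤ × ℤ} {b : ℕ → List V → W} (hb : IsCoeffs gr gr' σ δ b)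
    (l : List (BgrSeries gr)) : ext b (l.map toSeq) ∈ seriesSubmodule gr' :=
  hb.multiLin_ext.mem_of_homog (gr := seriesGrading gr) seriesGrading_span
    (seriesSubmodule gr').toAddSubgroup
    (fun _ _ hl => le_iSup (homogeneousSeries gr') _ (hb.ext_mem hl)) l

/-- The multilinear function on lists of series with given coefficients. -/
def ser {σ δ : ℤ × ℤ} {b : ℕ → List V → W} (hb : IsCoeffs gr gr' σ δ b)
    (l : List (BgrSeries gr)) : BgrSeries gr' := mkSeries (ext b (l.map toSeq)) (hb.mem l)

section

variable {σ δ : ℤ × ℤ} {b : ℕ → List V → W} (hb : IsCoeffs gr gr' σ δ b)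

theorem multiLin_ser : MultiLin (Polynomial k) (ser hb) := by
  refine MultiLin.of_X_smul (fun p q c x y => coeff_ext fun N => congrFun (hb.multiLin_ext p q c x y) N) ?_
  intro p x q
  rw [X_smul, X_smul]
  refine coeff_ext fun M => ?_
  have := ext_shift hb.multiLin (p.map toSeq) (toSeq x) (q.map toSeq) M
  change ext b ((p ++ mulHbar gr x :: q).map toSeq) M
    = shift (k := k) (ext b ((p ++ x :: q).map toSeq)) M
  rw [List.map_append, List.map_append]
  exact this

theorem homog_ser : Homog (seriesGrading gr) (seriesGrading gr') σ δ (ser hb) :=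
  fun _ _ hl => hb.ext_mem hl

theorem coeff_ser_const (l : List V) (N : ℕ) : coeff gr' N (ser hb (l.map (constLin hs))) = b N l := by
  have := ext_single hb.multiLin l N
  change ext b ((l.map (constLin hs)).map toSeq) N = _
  rw [List.map_map]
  exact this

theorem coeff_zero_ser (l : List (BgrSeries gr)) :
    coeff gr' 0 (ser hb l) = b 0 (l.map (coeff gr 0)) := by
  have := ext_coeff_zero b (l.map toSeq)
  rw [List.map_map] at this
  exact this

theorem ser_nil (h : ∀ N, b N [] = 0) : ser hb [] = 0 :=
  coeff_ext fun N => (h N).trans (map_zero _).symm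

end

theorem Homog.coeff {σ δ : ℤ × ℤ} {θ : List (BgrSeries gr) → BgrSeries gr'}
    (h : Homog (seriesGrading gr) (seriesGrading gr') σ δ θ) (N : ℕ) :
    Homog gr gr' σ (δ + (N : ℤ) • hdeg) (fun l => AInf.coeff gr' N (θ (l.map (constLin hs)))) := by
  intro l ds hl
  have h1 : HomList (seriesGrading gr) (l.map (constLin hs)) ds := by
    refine List.forall₂_map_left_iff.2 (hl.imp fun a d ha => constLin_mem hs ha)
  have := mem_seriesGrading.1 (h _ _ h1) N
  rw [List.length_map] at this
  convert this using 2
  abel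

theorem MultiLin.restrict {θ : List (BgrSeries gr) → BgrSeries gr'}
    (h : MultiLin (Polynomial k) θ) : MultiLin k (fun l => θ (l.map (constLin hs))) := by
  intro p q c x y
  have := h (p.map (constLin hs)) (q.map (constLin hs)) (Polynomial.C c) (constLin hs x)
    (constLin hs y)
  rw [C_smul, C_smul] at this
  simpa using this

end series

/-! ### Projections to the components of a bigrading -/

section projections

variable {k : Type u} [CommRing k] {V : Type w} [AddCommGroup V] [Module k V]
  {gr : ℤ × ℤ → Submodule k V} {π : ℤ × ℤ → V →ₗ[k] V}
  {W : Type w} [AddCommGroup W] [Module k W] {gr' : ℤ × ℤ → Submodule k W}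
  {π' : ℤ × ℤ → W →ₗ[k] W}

/-- `π` is the family of projections to the components of the bigrading `gr`. -/
structure IsProj (gr : ℤ × ℤ → Submodule k V) (π : ℤ × ℤ → V →ₗ[k] V) : Prop where
  mem : ∀ d x, π d x ∈ gr d
  same : ∀ d, ∀ x ∈ gr d, π d x = x
  ne : ∀ d d', d' ≠ d → ∀ x ∈ gr d, π d' x = 0
  span : ⨆ d, gr d = ⊤

theorem exists_isProj (h : DirectSum.IsInternal gr) : ∃ π, IsProj gr π := by
  classical
  let := h.chooseDecomposition
  refine ⟨fun d => (gr d).subtype ∘ₗ DirectSum.component k _ _ d ∘ₗ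
    (DirectSum.decomposeLinearEquiv gr).toLinearMap, ?_, ?_, ?_, h.submodule_iSup_eq_top⟩
  · intro d x; exact Subtype.mem _
  · intro d x hx; exact DirectSum.decompose_of_mem_same gr hx
  · intro d d' hd x hx; exact DirectSum.decompose_of_mem_ne gr hx hd.symm

theorem IsProj.isInternal (h : IsProj gr π) : DirectSum.IsInternal gr := by
  classical
  refine DirectSum.isInternal_submodule_of_iSupIndep_of_iSup_eq_top ?_ h.span
  rw [iSupIndep_def]
  intro d
  rw [Submodule.disjoint_def]
  intro x hx hx'
  have hle : ⨆ (j) (_ : j ≠ d), gr j ≤ LinearMap.ker (π d) :=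
    iSup₂_le fun j hj y hy => h.ne j d hj.symm y hy
  rw [← h.same d x hx]
  exact hle hx'

theorem IsProj.exists_sum (h : IsProj gr π) (x : V) :
    ∃ t : Finset (ℤ × ℤ), (∀ d ∉ t, π d x = 0) ∧ x = ∑ d ∈ t, π d x := by
  classical
  have hx : x ∈ ⨆ d, gr d := by rw [h.span]; trivial
  suffices H : ∃ t : Finset (ℤ × ℤ), ∀ t', t ⊆ t' →
      ((∀ d ∉ t', π d x = 0) ∧ x = ∑ d ∈ t', π d x) by
    obtain ⟨t, ht⟩ := H
    exact ⟨t, ht t subset_rfl⟩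
  refine Submodule.iSup_induction gr (motive := fun x => ∃ t : Finset (ℤ × ℤ), ∀ t', t ⊆ t' →
      ((∀ d ∉ t', π d x = 0) ∧ x = ∑ d ∈ t', π d x)) hx ?_ ?_ ?_
  · intro d x hx
    refine ⟨{d}, fun t' ht' => ⟨fun d' hd' => h.ne d d' ?_ x hx, ?_⟩⟩
    · rintro rfl
      exact hd' (Finset.singleton_subset_iff.1 ht')
    · rw [Finset.sum_eq_single_of_mem d (Finset.singleton_subset_iff.1 ht')
        (fun d' _ hd' => h.ne d d' hd' x hx), h.same d x hx]
  · exact ⟨∅, fun t' _ => by simp⟩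
  · rintro x y ⟨t, ht⟩ ⟨t₁, ht₁⟩
    refine ⟨t ∪ t₁, fun t' ht' => ?_⟩
    obtain ⟨a, b⟩ := ht t' (Finset.subset_union_left.trans ht')
    obtain ⟨a', b'⟩ := ht₁ t' (Finset.subset_union_right.trans ht')
    refine ⟨fun d hd => by rw [map_add, a d hd, a' d hd, add_zero], ?_⟩
    simp only [map_add]
    rw [Finset.sum_add_distrib, ← b, ← b']

theorem IsProj.comm (h : IsProj gr π) (h' : IsProj gr' π') (φ : V →+ W) (τ : ℤ × ℤ)
    (hφ : ∀ d, ∀ x ∈ gr d, φ x ∈ gr' (d + τ)) (d : ℤ × ℤ) (x : V) :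
    π' (d + τ) (φ x) = φ (π d x) := by
  have hx : x ∈ ⨆ d, gr d := by rw [h.span]; trivial
  refine Submodule.iSup_induction gr (motive := fun x => π' (d + τ) (φ x) = φ (π d x)) hx ?_ ?_ ?_
  · intro d' x hx
    by_cases hd : d = d'
    · subst hd
      rw [h.same d x hx, h'.same _ _ (hφ d x hx)]
    · rw [h.ne d' d hd x hx, map_zero, h'.ne _ _ _ _ (hφ d' x hx)]
      exact fun e => hd (add_right_cancel e)
  · simp
  · intro x y hx hy
    rw [map_add, map_add, hx, hy, map_add, map_add]

theorem exists_isGrading (h : DirectSum.IsInternal gr) : ∃ e : V →ₗ[k] V, IsGrading gr e := by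
  classical
  let := h.chooseDecomposition
  refine ⟨DirectSum.toModule k _ V (fun d => ((totalDeg d).negOnePow : ℤ) • (gr d).subtype) ∘ₗ
    (DirectSum.decomposeLinearEquiv gr).toLinearMap, ?_, h.submodule_iSup_eq_top⟩
  intro d x hx
  have := DirectSum.decomposeLinearEquiv_apply_coe gr d ⟨x, hx⟩
  rw [LinearMap.comp_apply, LinearEquiv.coe_coe]
  change DirectSum.toModule k _ V _ (DirectSum.decomposeLinearEquiv gr x) = _
  rw [this, DirectSum.toModule_lof]
  rfl

/-- The homogeneous part of a multilinear function on lists. -/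
theorem exists_homogeneous_part (h : IsProj gr π) (π' : ℤ × ℤ → W →ₗ[k] W) (σ δ : ℤ × ℤ)
    {θ : List V → W} (hθ : MultiLin k θ) :
    ∃ θ' : List V → W, MultiLin k θ' ∧ ∀ l ds, HomList gr l ds →
      θ' l = π' (ds.sum + δ - (l.length : ℤ) • σ) (θ l) := by
  classical
  let := h.isInternal.chooseDecomposition
  let g : (n : ℕ) → MultilinearMap k (fun _ : Fin n => V) W := fun n =>
    (MultilinearMap.fromDirectSumEquiv (R := k) (M' := W) (M := fun (_ : Fin n) d => gr d) fun p =>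
      (π' (∑ i, p i + δ - (n : ℤ) • σ)).compMultilinearMap
        ((toMulti hθ n).compLinearMap fun i => (gr (p i)).subtype)).compLinearMap
      fun _ => (DirectSum.decomposeLinearEquiv gr).toLinearMap
  refine ⟨ofList fun n => g n, multiLin_ofList g, fun l ds hl => ?_⟩
  have hlen := hl.length_eq
  have hmem : ∀ i : Fin l.length, l.getD i 0 ∈ gr (ds.getD i 0) := fun i => by
    rw [List.getD_eq_getElem _ _ i.2, List.getD_eq_getElem _ _ (hlen ▸ i.2)]
    exact hl.get i.2 (hlen ▸ i.2)
  have key := MultilinearMap.fromDirectSumEquiv_lof (R := k) (M' := W)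
    (M := fun (_ : Fin l.length) d => gr d) (fun p =>
      (π' (∑ i, p i + δ - (l.length : ℤ) • σ)).compMultilinearMap
        ((toMulti hθ l.length).compLinearMap fun i => (gr (p i)).subtype))
    (fun i => ds.getD i 0) (fun i => ⟨l.getD i 0, hmem i⟩)
  refine Eq.trans ?_ (key.trans ?_)
  · change MultilinearMap.fromDirectSumEquiv _ (fun i : Fin l.length => DirectSum.decomposeLinearEquiv gr (l.getD i 0)) = _
    congr 1
    funext i
    exact DirectSum.decomposeLinearEquiv_apply_coe gr _ ⟨_, hmem i⟩
  · have hsum : ∑ i : Fin l.length, ds.getD i 0 = ds.sum := by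
      rw [hlen, ← List.sum_ofFn]
      congr 1
      refine List.ext_getElem (by simp) fun i h1 h2 => ?_
      simp
    rw [hsum]
    change π' _ (ofList (fun n => toMulti hθ n) l) = _
    rw [ofList_toMulti]

/-- By induction composition with `q` is surjective on maps in `n` variables; currying turns a map
in `n + 1` variables into a linear map from the projective module `H` to those, which therefore
lifts. -/
theorem exists_lift_multilinear {H M M' : Type*} [AddCommGroup H] [Module k H] [AddCommGroup M]
    [Module k M] [AddCommGroup M'] [Module k M'] [Module.Projective k H] (q : M' →ₗ[k] M)
    (hq : Function.Surjective q) (n : ℕ) (e : MultilinearMap k (fun _ : Fin n => H) M) :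
    ∃ g : MultilinearMap k (fun _ : Fin n => H) M', q.compMultilinearMap g = e := by
  induction n with
  | zero =>
    obtain ⟨y, hy⟩ := hq (e Fin.elim0)
    refine ⟨MultilinearMap.constOfIsEmpty k _ y, ?_⟩
    ext a
    rw [show a = Fin.elim0 from Subsingleton.elim _ _]
    exact hy
  | succ n ih =>
    obtain ⟨g, hg⟩ := Module.projective_lifting_property
      (q.compMultilinearMapₗ k (M₁ := fun _ : Fin n => H)) e.curryLeft ih
    refine ⟨g.uncurryLeft, ?_⟩
    ext a
    have := congrArg (fun φ => φ (a 0) (Fin.tail a)) hg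
    simpa using this

theorem exists_lift {H M M' : Type w} [AddCommGroup H] [Module k H] [AddCommGroup M]
    [Module k M] [AddCommGroup M'] [Module k M'] [Module.Projective k H] (q : M' →ₗ[k] M)
    {e : List H → M} (he : MultiLin k e) (hq : ∀ l, e l ∈ LinearMap.range q) :
    ∃ g : List H → M', MultiLin k g ∧ ∀ l, q (g l) = e l := by
  have h : ∀ n, ∃ g : MultilinearMap k (fun _ : Fin n => H) M',
      q.compMultilinearMap g = toMulti he n := by
    intro n
    obtain ⟨g, hg⟩ := exists_lift_multilinear q.rangeRestrict q.surjective_rangeRestrict n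
      ((toMulti he n).codRestrict (LinearMap.range q) fun a => hq _)
    refine ⟨g, ?_⟩
    ext a
    exact congrArg Subtype.val (congrArg (fun φ => φ a) hg)
  choose g hg using h
  refine ⟨ofList fun n => g n, multiLin_ofList g, fun l => ?_⟩
  rw [← congrFun (ofList_toMulti he) l]
  exact DFunLike.congr_fun (hg l.length) fun i : Fin l.length => l.getD i 0

/-- Lifting a homogeneous multilinear function along a surjection `(β, φ) ↦ f β - m φ`. -/
theorem exists_graded_lift (h : IsProj gr π) (h' : IsProj gr' π') [Module.Projective k V]
    {σ δ τ : ℤ × ℤ} (f : V →ₗ[k] W) (hf : ∀ d, ∀ x ∈ gr d, f x ∈ gr' d)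
    (m : W →ₗ[k] W) (hm : ∀ d, ∀ x ∈ gr' d, m x ∈ gr' (d + τ)) {e : List V → W}
    (he : MultiLin k e) (heh : Homog gr gr' σ δ e) (hex : ∀ l, ∃ x y, e l = f x - m y) :
    ∃ (β : List V → V) (φ : List V → W), MultiLin k β ∧ MultiLin k φ ∧ Homog gr gr σ δ β ∧
      Homog gr gr' σ (δ - τ) φ ∧ ∀ l, e l = f (β l) - m (φ l) := by
  obtain ⟨g, hg, hgq⟩ := exists_lift (f.coprod (-m)) he fun l => by
    obtain ⟨x, y, hxy⟩ := hex l
    exact ⟨(x, y), by simp [hxy, sub_eq_add_neg]⟩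
  -- Since `e` is homogeneous and `f`, `m` have bidegrees `0` and `τ`, the homogeneous parts of the
  -- two components of a solution still form a solution.
  obtain ⟨β, hβ, hβ'⟩ := exists_homogeneous_part h π σ δ (hg.comp_left (LinearMap.fst k V W))
  obtain ⟨φ, hφ, hφ'⟩ := exists_homogeneous_part h π' σ (δ - τ) (hg.comp_left (LinearMap.snd k V W))
  refine ⟨β, φ, hβ, hφ, fun l ds hl => ?_, fun l ds hl => ?_, ?_⟩
  · rw [hβ' l ds hl]; exact h.mem _ _
  · rw [hφ' l ds hl]; exact h'.mem _ _
  · refine MultiLin.ext_homog he ((hβ.comp_left f).sub (hφ.comp_left m)) h.span ?_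
    intro l ds hl
    have h1 := h.comm h' f.toAddMonoidHom 0 (by simpa using hf) (ds.sum + δ - (l.length : ℤ) • σ)
      (g l).1
    have h2 := h'.comm h' m.toAddMonoidHom τ hm (ds.sum + (δ - τ) - (l.length : ℤ) • σ) (g l).2
    rw [add_zero] at h1
    rw [show ds.sum + (δ - τ) - (l.length : ℤ) • σ + τ = ds.sum + δ - (l.length : ℤ) • σ by abel]
      at h2
    rw [hβ' l ds hl, hφ' l ds hl]
    refine Eq.trans ?_ (congrArg₂ (· - ·) h1 h2)
    rw [← map_sub, ← h'.same _ _ (heh l ds hl), ← hgq l]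
    simp [sub_eq_add_neg]

end projections

/-! ### The bigrading of the cohomology -/

section cohomology

variable {k : Type u} [CommRing k] {V : Type w} [AddCommGroup V] [Module k V]
  {gr : ℤ × ℤ → Submodule k V} {π : ℤ × ℤ → V →ₗ[k] V}

/-- The projections commute with `d` up to the shift by `τ`, so they preserve cycles and boundaries
and descend. -/
theorem exists_isProj_cohomology (h : IsProj gr π) (d : V →ₗ[k] V) (τ : ℤ × ℤ)
    (hd : ∀ p, ∀ x ∈ gr p, d x ∈ gr (p + τ)) :
    ∃ π', IsProj (cohomologyGrading gr d) π' := by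
  have hcomm : ∀ p x, π (p + τ) (d x) = d (π p x) := h.comm h d.toAddMonoidHom τ hd
  have hcomm' : ∀ p x, π p (d x) = d (π (p - τ) x) := fun p x => by
    rw [← hcomm, sub_add_cancel]
  have hker : ∀ p, ∀ x ∈ LinearMap.ker d, π p x ∈ LinearMap.ker d := fun p x hx => by
    rw [LinearMap.mem_ker] at hx ⊢
    rw [← hcomm, hx, map_zero]
  let π' : ℤ × ℤ → Cohomology d →ₗ[k] Cohomology d := fun p =>
    Submodule.mapQ _ _ ((π p).restrict (hker p)) (by
      rintro ⟨x, hx⟩ ⟨y, hy⟩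
      exact ⟨π (p - τ) y, by rw [← hcomm', hy]; rfl⟩)
  have hπ' : ∀ p (x : LinearMap.ker d), π' p (Submodule.Quotient.mk x)
      = Submodule.Quotient.mk ⟨π p x, hker p x x.2⟩ := fun p x => rfl
  refine ⟨π', ?_, ?_, ?_, ?_⟩
  · intro p x
    obtain ⟨x, rfl⟩ := Submodule.Quotient.mk_surjective _ x
    exact ⟨⟨π p x, hker p x x.2⟩, h.mem p x, rfl⟩
  · rintro p _ ⟨x, hx, rfl⟩
    exact congrArg Submodule.Quotient.mk (Subtype.ext (h.same p x hx))
  · rintro p p' hp _ ⟨x, hx, rfl⟩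
    have h0 : (⟨π p' x, hker p' x x.2⟩ : LinearMap.ker d) = 0 := Subtype.ext (h.ne p p' hp x hx)
    exact (hπ' p' x).trans (by rw [h0]; rfl)
  · refine eq_top_iff.2 fun x _ => ?_
    obtain ⟨x, rfl⟩ := Submodule.Quotient.mk_surjective _ x
    obtain ⟨t, -, ht⟩ := h.exists_sum (x : V)
    have : x = ∑ p ∈ t, ⟨π p x, hker p x x.2⟩ := Subtype.ext (by
      rw [AddSubmonoidClass.coe_finsetSum]; exact ht)
    rw [this]
    change (Submodule.mkQ _) _ ∈ _
    rw [map_sum]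
    exact Submodule.sum_mem _ fun p _ => Submodule.mem_iSup_of_mem p ⟨_, h.mem p x, rfl⟩

end cohomology

/-! ### A linear form on a unital projective algebra -/

section unitform

variable {k : Type u} [CommRing k] {V : Type w} [AddCommGroup V] [Module k V]

/-- For a bilinear product with unit `u` on a projective module, the line through `u` is a direct
summand. -/
theorem exists_unit_form [Module.Projective k V] (u : V) (μ : V →ₗ[k] V →ₗ[k] V)
    (hμ : ∀ x, μ u x = x) : ∃ lam : V →ₗ[k] k, lam u • u = u := by
  classical
  obtain ⟨c, hc⟩ := (Module.projective_def (R := k) (P := V)).1 inferInstance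
  obtain ⟨φ, hφ⟩ : ∃ φ : V → V →ₗ[k] k, ∀ h x, φ h x = c x h :=
    ⟨fun h => Finsupp.lapply h ∘ₗ c, fun _ _ => rfl⟩
  have hu : ∀ x, x = ∑ h ∈ (c x).support, φ h x • h := fun x => by
    have := hc x
    rw [Finsupp.linearCombination_apply, Finsupp.sum] at this
    simp only [hφ]
    exact this.symm
  -- `I` consists of the values of linear forms at `u`. Since `x = μ u x`, the value of a form at
  -- any `x` is the value of another form at `u`, so `I` is the trace ideal of `V`.
  let I : Ideal k := LinearMap.range ((LinearMap.applyₗ u : (V →ₗ[k] k) →ₗ[k] k))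
  have hI : ∀ (ψ : V →ₗ[k] k) x, ψ x ∈ I := fun ψ x => ⟨ψ ∘ₗ μ.flip x, by simp [hμ]⟩
  have hgen : I = Ideal.span ((c u).support.image fun h => φ h u : Set k) := by
    refine le_antisymm ?_ (Ideal.span_le.2 ?_)
    · rintro _ ⟨ψ, rfl⟩
      have hψ : ψ u = ∑ h ∈ (c u).support, ψ (φ h u • h) := by rw [← map_sum, ← hu u]
      change ψ u ∈ _
      rw [hψ]
      refine Submodule.sum_mem _ fun h hh => ?_
      rw [map_smul, smul_eq_mul, mul_comm]
      exact Ideal.mul_mem_left _ _ (Ideal.subset_span (Finset.mem_coe.2 (Finset.mem_image_of_mem _ hh)))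
    · intro y hy
      obtain ⟨h, -, rfl⟩ := Finset.mem_image.1 (Finset.mem_coe.1 hy)
      exact hI _ _
  have hfg : I.FG := ⟨_, hgen.symm⟩
  -- Expanding `u` in a dual basis writes `ψ u` as a sum of products `φ h u * ψ h` of two elements
  -- of `I`. A finitely generated idempotent ideal is generated by an idempotent `ε`.
  have hidem : IsIdempotentElem I := by
    refine le_antisymm Ideal.mul_le_left ?_
    rintro _ ⟨ψ, rfl⟩
    have hψ : ψ u = ∑ h ∈ (c u).support, ψ (φ h u • h) := by rw [← map_sum, ← hu u]
    change ψ u ∈ _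
    rw [hψ]
    refine Submodule.sum_mem _ fun h hh => ?_
    rw [map_smul, smul_eq_mul]
    exact Ideal.mul_mem_mul (hI _ _) (hI _ _)
  obtain ⟨ε, hε, hIε⟩ := (Ideal.isIdempotentElem_iff_of_fg I hfg).1 hidem
  obtain ⟨lam, hlam⟩ : ε ∈ I := by rw [hIε]; exact Submodule.mem_span_singleton_self ε
  refine ⟨lam, ?_⟩
  change lam u = ε at hlam
  rw [hlam]
  -- The idempotent `ε` fixes every element of `I`, in particular the coordinates of `u`, and hence
  -- `u`.
  suffices hs : ε • ∑ h ∈ (c u).support, φ h u • h = ∑ h ∈ (c u).support, φ h u • h by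
    rwa [← hu u] at hs
  rw [Finset.smul_sum]
  refine Finset.sum_congr rfl fun h _ => ?_
  have : φ h u ∈ I := hI _ _
  rw [hIε] at this
  obtain ⟨a, ha⟩ := Submodule.mem_span_singleton.1 this
  rw [smul_smul, ← ha, smul_eq_mul, mul_left_comm, hε.eq]

end unitform

/-! ### Quasi-isomorphisms -/

section cone

variable {R : Type v} [CommRing R] {V W : Type w} [AddCommGroup V] [Module R V] [AddCommGroup W]
  [Module R W]

/-- Exactness of the mapping cone of `φ`. -/
def ConeExact (d : V →ₗ[R] V) (d' : W →ₗ[R] W) (φ : V →ₗ[R] W) : Prop :=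
  ∀ x y, d x = 0 → φ x = d' y → ∃ z w, x = d z ∧ y = φ z + d' w

theorem ConeExact.isQuasiIsoMap {d : V →ₗ[R] V} {d' : W →ₗ[R] W} {φ : V →ₗ[R] W}
    (h : ConeExact d d' φ) (hc : ∀ x, φ (d x) = d' (φ x)) : IsQuasiIsoMap d d' φ := by
  refine ⟨hc, ?_, ?_⟩
  · rw [injective_iff_map_eq_zero]
    intro x hx
    obtain ⟨⟨x, hxk⟩, rfl⟩ := Submodule.Quotient.mk_surjective _ x
    obtain ⟨y, hy⟩ := (Submodule.Quotient.mk_eq_zero _).1 hx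
    obtain ⟨z, -, hz, -⟩ := h x y hxk hy.symm
    exact (Submodule.Quotient.mk_eq_zero _).2 ⟨z, hz.symm⟩
  · intro y
    obtain ⟨⟨y, hy⟩, rfl⟩ := Submodule.Quotient.mk_surjective _ y
    obtain ⟨z, w, hz, hw⟩ := h 0 y (map_zero _) (by rw [map_zero]; exact hy.symm)
    refine ⟨Submodule.Quotient.mk ⟨z, hz.symm⟩, ?_⟩
    refine (Submodule.Quotient.eq _).2 ⟨-w, ?_⟩
    change d' (-w) = φ z - y
    rw [hw, map_neg]; abel

/-- Injectivity gives `z` with `d z = x`; the cycle `y - φ z` is then reached, up to a boundary, by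
surjectivity. -/
theorem IsQuasiIsoMap.coneExact {d : V →ₗ[R] V} {d' : W →ₗ[R] W} {φ : V →ₗ[R] W}
    (h : IsQuasiIsoMap d d' φ) : ConeExact d d' φ := by
  obtain ⟨hc, hinj, hsurj⟩ := h
  intro x y hx hxy
  have h1 : cohomologyMap d d' φ hc (Submodule.Quotient.mk ⟨x, hx⟩) = 0 :=
    (Submodule.Quotient.mk_eq_zero _).2 ⟨y, hxy.symm⟩
  obtain ⟨z, hz⟩ := (Submodule.Quotient.mk_eq_zero _).1 ((injective_iff_map_eq_zero _).1 hinj _ h1)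
  change d z = x at hz
  have h2 : d' (y - φ z) = 0 := by rw [map_sub, ← hc, hz, hxy, sub_self]
  obtain ⟨z', hz'⟩ := hsurj (Submodule.Quotient.mk ⟨y - φ z, h2⟩)
  obtain ⟨⟨z', hz'k⟩, rfl⟩ := Submodule.Quotient.mk_surjective _ z'
  obtain ⟨w, hw⟩ := (Submodule.Quotient.eq _).1 hz'
  change d' w = φ z' - (y - φ z) at hw
  refine ⟨z + z', -w, ?_, ?_⟩
  · rw [map_add, hz, show d z' = 0 from hz'k, add_zero]
  · rw [map_neg, hw, map_add]; abel

end cone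

/-! ### The differential and the linear part of a morphism -/

section algebra

variable {k : Type u} {R : Type v} [CommRing k] [CommRing R]
  {V : Type w} [AddCommGroup V] [Module k V] [Module R V] {gr : ℤ × ℤ → Submodule k V}
  {W : Type w} [AddCommGroup W] [Module k W] [Module R W] {gr' : ℤ × ℤ → Submodule k W}
  {s : ℕ}

theorem Algebra.d_mem (X : Algebra k R gr s) (p : ℤ × ℤ) (x : V) (hx : x ∈ gr p) :
    X.d x ∈ gr (p + typ s) := by
  have := X.homogeneous 1 (fun _ => p) (fun _ => x) fun _ => hx
  rw [Fin.sum_univ_one, show (2 - ((1 : ℕ) : ℤ)) = 1 by norm_num, one_smul] at this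
  exact this

theorem Hom.linear_mem {X : Algebra k R gr s} {Y : Algebra k R gr' s} (f : Hom X Y) (p : ℤ × ℤ)
    (x : V) (hx : x ∈ gr p) : f.linear x ∈ gr' p := by
  have := f.homogeneous 1 (fun _ => p) (fun _ => x) fun _ => hx
  rw [Fin.sum_univ_one, show (1 - ((1 : ℕ) : ℤ)) = 0 by norm_num, zero_smul, add_zero] at this
  exact this

theorem Algebra.d_d (X : Algebra k R gr s) {e : V →ₗ[R] V} (he : IsGrading gr e) (x : V) :
    X.d (X.d x) = 0 := by
  have h : X.op e [X.op e [x]] = 0 := X.coder_op he [x]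
  rwa [X.op_one, X.op_one] at h

theorem Hom.linear_d {X : Algebra k R gr s} {Y : Algebra k R gr' s} (f : Hom X Y)
    {e : V →ₗ[R] V} (he : IsGrading gr e) {e' : W →ₗ[R] W} (he' : IsGrading gr' e') (x : V) :
    f.linear (X.d x) = Y.d (f.linear x) := by
  have h : Y.op e' [f.op e [x]] = f.op e [X.op e [x]] := f.pull_op he he' [x]
  rw [X.op_one, f.op_one, f.op_one, Y.op_one] at h
  exact h.symm

end algebra

/-! ### Exactness of the mapping cone: from the reduction modulo `ħ` to series -/

section series

variable {k : Type u} [CommRing k] {V : Type w} [AddCommGroup V] [Module k V]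
  {gr : ℤ × ℤ → Submodule k V} {π : ℤ × ℤ → V →ₗ[k] V}
  {W : Type w} [AddCommGroup W] [Module k W] {gr' : ℤ × ℤ → Submodule k W}
  {π' : ℤ × ℤ → W →ₗ[k] W}

local notation "ħ" => (Polynomial.X : Polynomial k)

theorem exists_isProj_series (h : IsProj gr π) :
    ∃ pr : ℤ × ℤ → BgrSeries gr →ₗ[k] BgrSeries gr, IsProj (seriesGrading gr) pr := by
  have hmem : ∀ d (x : BgrSeries gr),
      (fun r : ℕ => π (d + (r : ℤ) • hdeg) (coeff gr r x)) ∈ homogeneousSeries gr d := fun d x =>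
    mem_homogeneousSeries.2 fun r => h.mem _ _
  refine ⟨fun d =>
    { toFun := fun x => mkSeries _ (le_iSup (homogeneousSeries gr) d (hmem d x))
      map_add' := fun x y => coeff_ext fun N => map_add (π _ ∘ₗ coeff gr N) x y
      map_smul' := fun c x => coeff_ext fun N => map_smul (π _ ∘ₗ coeff gr N) c x },
    fun d x => hmem d x, fun d x hx => ?_, fun d d' hd x hx => ?_, seriesGrading_span⟩
  · exact coeff_ext fun N => h.same _ _ (mem_seriesGrading.1 hx N)
  · refine coeff_ext fun N => (h.ne _ _ ?_ _ (mem_seriesGrading.1 hx N)).trans (map_zero _).symm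
    exact fun e => hd (add_right_cancel e)

/-- A map of complexes of series whose reduction modulo `ħ` has an exact cone has an exact cone. -/
theorem ConeExact.series (h : IsProj gr π) (h' : IsProj gr' π') {τ : ℤ × ℤ}
    {d : V →ₗ[k] V} {d' : W →ₗ[k] W} {φ : V →ₗ[k] W} (hex : ConeExact d d' φ)
    (hd : ∀ p, ∀ x ∈ gr p, d x ∈ gr (p + τ)) (hd' : ∀ p, ∀ x ∈ gr' p, d' x ∈ gr' (p + τ))
    (hφ : ∀ p, ∀ x ∈ gr p, φ x ∈ gr' p)
    {D : BgrSeries gr →ₗ[Polynomial k] BgrSeries gr}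
    {D' : BgrSeries gr' →ₗ[Polynomial k] BgrSeries gr'}
    {Φ : BgrSeries gr →ₗ[Polynomial k] BgrSeries gr'}
    (hD : ∀ p, ∀ x ∈ seriesGrading gr p, D x ∈ seriesGrading gr (p + τ))
    (hD' : ∀ p, ∀ x ∈ seriesGrading gr' p, D' x ∈ seriesGrading gr' (p + τ))
    (hΦ : ∀ p, ∀ x ∈ seriesGrading gr p, Φ x ∈ seriesGrading gr' p)
    (hDd : ∀ x, coeff gr 0 (D x) = d (coeff gr 0 x))
    (hDd' : ∀ x, coeff gr' 0 (D' x) = d' (coeff gr' 0 x))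
    (hΦφ : ∀ x, coeff gr' 0 (Φ x) = φ (coeff gr 0 x))
    (hDD : ∀ x, D (D x) = 0) (hDD' : ∀ x, D' (D' x) = 0) (hc : ∀ x, Φ (D x) = D' (Φ x)) :
    ConeExact D D' Φ := by
  classical
  have homogeneous_case : ∀ p x y, x ∈ seriesGrading gr p → y ∈ seriesGrading gr' (p - τ) →
      D x = 0 → Φ x = D' y → ∃ z w, x = D z ∧ y = Φ z + D' w := by
    intro p x y hx hy hDx hxy
    -- The remainder after `N` steps is again a cocycle of the cone. It has been divided by `ħ` each
    -- time, so its bidegree has moved by `N • hdeg`.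
    let Good : ℕ → BgrSeries gr × BgrSeries gr' → Prop := fun N a =>
      a.1 ∈ seriesGrading gr (p + (N : ℤ) • hdeg) ∧
      a.2 ∈ seriesGrading gr' (p + (N : ℤ) • hdeg - τ) ∧ D a.1 = 0 ∧ Φ a.1 = D' a.2
    have step : ∀ N (a : {a // Good N a}), ∃ (b : {b // Good (N + 1) b}) (z : V) (w : W),
        z ∈ gr (p - τ + (N : ℤ) • hdeg) ∧ w ∈ gr' (p - τ - τ + (N : ℤ) • hdeg) ∧
        a.1.1 = D (constLin h.span z) + ħ • b.1.1 ∧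
        a.1.2 = Φ (constLin h.span z) + D' (constLin h'.span w) + ħ • b.1.2 := by
      rintro N ⟨⟨x, y⟩, hx, hy, hDx, hxy⟩
      dsimp only at hx hy hDx hxy ⊢
      obtain ⟨z, w, hz, hw⟩ := hex (coeff gr 0 x) (coeff gr' 0 y)
        (by rw [← hDd, hDx, map_zero]) (by rw [← hΦφ, hxy, hDd'])
      have hx0 := mem_seriesGrading.1 hx 0
      have hy0 := mem_seriesGrading.1 hy 0
      rw [Nat.cast_zero, zero_smul, add_zero] at hx0 hy0
      have e1 : p - τ + (N : ℤ) • hdeg + τ = p + (N : ℤ) • hdeg := by abel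
      have e2 : p - τ + (N : ℤ) • hdeg = p + (N : ℤ) • hdeg - τ := by abel
      have e3 : p - τ - τ + (N : ℤ) • hdeg + τ = p + (N : ℤ) • hdeg - τ := by abel
      -- The constant terms of `x` and `y` are homogeneous, so `z` and `w` may be replaced by their
      -- components of the matching bidegrees.
      set z' := π (p - τ + (N : ℤ) • hdeg) z with hz'
      set w' := π' (p - τ - τ + (N : ℤ) • hdeg) w with hw'
      have hz1 : d z' = coeff gr 0 x := by
        have := h.comm h d.toAddMonoidHom τ hd (p - τ + (N : ℤ) • hdeg) z
        rw [e1] at this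
        refine this.symm.trans ?_
        rw [show d.toAddMonoidHom z = coeff gr 0 x from hz.symm, h.same _ _ hx0]
      have hw1 : φ z' + d' w' = coeff gr' 0 y := by
        have h1 := h.comm h' φ.toAddMonoidHom 0 (by simpa using hφ) (p - τ + (N : ℤ) • hdeg) z
        have h2 := h'.comm h' d'.toAddMonoidHom τ hd' (p - τ - τ + (N : ℤ) • hdeg) w
        rw [add_zero, e2] at h1
        rw [e3] at h2
        rw [hz', e2]
        refine (congrArg₂ (· + ·) h1 h2).symm.trans ?_
        rw [← map_add, ← h'.same _ _ hy0]
        exact congrArg _ hw.symm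
      have hz'm : z' ∈ gr (p - τ + (N : ℤ) • hdeg) := h.mem _ _
      have hw'm : w' ∈ gr' (p - τ - τ + (N : ℤ) • hdeg) := h'.mem _ _
      have hcz := constLin_mem h.span hz'm
      have hcw := constLin_mem h'.span hw'm
      set x' := x - D (constLin h.span z') with hx'
      set y' := y - Φ (constLin h.span z') - D' (constLin h'.span w') with hy'
      have hx'0 : coeff gr 0 x' = 0 := by
        rw [hx', map_sub, hDd, coeff_constLin_zero, hz1, sub_self]
      have hy'0 : coeff gr' 0 y' = 0 := by
        rw [hy', map_sub, map_sub, hΦφ, hDd', coeff_constLin_zero, coeff_constLin_zero, ← hw1]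
        abel
      have hxs : x' = ħ • unshift x' := by
        have := eq_constLin_add h.span x'
        rwa [hx'0, map_zero, zero_add] at this
      have hys : y' = ħ • unshift y' := by
        have := eq_constLin_add h'.span y'
        rwa [hy'0, map_zero, zero_add] at this
      have hx'm : x' ∈ seriesGrading gr (p + (N : ℤ) • hdeg) := by
        refine Submodule.sub_mem _ hx ?_
        have := hD _ _ hcz
        rwa [e1] at this
      have hy'm : y' ∈ seriesGrading gr' (p + (N : ℤ) • hdeg - τ) := by
        refine Submodule.sub_mem _ (Submodule.sub_mem _ hy ?_) ?_
        · have := hΦ _ _ hcz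
          rwa [e2] at this
        · have := hD' _ _ hcw
          rwa [e3] at this
      have e4 : p + ((N + 1 : ℕ) : ℤ) • hdeg = p + (N : ℤ) • hdeg + hdeg := by
        push_cast; rw [add_smul, one_smul]; abel
      refine ⟨⟨(unshift x', unshift y'), ?_, ?_, ?_, ?_⟩, z', w', hz'm, hw'm, ?_, ?_⟩
      · rw [e4]; exact unshift_mem hx'm
      · rw [e4, add_sub_right_comm]; exact unshift_mem hy'm
      · refine X_smul_injective ?_
        rw [← map_smul, ← hxs, smul_zero, hx', map_sub, hDx, hDD, sub_zero]
      · refine X_smul_injective ?_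
        change ħ • Φ (unshift x') = ħ • D' (unshift y')
        rw [← Φ.map_smul, ← D'.map_smul, ← hxs, ← hys, hx', hy', map_sub, map_sub, map_sub, hc,
          hDD', hxy, sub_zero]
      · change x = _ + ħ • unshift x'
        rw [← hxs, hx']; abel
      · change y = _ + ħ • unshift y'
        rw [← hys, hy']; abel
    choose next zf wf hzf hwf hxf hyf using step
    have g0 : Good 0 (x, y) := by
      refine ⟨?_, ?_, hDx, hxy⟩ <;> simpa
    -- The solution has as coefficient of `ħ ^ N` the elements found in step `N`. The tails that
    -- begin at step `M` are solutions for the remainder of that step, which is what the recursion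
    -- `hZ`, `hW` uses.
    let sq : (N : ℕ) → {a // Good N a} := fun N => Nat.rec ⟨(x, y), g0⟩ (fun N a => next N a) N
    have hz : ∀ M, (fun r => zf (M + r) (sq (M + r))) ∈ seriesSubmodule gr := fun M => by
      refine le_iSup (homogeneousSeries gr) (p - τ + (M : ℤ) • hdeg) (mem_homogeneousSeries.2 fun r => ?_)
      have := hzf (M + r) (sq (M + r))
      rwa [Nat.cast_add, add_smul, ← add_assoc] at this
    have hw : ∀ M, (fun r => wf (M + r) (sq (M + r))) ∈ seriesSubmodule gr' := fun M => by
      refine le_iSup (homogeneousSeries gr') (p - τ - τ + (M : ℤ) • hdeg)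
        (mem_homogeneousSeries.2 fun r => ?_)
      have := hwf (M + r) (sq (M + r))
      rwa [Nat.cast_add, add_smul, ← add_assoc] at this
    have hZ : ∀ M, mkSeries _ (hz M) = constLin h.span (zf M (sq M)) + ħ • mkSeries _ (hz (M + 1)) := by
      intro M
      refine coeff_ext fun N => ?_
      rw [map_add]
      cases N with
      | zero => rw [coeff_constLin_zero, coeff_X_smul_zero, add_zero]; rfl
      | succ N =>
        rw [coeff_constLin_succ, coeff_X_smul_succ, zero_add, coeff_mkSeries, coeff_mkSeries,
          show M + (N + 1) = M + 1 + N by omega]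
    have hW : ∀ M, mkSeries _ (hw M) = constLin h'.span (wf M (sq M)) + ħ • mkSeries _ (hw (M + 1)) := by
      intro M
      refine coeff_ext fun N => ?_
      rw [map_add]
      cases N with
      | zero => rw [coeff_constLin_zero, coeff_X_smul_zero, add_zero]; rfl
      | succ N =>
        rw [coeff_constLin_succ, coeff_X_smul_succ, zero_add, coeff_mkSeries, coeff_mkSeries,
          show M + (N + 1) = M + 1 + N by omega]
    -- Removing the constant term turns the difference at `M` into `ħ` times the difference at `M +
    -- 1`; so it is divisible by every power of `ħ`.
    have hxd : ∀ j M, Div (ħ ^ j) ((sq M).1.1 - D (mkSeries _ (hz M))) := by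
      intro j
      induction j with
      | zero => intro M; exact ⟨_, by rw [pow_zero, one_smul]⟩
      | succ j ih =>
        intro M
        obtain ⟨t, ht⟩ := ih (M + 1)
        refine ⟨t, ?_⟩
        rw [pow_succ', mul_smul, ← ht, hxf M (sq M), hZ M, map_add, map_smul, smul_sub]
        exact add_sub_add_left_eq_sub _ _ _
    have hyd : ∀ j M, Div (ħ ^ j)
        ((sq M).1.2 - (Φ (mkSeries _ (hz M)) + D' (mkSeries _ (hw M)))) := by
      intro j
      induction j with
      | zero => intro M; exact ⟨_, by rw [pow_zero, one_smul]⟩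
      | succ j ih =>
        intro M
        obtain ⟨t, ht⟩ := ih (M + 1)
        refine ⟨t, ?_⟩
        rw [pow_succ', mul_smul, ← ht, hyf M (sq M), hZ M, hW M, map_add, map_smul, map_add,
          map_smul, smul_sub, smul_add, add_add_add_comm]
        exact add_sub_add_left_eq_sub _ _ _
    exact ⟨_, _, sub_eq_zero.1 (eq_zero_of_div fun j => hxd j 0),
      sub_eq_zero.1 (eq_zero_of_div fun j => hyd j 0)⟩
  -- A general cocycle of the cone is a finite sum of homogeneous ones.
  intro x y hx hxy
  obtain ⟨pr, hP⟩ := exists_isProj_series h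
  obtain ⟨pr', hP'⟩ := exists_isProj_series h'
  have c1 := hP.comm hP D.toAddMonoidHom τ hD
  have c2 := hP'.comm hP' D'.toAddMonoidHom τ hD'
  have c3 := hP.comm hP' Φ.toAddMonoidHom 0 (by simpa using hΦ)
  have key : ∀ p, ∃ z w, pr p x = D z ∧ pr' (p - τ) y = Φ z + D' w := by
    intro p
    refine homogeneous_case p _ _ (hP.mem _ _) (hP'.mem _ _) ?_ ?_
    · have := c1 p x
      change pr (p + τ) (D x) = D (pr p x) at this
      rw [← this, hx, map_zero]
    · have h3 := c3 p x
      have h2 := c2 (p - τ) y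
      change pr' (p + 0) (Φ x) = Φ (pr p x) at h3
      change pr' (p - τ + τ) (D' y) = D' (pr' (p - τ) y) at h2
      rw [← h3, ← h2, hxy, add_zero, sub_add_cancel]
  choose z w hz hw using key
  obtain ⟨t, ht0, ht⟩ := hP.exists_sum x
  obtain ⟨t', ht0', ht'⟩ := hP'.exists_sum y
  -- The component of `y` that belongs to bidegree `p` of `x` is the one of bidegree `p - τ`; the
  -- support of `y` is shifted accordingly.
  let T := t ∪ t'.image (· + τ)
  have hxT : x = ∑ p ∈ T, pr p x :=
    ht.trans (Finset.sum_subset Finset.subset_union_left fun p _ hp => ht0 p hp)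
  have hyT : y = ∑ p ∈ T, pr' (p - τ) y := by
    refine ht'.trans (Eq.trans ?_
      (Finset.sum_subset (Finset.subset_union_right (s₁ := t)) fun p _ hp => ?_))
    · rw [Finset.sum_image fun a _ b _ hab => add_right_cancel hab]
      simp only [add_sub_cancel_right]
    · exact ht0' _ fun hp' => hp (Finset.mem_image.2 ⟨_, hp', sub_add_cancel _ _⟩)
  refine ⟨∑ p ∈ T, z p, ∑ p ∈ T, w p, ?_, ?_⟩
  · rw [map_sum]
    exact hxT.trans (Finset.sum_congr rfl fun p _ => hz p)
  · rw [map_sum, map_sum, ← Finset.sum_add_distrib]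
    exact hyT.trans (Finset.sum_congr rfl fun p _ => hw p)

theorem mem_hbarPow {N : ℕ} {M : Type w} [AddCommGroup M] [Module (Polynomial k) M] {x : M} :
    x ∈ hbarPow k N M ↔ ∃ y, x = ħ ^ (N + 1) • y := by
  rw [hbarPow, Submodule.ideal_span_singleton_smul, Submodule.mem_smul_pointwise_iff_exists]
  constructor
  · rintro ⟨y, -, rfl⟩; exact ⟨y, rfl⟩
  · rintro ⟨y, rfl⟩; exact ⟨y, trivial, rfl⟩

/-- A cocycle modulo `ħ ^ (N + 1)` has as error `ħ ^ (N + 1)` times a pair `(a, b)`, which is itself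
a cocycle of the cone because `ħ` acts injectively. A primitive `(z, w)` of this pair, multiplied by
`ħ ^ (N + 1)`, corrects `(x, y)` to a true cocycle. -/
theorem ConeExact.reduction {D : BgrSeries gr →ₗ[Polynomial k] BgrSeries gr}
    {D' : BgrSeries gr' →ₗ[Polynomial k] BgrSeries gr'}
    {Φ : BgrSeries gr →ₗ[Polynomial k] BgrSeries gr'} (h : ConeExact D D' Φ)
    (hDD : ∀ x, D (D x) = 0) (hDD' : ∀ x, D' (D' x) = 0) (hc : ∀ x, Φ (D x) = D' (Φ x)) (N : ℕ) :
    ConeExact (reduction N D) (reduction N D') (reduction N Φ) := by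
  intro x y hx hxy
  obtain ⟨x, rfl⟩ := Submodule.Quotient.mk_surjective _ x
  obtain ⟨y, rfl⟩ := Submodule.Quotient.mk_surjective _ y
  obtain ⟨a, ha⟩ := mem_hbarPow.1 ((Submodule.Quotient.mk_eq_zero _).1 hx)
  obtain ⟨b, hb⟩ := mem_hbarPow.1 ((Submodule.Quotient.eq _).1 hxy)
  obtain ⟨z, w, hz, hw⟩ := h a b
    (X_pow_smul_injective (N + 1) (by rw [← map_smul, ← ha, hDD, smul_zero]))
    (X_pow_smul_injective (N + 1) (by
      rw [← map_smul, ← map_smul, ← ha, ← hb, map_sub, hDD', sub_zero, hc]))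
  obtain ⟨z', w', hz', hw'⟩ := h (x - ħ ^ (N + 1) • z) (y + ħ ^ (N + 1) • w)
    (by rw [map_sub, map_smul, ← hz, ← ha, sub_self]) (by
      rw [map_sub, map_add, map_smul, map_smul, eq_comm, ← sub_eq_zero,
        show D' y = Φ x - ħ ^ (N + 1) • b by rw [← hb]; abel, hw, smul_add]
      abel)
  refine ⟨Submodule.Quotient.mk z', Submodule.Quotient.mk w', ?_, ?_⟩
  · refine (Submodule.Quotient.eq _).2 (mem_hbarPow.2 ⟨z, ?_⟩)
    rw [← hz']; abel
  · refine (Submodule.Quotient.eq _).2 (mem_hbarPow.2 ⟨-w, ?_⟩)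
    change y - (Φ z' + D' w') = _
    rw [← hw', smul_neg]; abel

variable {s : ℕ}

/-- A morphism of deformations whose base is a quasi-isomorphism is a quasi-isomorphism. -/
theorem DeformationHom.isQuasiIso_of_base (hgr : DirectSum.IsInternal gr)
    (hgr' : DirectSum.IsInternal gr') {X : Algebra k k gr s} {Y : Algebra k k gr' s}
    {D : FormalDeformation X} {E : FormalDeformation Y} (F : DeformationHom D E)
    (h : F.base.IsQuasiIso) : F.IsQuasiIso := by
  obtain ⟨π, hπ⟩ := exists_isProj hgr
  obtain ⟨π', hπ'⟩ := exists_isProj hgr'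
  obtain ⟨e, he⟩ := exists_isGrading hgr
  obtain ⟨e', he'⟩ := exists_isGrading hgr'
  have h1 := D.alg.d_d he.series
  have h2 := E.alg.d_d he'.series
  have h3 := F.lift.linear_d he.series he'.series
  have hex : ConeExact D.alg.d E.alg.d F.lift.linear :=
    ConeExact.series hπ hπ' h.coneExact X.d_mem Y.d_mem F.base.linear_mem D.alg.d_mem E.alg.d_mem
      F.lift.linear_mem (fun x => D.reduces 1 _) (fun x => E.reduces 1 _) (fun x => F.reduces 1 _)
      h1 h2 h3
  refine ⟨h, fun N => (hex.reduction h1 h2 h3 N).isQuasiIsoMap fun x => ?_, hex.isQuasiIsoMap h3⟩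
  obtain ⟨x, rfl⟩ := Submodule.Quotient.mk_surjective _ x
  exact congrArg Submodule.Quotient.mk (h3 x)

end series

/-! ### Solving an equation between families of series by successive approximation -/

section approximation

variable {k : Type u} [CommRing k] {V : Type w} [AddCommGroup V] [Module k V]
  {gr : ℤ × ℤ → Submodule k V} {π : ℤ × ℤ → V →ₗ[k] V}
  {W : Type w} [AddCommGroup W] [Module k W] {gr' : ℤ × ℤ → Submodule k W}
  {π' : ℤ × ℤ → W →ₗ[k] W} (hs : ⨆ d, gr d = ⊤) (hs' : ⨆ d, gr' d = ⊤)

local notation "ħ" => (Polynomial.X : Polynomial k)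

theorem MultiLin.length_dep {θ : ℕ → List V → W} (h : ∀ n, MultiLin k (θ n)) :
    MultiLin k (fun l => θ l.length l) := by
  intro p q c x y
  have := h (p.length + (q.length + 1)) p q c x y
  simpa using this

theorem MultiLin.ite_length {θ : List V → W} (h : MultiLin k θ) (P : ℕ → Prop) [DecidablePred P] :
    MultiLin k (fun l => if P l.length then θ l else 0) :=
  MultiLin.length_dep (θ := fun n l => if P n then θ l else 0) fun n => by
    by_cases hn : P n
    · simpa [hn] using h
    · simpa [hn] using MultiLin.zero

theorem coeff_apply_of_div {M : BgrSeries gr →ₗ[Polynomial k] BgrSeries gr'} {m : V →ₗ[k] W}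
    (hM : ∀ x, coeff gr' 0 (M x) = m (coeff gr 0 x)) {N : ℕ} {x : BgrSeries gr}
    (h : Div (ħ ^ N) x) : coeff gr' N (M x) = m (coeff gr N x) := by
  obtain ⟨y, rfl⟩ := h
  have h1 := coeff_X_pow_smul_add (M y) N 0
  have h2 := coeff_X_pow_smul_add y N 0
  rw [zero_add] at h1 h2
  rw [map_smul, h1, h2, hM]

theorem coeff_zero_of_div {N : ℕ} {x : BgrSeries gr} (h : Div (ħ ^ (N + 1)) x) :
    coeff gr N x = 0 := div_X_pow_iff.1 h N (Nat.lt_succ_self N)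

theorem div_succ {N : ℕ} {x : BgrSeries gr} (h : Div (ħ ^ N) x) (h0 : coeff gr N x = 0) :
    Div (ħ ^ (N + 1)) x := by
  rw [div_X_pow_iff] at h ⊢
  intro M hM
  rcases Nat.lt_succ_iff_lt_or_eq.1 hM with h' | rfl
  · exact h M h'
  · exact h0

/-- Pairs of functions on lists of series that reduce to `β`, `φ` modulo `ħ` and are constant on
the lists in `Z`. -/
structure Admissible (gr : ℤ × ℤ → Submodule k V) (gr' : ℤ × ℤ → Submodule k W)
    (hs : ⨆ d, gr d = ⊤) (hs' : ⨆ d, gr' d = ⊤) (σ δ δ' : ℤ × ℤ) (Z : List V → Prop)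
    (β : List V → V) (φ : List V → W) (B : List (BgrSeries gr) → BgrSeries gr)
    (C : List (BgrSeries gr) → BgrSeries gr') : Prop where
  multiLin_left : MultiLin (Polynomial k) B
  multiLin_right : MultiLin (Polynomial k) C
  homog_left : Homog (seriesGrading gr) (seriesGrading gr) σ δ B
  homog_right : Homog (seriesGrading gr) (seriesGrading gr') σ δ' C
  nil_left : B [] = 0
  nil_right : C [] = 0
  coeff_left : ∀ l, coeff gr 0 (B l) = β (l.map (coeff gr 0))
  coeff_right : ∀ l, coeff gr' 0 (C l) = φ (l.map (coeff gr 0))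
  const_left : ∀ l, Z l → B (l.map (constLin hs)) = constLin hs (β l)
  const_right : ∀ l, Z l → C (l.map (constLin hs)) = constLin hs' (φ l)

/-- Coefficients of an admissible pair. -/
structure AdmissibleCoeffs (gr : ℤ × ℤ → Submodule k V) (gr' : ℤ × ℤ → Submodule k W)
    (σ δ δ' : ℤ × ℤ) (Z : List V → Prop) (β : List V → V) (φ : List V → W)
    (b : ℕ → List V → V) (c : ℕ → List V → W) : Prop where
  left : IsCoeffs gr gr σ δ b
  right : IsCoeffs gr gr' σ δ' c
  zero_left : b 0 = β
  zero_right : c 0 = φ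
  nil_left : ∀ N, b N [] = 0
  nil_right : ∀ N, c N [] = 0
  mem_left : ∀ N, N ≠ 0 → ∀ l, Z l → b N l = 0
  mem_right : ∀ N, N ≠ 0 → ∀ l, Z l → c N l = 0

variable {σ δ δ' : ℤ × ℤ} {Z : List V → Prop} {β : List V → V} {φ : List V → W}

theorem AdmissibleCoeffs.admissible {b : ℕ → List V → V} {c : ℕ → List V → W}
    (h : AdmissibleCoeffs gr gr' σ δ δ' Z β φ b c) :
    Admissible gr gr' hs hs' σ δ δ' Z β φ (ser h.left) (ser h.right) where
  multiLin_left := multiLin_ser _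
  multiLin_right := multiLin_ser _
  homog_left := homog_ser _
  homog_right := homog_ser _
  nil_left := ser_nil _ h.nil_left
  nil_right := ser_nil _ h.nil_right
  coeff_left l := by rw [coeff_zero_ser, h.zero_left]
  coeff_right l := by rw [coeff_zero_ser, h.zero_right]
  const_left l hl := coeff_ext fun N => by
    rw [coeff_ser_const]
    cases N with
    | zero => rw [h.zero_left, coeff_constLin_zero]
    | succ N => rw [h.mem_left _ N.succ_ne_zero l hl, coeff_constLin_succ]
  const_right l hl := coeff_ext fun N => by
    rw [coeff_ser_const]
    cases N with
    | zero => rw [h.zero_right, coeff_constLin_zero]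
    | succ N => rw [h.mem_right _ N.succ_ne_zero l hl, coeff_constLin_succ]

theorem div_ser_sub_ser (hs : ⨆ d, gr d = ⊤) {b b' : ℕ → List V → W} (hb : IsCoeffs gr gr' σ δ b)
    (hb' : IsCoeffs gr gr' σ δ b') {n : ℕ → ℕ} (h : ∀ l, ∀ N < n l.length, b' N l = b N l)
    (l : List (BgrSeries gr)) : Div (ħ ^ n l.length) (ser hb' l - ser hb l) := by
  refine ((multiLin_ser hb').sub (multiLin_ser hb)).div_of_const_length hs l fun l' hl' => ?_
  rw [div_X_pow_iff]
  intro N hN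
  rw [map_sub, coeff_ser_const, coeff_ser_const, h l' N (hl' ▸ hN), sub_self]

/-- Conditions under which an equation `E B C = 0` for admissible pairs can be solved. -/
structure Solvable (gr : ℤ × ℤ → Submodule k V) (gr' : ℤ × ℤ → Submodule k W)
    (hs : ⨆ d, gr d = ⊤) (hs' : ⨆ d, gr' d = ⊤) (σ δ τ : ℤ × ℤ) (Z : List V → Prop)
    (β : List V → V) (φ : List V → W)
    (f : V →ₗ[k] W) (m : W →ₗ[k] W) (F : BgrSeries gr →ₗ[Polynomial k] BgrSeries gr')
    (M : BgrSeries gr' →ₗ[Polynomial k] BgrSeries gr')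
    (E : (List (BgrSeries gr) → BgrSeries gr) → (List (BgrSeries gr) → BgrSeries gr') →
      List (BgrSeries gr) → BgrSeries gr') : Prop where
  multiLin : ∀ B C, Admissible gr gr' hs hs' σ δ (δ - τ) Z β φ B C → MultiLin (Polynomial k) (E B C)
  homog : ∀ B C, Admissible gr gr' hs hs' σ δ (δ - τ) Z β φ B C →
    Homog (seriesGrading gr) (seriesGrading gr') σ δ (E B C)
  nil : ∀ B C, Admissible gr gr' hs hs' σ δ (δ - τ) Z β φ B C → E B C [] = 0
  coeff_zero : ∀ B C, Admissible gr gr' hs hs' σ δ (δ - τ) Z β φ B C →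
    ∀ l : List V, coeff gr' 0 (E B C (l.map (constLin hs))) = 0
  mem : ∀ B C, Admissible gr gr' hs hs' σ δ (δ - τ) Z β φ B C →
    ∀ l : List V, Z l → E B C (l.map (constLin hs)) = 0
  lead : ∀ B C, Admissible gr gr' hs hs' σ δ (δ - τ) Z β φ B C →
    ∀ B' C', Admissible gr gr' hs hs' σ δ (δ - τ) Z β φ B' C' → ∀ w : ℕ,
    (∀ l, Div (ħ ^ (w - l.length + 1)) (B' l - B l)) →
    (∀ l, Div (ħ ^ (w - l.length + 1)) (C' l - C l)) →
    ∀ l, Div (ħ ^ (w + 1 - l.length + 1))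
      (E B' C' l - E B C l - (M (C' l - C l) - F (B' l - B l)))
  closed : ∀ B C, Admissible gr gr' hs hs' σ δ (δ - τ) Z β φ B C → ∀ w : ℕ,
    (∀ l, Div (ħ ^ (w - l.length + 1)) (E B C l)) →
    ∀ l, l.length ≤ w → Div (ħ ^ (w - l.length + 1 + 1)) (M (E B C l))
  red_left : ∀ x, coeff gr' 0 (F x) = f (coeff gr 0 x)
  red_right : ∀ x, coeff gr' 0 (M x) = m (coeff gr' 0 x)
  exact : ∀ a, m a = 0 → ∃ x y, a = f x - m y
  left_mem : ∀ d, ∀ x ∈ gr d, f x ∈ gr' d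
  right_mem : ∀ d, ∀ x ∈ gr' d, m x ∈ gr' (d + τ)

/-- The correction lives in weight `N + l.length = w + 1`. The shift `N • hdeg` is therefore `(w +
1) • hdeg` minus `hdeg` for every argument, whence `σ + hdeg`. The condition on `N` preserves the
reduction modulo `ħ`, the one on the length the value at the empty list. -/
theorem IsCoeffs.modify {b : ℕ → List V → W} (hb : IsCoeffs gr gr' σ δ b) {w : ℕ}
    {θ : List V → W} (hθ : MultiLin k θ)
    (hh : Homog gr gr' (σ + hdeg) (δ + ((w + 1 : ℕ) : ℤ) • hdeg) θ) :
    IsCoeffs gr gr' σ δ (fun N l => b N l +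
      if N + l.length = w + 1 ∧ N ≠ 0 ∧ l.length ≠ 0 then θ l else 0) where
  multiLin N := (hb.multiLin N).add
    (hθ.ite_length fun n => N + n = w + 1 ∧ N ≠ 0 ∧ n ≠ 0)
  homog N l ds hl := by
    refine Submodule.add_mem _ (hb.homog N l ds hl) ?_
    split_ifs with h
    · have := hh l ds hl
      rw [← h.1] at this
      convert this using 2
      push_cast
      rw [add_smul, smul_add]
      abel
    · exact Submodule.zero_mem _

/-- The induction step on the weight. By hypothesis the defect vanishes modulo `ħ` and in weights at
most `w`; the truncated subtraction in the exponent expresses both. Its part `e` of weight `w + 1`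
is a cocycle by `closed`, hence of the form `f β - m φ`, and by `lead` adding `β` and `φ` to the
coefficients of that weight cancels it. Composition with `P` makes the corrections vanish on `Z` and
leaves `e` unchanged. -/
theorem Solvable.step {τ : ℤ × ℤ} [Module.Projective k V] (hπ : IsProj gr π) (hπ' : IsProj gr' π')
    {f : V →ₗ[k] W} {m : W →ₗ[k] W} {F : BgrSeries gr →ₗ[Polynomial k] BgrSeries gr'}
    {M : BgrSeries gr' →ₗ[Polynomial k] BgrSeries gr'}
    {E : (List (BgrSeries gr) → BgrSeries gr) → (List (BgrSeries gr) → BgrSeries gr') →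
      List (BgrSeries gr) → BgrSeries gr'}
    (S : Solvable gr gr' hs hs' σ δ τ Z β φ f m F M E)
    {P : V →ₗ[k] V} (hP : ∀ d, ∀ x ∈ gr d, P x ∈ gr d)
    (hPe : ∀ e : List V → W, MultiLin k e → (∀ l, Z l → e l = 0) → ∀ l, e (l.map P) = e l)
    (hPZ : ∀ l, Z l → (0 : V) ∈ l.map P) (w : ℕ)
    {b : ℕ → List V → V} {c : ℕ → List V → W} (h : AdmissibleCoeffs gr gr' σ δ (δ - τ) Z β φ b c)
    (hE : ∀ l, Div (ħ ^ (w - l.length + 1)) (E (ser h.left) (ser h.right) l)) :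
    ∃ (b' : ℕ → List V → V) (c' : ℕ → List V → W)
      (h' : AdmissibleCoeffs gr gr' σ δ (δ - τ) Z β φ b' c'),
      (∀ l, Div (ħ ^ (w + 1 - l.length + 1)) (E (ser h'.left) (ser h'.right) l)) ∧
      (∀ N l, N + l.length ≠ w + 1 → b' N l = b N l) ∧
      (∀ N l, N + l.length ≠ w + 1 → c' N l = c N l) := by
  have hA := h.admissible hs hs'
  set B := ser h.left with hB
  set C := ser h.right with hC
  -- On lists longer than `w` only divisibility by `ħ` is required, so nothing has to be corrected
  -- there.
  let e : List V → W := fun l =>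
    if l.length ≤ w then coeff gr' (w + 1 - l.length) (E B C (l.map (constLin hs))) else 0
  have heM : MultiLin k e := MultiLin.length_dep
    (θ := fun n l => if n ≤ w then coeff gr' (w + 1 - n) (E B C (l.map (constLin hs))) else 0)
    fun n => by
      by_cases hn : n ≤ w
      · simpa [hn] using ((S.multiLin B C hA).restrict hs).comp_left (coeff gr' (w + 1 - n))
      · simpa [hn] using MultiLin.zero
  have heZ : ∀ l, Z l → e l = 0 := fun l hl => by
    simp only [e]
    split_ifs
    · rw [S.mem B C hA l hl, map_zero]
    · rfl
  -- The exponent of `ħ` drops with the length of the list, so its bidegree is counted with the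
  -- arguments.
  have heH : Homog gr gr' (σ + hdeg) (δ + ((w + 1 : ℕ) : ℤ) • hdeg) e := by
    intro l ds hl
    simp only [e]
    split_ifs with hw
    · have := (S.homog B C hA).coeff hs (w + 1 - l.length) l ds hl
      convert this using 2
      rw [Nat.cast_sub (by omega), sub_smul, smul_add]
      abel
    · exact Submodule.zero_mem _
  have hex : ∀ l, ∃ x y, e l = f x - m y := by
    intro l
    refine S.exact _ ?_
    simp only [e]
    split_ifs with hw
    · have h1 := S.closed B C hA w hE (l.map (constLin hs)) (by simpa using hw)
      have h2 := hE (l.map (constLin hs))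
      rw [List.length_map] at h1 h2
      rw [show w + 1 - l.length = w - l.length + 1 by omega, ← coeff_apply_of_div S.red_right h2]
      exact coeff_zero_of_div h1
    · exact map_zero _
  obtain ⟨β₁, φ₁, hβM, hφM, hβH, hφH, hβφ⟩ :=
    exists_graded_lift hπ hπ' f S.left_mem m S.right_mem heM heH hex
  have homP : ∀ {U : Type w} [AddCommGroup U] [Module k U] {gr'' : ℤ × ℤ → Submodule k U}
      {σ δ : ℤ × ℤ} {θ : List V → U}, Homog gr gr'' σ δ θ →
      Homog gr gr'' σ δ (fun l => θ (l.map P)) := by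
    intro U _ _ gr'' σ δ θ hθ l ds hl
    have := hθ (l.map P) ds (List.forall₂_map_left_iff.2 (hl.imp fun a d ha => hP d a ha))
    rwa [List.length_map] at this
  have zeroP : ∀ {U : Type w} [AddCommGroup U] [Module k U] {θ : List V → U}, MultiLin k θ →
      ∀ l, Z l → θ (l.map P) = 0 := by
    intro U _ _ θ hθ l hl
    obtain ⟨p, q, hpq⟩ := List.append_of_mem (hPZ l hl)
    rw [hpq, hθ.map_zero]
  have hφH' : Homog gr gr' (σ + hdeg) (δ - τ + ((w + 1 : ℕ) : ℤ) • hdeg)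
      (fun l => φ₁ (l.map P)) := by
    have := homP hφH
    rwa [add_sub_right_comm] at this
  let b' : ℕ → List V → V := fun N l => b N l +
    if N + l.length = w + 1 ∧ N ≠ 0 ∧ l.length ≠ 0 then β₁ (l.map P) else 0
  let c' : ℕ → List V → W := fun N l => c N l +
    if N + l.length = w + 1 ∧ N ≠ 0 ∧ l.length ≠ 0 then φ₁ (l.map P) else 0
  have h' : AdmissibleCoeffs gr gr' σ δ (δ - τ) Z β φ b' c' :=
    { left := h.left.modify (hβM.comp_map P) (homP hβH)
      right := h.right.modify (hφM.comp_map P) hφH'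
      zero_left := by funext l; simp [b', h.zero_left]
      zero_right := by funext l; simp [c', h.zero_right]
      nil_left := fun N => by simp [b', h.nil_left]
      nil_right := fun N => by simp [c', h.nil_right]
      mem_left := fun N hN l hl => by simp [b', h.mem_left N hN l hl, zeroP hβM l hl]
      mem_right := fun N hN l hl => by simp [c', h.mem_right N hN l hl, zeroP hφM l hl] }
  have hA' := h'.admissible hs hs'
  have hBB : ∀ l, Div (ħ ^ (w - l.length + 1)) (ser h'.left l - B l) :=
    div_ser_sub_ser hs h.left h'.left (n := fun n => w - n + 1) fun l N hN => by
      simp only [b', if_neg (show ¬ (N + l.length = w + 1 ∧ N ≠ 0 ∧ l.length ≠ 0) by omega),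
        add_zero]
  have hCC : ∀ l, Div (ħ ^ (w - l.length + 1)) (ser h'.right l - C l) :=
    div_ser_sub_ser hs h.right h'.right (n := fun n => w - n + 1) fun l N hN => by
      simp only [c', if_neg (show ¬ (N + l.length = w + 1 ∧ N ≠ 0 ∧ l.length ≠ 0) by omega),
        add_zero]
  refine ⟨b', c', h', ?_, fun N l hN => by simp [b', hN], fun N l hN => by simp [c', hN]⟩
  intro l
  refine (S.multiLin _ _ hA').div_of_const_length hs l fun l' hl' => ?_
  rw [← hl']
  have h1 := S.lead B C hA _ _ hA' w hBB hCC (l'.map (constLin hs))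
  rw [List.length_map] at h1
  rw [sub_sub] at h1
  refine h1.of_sub_left ?_
  rcases Nat.eq_zero_or_pos l'.length with h0 | h0
  · rw [List.length_eq_zero_iff] at h0
    subst h0
    rw [List.map_nil, S.nil B C hA, hA.nil_left, hA.nil_right, hA'.nil_left, hA'.nil_right]
    simp only [sub_zero, map_zero, add_zero]
    exact Div.zero
  have hb1 := hBB (l'.map (constLin hs))
  have hc1 := hCC (l'.map (constLin hs))
  have he1 := hE (l'.map (constLin hs))
  rw [List.length_map] at hb1 hc1 he1
  by_cases hw : l'.length ≤ w
  · rw [show w + 1 - l'.length = w - l'.length + 1 by omega]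
    refine div_succ (he1.add ((hc1.map M).sub (hb1.map F))) ?_
    rw [map_add, map_sub, coeff_apply_of_div S.red_right hc1, coeff_apply_of_div S.red_left hb1,
      map_sub (coeff gr' _), map_sub (coeff gr _), hB, hC, coeff_ser_const, coeff_ser_const, coeff_ser_const, coeff_ser_const]
    have hcond : w - l'.length + 1 + l'.length = w + 1 ∧ w - l'.length + 1 ≠ 0 ∧ l'.length ≠ 0 := by
      omega
    simp only [b', c', if_pos hcond, add_sub_cancel_left]
    -- The corrections are evaluated at the image of the list under `P`; as `e` does not notice `P`,
    -- they solve the equation for `l'` itself.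
    have h2 := hβφ (l'.map P)
    rw [hPe e heM heZ] at h2
    have h3 : e l' = coeff gr' (w - l'.length + 1) (E B C (l'.map (constLin hs))) := by
      simp only [e]
      rw [if_pos hw, show w + 1 - l'.length = w - l'.length + 1 by omega]
    rw [← hB, ← hC, ← h3, h2]
    abel
  -- The list is too long for the new weight: the required exponent is still one.
  · have hw1 : w + 1 - l'.length = 0 := by omega
    have hw2 : w - l'.length + 1 = 1 := by omega
    rw [hw2] at hb1 hc1 he1
    rw [hw1, zero_add]
    exact he1.add ((hc1.map M).sub (hb1.map F))

/-- The method of successive approximation. -/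
theorem Solvable.exists_solution {τ : ℤ × ℤ} [Module.Projective k V] (hπ : IsProj gr π)
    (hπ' : IsProj gr' π')
    {f : V →ₗ[k] W} {m : W →ₗ[k] W} {F : BgrSeries gr →ₗ[Polynomial k] BgrSeries gr'}
    {M : BgrSeries gr' →ₗ[Polynomial k] BgrSeries gr'}
    {E : (List (BgrSeries gr) → BgrSeries gr) → (List (BgrSeries gr) → BgrSeries gr') →
      List (BgrSeries gr) → BgrSeries gr'}
    (S : Solvable gr gr' hs hs' σ δ τ Z β φ f m F M E)
    {P : V →ₗ[k] V} (hP : ∀ d, ∀ x ∈ gr d, P x ∈ gr d)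
    (hPe : ∀ e : List V → W, MultiLin k e → (∀ l, Z l → e l = 0) → ∀ l, e (l.map P) = e l)
    (hPZ : ∀ l, Z l → (0 : V) ∈ l.map P)
    (hβ : MultiLin k β) (hβh : Homog gr gr σ δ β) (hβ0 : β [] = 0)
    (hφ : MultiLin k φ) (hφh : Homog gr gr' σ (δ - τ) φ) (hφ0 : φ [] = 0) :
    ∃ B C, Admissible gr gr' hs hs' σ δ (δ - τ) Z β φ B C ∧ ∀ l, E B C l = 0 := by
  classical
  let State : ℕ → Type w := fun w => {a : (ℕ → List V → V) × (ℕ → List V → W) //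
    ∃ h : AdmissibleCoeffs gr gr' σ δ (δ - τ) Z β φ a.1 a.2,
      ∀ l, Div (ħ ^ (w - l.length + 1)) (E (ser h.left) (ser h.right) l)}
  have step : ∀ w (a : State w), ∃ a' : State (w + 1),
      (∀ N l, N + l.length ≠ w + 1 → a'.1.1 N l = a.1.1 N l) ∧
      (∀ N l, N + l.length ≠ w + 1 → a'.1.2 N l = a.1.2 N l) := by
    rintro w ⟨⟨b, c⟩, h, hE⟩
    obtain ⟨b', c', h', hE', h1, h2⟩ := S.step hs hs' hπ hπ' hP hPe hPZ w h hE
    exact ⟨⟨(b', c'), h', hE'⟩, h1, h2⟩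
  have isCoeffs_zero : ∀ {U : Type w} [AddCommGroup U] [Module k U] {gr'' : ℤ × ℤ → Submodule k U}
      {δ : ℤ × ℤ} {θ : List V → U}, MultiLin k θ → Homog gr gr'' σ δ θ →
      IsCoeffs gr gr'' σ δ (fun N l => if N = 0 then θ l else 0) := by
    intro U _ _ gr'' δ θ hθ hh
    refine ⟨fun N => ?_, fun N l ds hl => ?_⟩
    · by_cases hN : N = 0
      · simpa [hN] using hθ
      · simpa [hN] using MultiLin.zero
    · by_cases hN : N = 0
      · subst hN
        simpa using hh l ds hl
      · rw [if_neg hN]; exact Submodule.zero_mem _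
  have h0 : AdmissibleCoeffs gr gr' σ δ (δ - τ) Z β φ (fun N l => if N = 0 then β l else 0)
      (fun N l => if N = 0 then φ l else 0) :=
    { left := isCoeffs_zero hβ hβh
      right := isCoeffs_zero hφ hφh
      zero_left := rfl
      zero_right := rfl
      nil_left := fun N => by simp [hβ0]
      nil_right := fun N => by simp [hφ0]
      mem_left := fun N hN l _ => if_neg hN
      mem_right := fun N hN l _ => if_neg hN }
  have hE0 : ∀ l, Div (ħ ^ (0 - l.length + 1)) (E (ser h0.left) (ser h0.right) l) := by
    intro l
    refine (S.multiLin _ _ (h0.admissible hs hs')).div_of_const_length hs l fun l' _ => ?_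
    rw [Nat.zero_sub, div_X_pow_iff]
    intro N hN
    obtain rfl : N = 0 := by omega
    exact S.coeff_zero _ _ (h0.admissible hs hs') l'
  choose next hnb hnc using step
  let sq : (w : ℕ) → State w := fun w =>
    Nat.rec (⟨(fun N l => if N = 0 then β l else 0, fun N l => if N = 0 then φ l else 0),
      h0, hE0⟩ : State 0) (fun w a => next w a) w
  have hsq : ∀ w, AdmissibleCoeffs gr gr' σ δ (δ - τ) Z β φ (sq w).1.1 (sq w).1.2 :=
    fun w => (sq w).2.choose
  -- A coefficient of weight `N + l.length` no longer changes after the stage of that number.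
  have hb : ∀ w N l, N + l.length ≤ w → (sq w).1.1 N l = (sq (N + l.length)).1.1 N l := by
    intro w N l hw
    induction w, hw using Nat.le_induction with
    | base => rfl
    | succ w hw ih => exact (hnb w (sq w) N l (by omega)).trans ih
  have hc : ∀ w N l, N + l.length ≤ w → (sq w).1.2 N l = (sq (N + l.length)).1.2 N l := by
    intro w N l hw
    induction w, hw using Nat.le_induction with
    | base => rfl
    | succ w hw ih => exact (hnc w (sq w) N l (by omega)).trans ih
  have hL : AdmissibleCoeffs gr gr' σ δ (δ - τ) Z β φ (fun N l => (sq (N + l.length)).1.1 N l)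
      (fun N l => (sq (N + l.length)).1.2 N l) :=
    { left := ⟨fun N => MultiLin.length_dep (θ := fun n l => (sq (N + n)).1.1 N l)
          fun n => (hsq _).left.multiLin N, fun N l ds hl => (hsq _).left.homog N l ds hl⟩
      right := ⟨fun N => MultiLin.length_dep (θ := fun n l => (sq (N + n)).1.2 N l)
          fun n => (hsq _).right.multiLin N, fun N l ds hl => (hsq _).right.homog N l ds hl⟩
      zero_left := funext fun l => congrFun (hsq _).zero_left l
      zero_right := funext fun l => congrFun (hsq _).zero_right l
      nil_left := fun N => (hsq _).nil_left N
      nil_right := fun N => (hsq _).nil_right N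
      mem_left := fun N hN l hl => (hsq _).mem_left N hN l hl
      mem_right := fun N hN l hl => (hsq _).mem_right N hN l hl }
  refine ⟨_, _, hL.admissible hs hs', fun l => eq_zero_of_div fun j => ?_⟩
  have hsm : ∀ w, ∀ l, Div (ħ ^ (w - l.length + 1))
      (E (ser (hsq w).left) (ser (hsq w).right) l) := fun w => (sq w).2.choose_spec
  -- The limit agrees with stage `w` in all weights up to `w`, so by `lead` its defect is divisible
  -- to the same order.
  have key : ∀ w (l : List (BgrSeries gr)),
      Div (ħ ^ (w - l.length + 1)) (E (ser hL.left) (ser hL.right) l) := by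
    intro w l
    have hBB : ∀ l, Div (ħ ^ (w - l.length + 1)) (ser hL.left l - ser (hsq w).left l) :=
      div_ser_sub_ser hs (hsq w).left hL.left (n := fun n => w - n + 1) fun l N hN => by
        rcases Nat.eq_zero_or_pos N with rfl | hN0
        · rw [(hsq w).zero_left]
          exact congrFun (hsq _).zero_left l
        · exact (hb w N l (by omega)).symm
    have hCC : ∀ l, Div (ħ ^ (w - l.length + 1)) (ser hL.right l - ser (hsq w).right l) :=
      div_ser_sub_ser hs (hsq w).right hL.right (n := fun n => w - n + 1) fun l N hN => by
        rcases Nat.eq_zero_or_pos N with rfl | hN0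
        · rw [(hsq w).zero_right]
          exact congrFun (hsq _).zero_right l
        · exact (hc w N l (by omega)).symm
    have h1 := S.lead _ _ ((hsq w).admissible hs hs') _ _ (hL.admissible hs hs') w hBB hCC l
    rw [sub_sub] at h1
    exact (h1.mono (by omega)).of_sub_left
      ((hsm w l).add (((hCC l).map M).sub ((hBB l).map F)))
  -- Stage `l.length + j` gives the exponent `j + 1` on `l`.
  exact (key (l.length + j) l).mono (by omega)

end approximation

/-! ### Homogeneity of the list operations -/

section homog

variable {k : Type u} [CommRing k] {V W U : Type w} [AddCommGroup V] [Module k V]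
  [AddCommGroup W] [Module k W] [AddCommGroup U] [Module k U]
  {gr : ℤ × ℤ → Submodule k V} {gr' : ℤ × ℤ → Submodule k W} {gr'' : ℤ × ℤ → Submodule k U}
  {σ δ δ' D : ℤ × ℤ}

theorem Homog.congr {θ : List V → W} (h : Homog gr gr' σ δ θ) (hδ : δ = δ') :
    Homog gr gr' σ δ' θ := hδ ▸ h

theorem Homog.sub {θ θ' : List V → W} (h : Homog gr gr' σ δ θ) (h' : Homog gr gr' σ δ θ') :
    Homog gr gr' σ δ (fun l => θ l - θ' l) :=
  fun l ds hl => Submodule.sub_mem _ (h l ds hl) (h' l ds hl)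

theorem Homog.neg {θ : List V → W} (h : Homog gr gr' σ δ θ) :
    Homog gr gr' σ δ (fun l => -θ l) :=
  fun l ds hl => Submodule.neg_mem _ (h l ds hl)

theorem homog_single {e : V → W} (he : ∀ d, ∀ x ∈ gr d, e x ∈ gr' d) :
    Homog gr gr' σ σ (single e) := by
  intro l ds hl
  match l, ds, hl with
  | [], _, _ => exact Submodule.zero_mem _
  | [x], [d], hl =>
    have hx : x ∈ gr d := by simpa [HomList] using hl
    simpa using he d x hx
  | _ :: _ :: _, _, _ => exact Submodule.zero_mem _

theorem Homog.head {θ : List V → W} (h : Homog gr gr' σ δ θ) : θ [] ∈ gr' δ := by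
  simpa using h [] [] List.Forall₂.nil

theorem homog_pullAux {f : List V → W} (hf : Homog gr gr' σ σ f) {l : List V}
    {ds : List (ℤ × ℤ)} (hl : HomList gr l ds) : ∀ {D δ : ℤ × ℤ} {φ : List V → W} {Θ : List W → U},
    Homog gr gr' σ D φ → Homog gr' gr'' σ δ Θ →
    pullAux f l φ Θ ∈ gr'' (ds.sum + (D + δ - σ) - (l.length : ℤ) • σ) := by
  induction hl with
  | nil =>
    intro D δ φ Θ hφ hΘ
    rw [show pullAux f [] φ Θ = Θ [φ []] from rfl]
    simpa using (hΘ.tail hφ.head).congr (δ' := D + δ - σ) (by abel) |>.head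
  | @cons x d l ds hx hl ih =>
    intro D δ φ Θ hφ hΘ
    rw [pullAux]
    refine Submodule.add_mem _ ?_ ?_
    · convert ih (hf.tail hx) (hΘ.tail hφ.head) using 2
      rw [List.sum_cons, List.length_cons]
      push_cast
      rw [add_smul, one_smul]; abel
    · convert ih (hφ.tail hx) hΘ using 2
      rw [List.sum_cons, List.length_cons]
      push_cast
      rw [add_smul, one_smul]; abel

theorem Homog.pull {f : List V → W} (hf : Homog gr gr' σ σ f) {Θ : List W → U}
    (hΘ : Homog gr' gr'' σ δ Θ) : Homog gr gr'' σ δ (pull f Θ) := by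
  intro l ds hl
  cases hl with
  | nil =>
    rw [show AInf.pull f Θ [] = Θ [] from rfl]
    simpa using hΘ.head
  | @cons x d l ds hx hl =>
    change pullAux f l (fun q => f (x :: q)) Θ ∈ _
    convert homog_pullAux hf hl (hf.tail hx) hΘ using 2
    rw [List.sum_cons, List.length_cons]
    push_cast
    rw [add_smul, one_smul]; abel

theorem homog_codAux {p η f : List V → W} (hp : Homog gr gr' σ σ p) {δ' : ℤ × ℤ}
    (hη : Homog gr gr' σ δ' η) (hf : Homog gr gr' σ σ f) {l : List V}
    {ds : List (ℤ × ℤ)} (hl : HomList gr l ds) :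
    ∀ {D δ : ℤ × ℤ} {φ χ : List V → W} {Θ : List W → U},
    Homog gr gr' σ D φ → Homog gr gr' σ (D + δ' - σ) χ → Homog gr' gr'' σ δ Θ →
    codAux p η f l φ χ Θ ∈ gr'' (ds.sum + (D + δ' - σ + δ - σ) - (l.length : ℤ) • σ) := by
  induction hl with
  | nil =>
    intro D δ φ χ Θ hφ hχ hΘ
    rw [show codAux p η f [] φ χ Θ = Θ [χ []] from rfl]
    simpa using (hΘ.tail hχ.head).congr (δ' := D + δ' - σ + δ - σ) (by abel) |>.head
  | @cons x d l ds hx hl ih =>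
    intro D δ φ χ Θ hφ hχ hΘ
    rw [codAux]
    refine Submodule.add_mem _ (Submodule.add_mem _ ?_ ?_) ?_
    · convert ih (hp.tail hx) ((hη.tail hx).congr ?_) (hΘ.tail hφ.head) using 2
      · rw [List.sum_cons, List.length_cons]
        push_cast
        rw [add_smul, one_smul]; abel
      · abel
    · convert homog_pullAux hf hl (hf.tail hx) (hΘ.tail hχ.head) using 2
      rw [List.sum_cons, List.length_cons]
      push_cast
      rw [add_smul, one_smul]; abel
    · convert ih (hφ.tail hx) ((hχ.tail hx).congr ?_) hΘ using 2
      · rw [List.sum_cons, List.length_cons]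
        push_cast
        rw [add_smul, one_smul]; abel
      · abel

theorem Homog.cod {p η f : List V → W} (hp : Homog gr gr' σ σ p) {δ' : ℤ × ℤ}
    (hη : Homog gr gr' σ δ' η) (hf : Homog gr gr' σ σ f) {Θ : List W → U}
    (hΘ : Homog gr' gr'' σ δ Θ) : Homog gr gr'' σ (δ' + δ - σ) (cod p η f Θ) := by
  intro l ds hl
  cases hl with
  | nil => exact Submodule.zero_mem _
  | @cons x d l ds hx hl =>
    change codAux p η f l (fun q => p (x :: q)) (fun q => η (x :: q)) Θ ∈ _
    have hη' := (hη.tail hx).congr (δ' := σ + d - σ + δ' - σ) (by abel)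
    convert homog_codAux hp hη hf hl (hp.tail hx) hη' hΘ using 2
    · rw [List.sum_cons, List.length_cons]
      push_cast
      rw [add_smul, one_smul]; abel

end homog

/-! ### Suspended operations and strict units -/

section operations

variable {k : Type u} {R : Type v} [CommRing k] [CommRing R]
  {V : Type w} [AddCommGroup V] [Module k V] [Module R V] {gr : ℤ × ℤ → Submodule k V}
  {W : Type w} [AddCommGroup W] [Module k W] [Module R W] {gr' : ℤ × ℤ → Submodule k W}
  {s : ℕ}

theorem IsGrading.neg_apply_mem {e : V →ₗ[R] V} (he : IsGrading gr e) (d : ℤ × ℤ) (x : V)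
    (hx : x ∈ gr d) : (-e) x ∈ gr d := Submodule.neg_mem _ (he.apply_mem d x hx)

theorem Homog.coder {e : V →ₗ[R] V} (he : IsGrading gr e) {σ δ δ' : ℤ × ℤ} {m : List V → V}
    {θ : List V → W} (hm : Homog gr gr σ δ' m) (hθ : Homog gr gr' σ δ θ) :
    Homog gr gr' σ (δ' + δ - σ) (coder (-e) m θ) :=
  Homog.cod (homog_single he.neg_apply_mem) hm (homog_single fun _ _ hx => hx) hθ

theorem MultiLin.coder {e : V →ₗ[R] V} {m : List V → V} (hm : MultiLin R m) {θ : List V → W}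
    (hθ : MultiLin R θ) : MultiLin R (coder e m θ) :=
  (multiLin_single e).cod hm (multiLin_single LinearMap.id) hθ

theorem twist_mem {e : V → V} {u : V} (hu : e u = u) (l : List V) (h : u ∈ l) : u ∈ twist e l := by
  have hit : ∀ n, e^[n] u = u := fun n => Function.iterate_fixed hu n
  induction l with
  | nil => exact h
  | cons x l ih =>
    rw [twist, List.mem_cons]
    rcases List.mem_cons.1 h with rfl | h
    · exact Or.inl (hit _).symm
    · exact Or.inr (ih h)

theorem ofList_eq_zero_of_mem {g : (n : ℕ) → (Fin n → V) → W} {n : ℕ} {u : V}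
    (hg : ∀ a : Fin n → V, (∃ i, a i = u) → g n a = 0) {l : List V} (hn : l.length = n)
    (hu : u ∈ l) : ofList g l = 0 := by
  subst hn
  obtain ⟨i, hi, rfl⟩ := List.mem_iff_getElem.1 hu
  exact hg _ ⟨⟨i, hi⟩, List.getD_eq_getElem _ _ hi⟩

theorem Algebra.unitalOp (X : Algebra k R gr s) {e : V →ₗ[R] V} {u : V}
    (hu : X.IsStrictUnit u) (heu : e u = u) : UnitalOp (-e) (X.op e) u where
  parity := by rw [LinearMap.neg_apply, heu]
  one := ofList_eq_zero_of_mem (g := fun n => X.m n) (hu.2.2 1 (by norm_num)) (by simp)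
    (twist_mem heu _ (by simp))
  left x := by
    refine Eq.trans ?_ (hu.1 x)
    change X.m 2 _ = X.m 2 _
    congr 1
    funext i
    fin_cases i
    · exact heu
    · rfl
  right x := by
    refine Eq.trans ?_ ((hu.2.1 (e x)).trans (by simp))
    change X.m 2 _ = X.m 2 _
    congr 1
    funext i
    fin_cases i <;> rfl
  other p q hpq := by
    refine ofList_eq_zero_of_mem (g := fun n => X.m n)
      (hu.2.2 (p ++ u :: q).length (by rw [List.length_append, List.length_cons]; omega)) (by simp)
      (twist_mem heu _ (by simp))

theorem Hom.op_unit {X : Algebra k R gr s} {Y : Algebra k R gr' s} (f : Hom X Y) {e : V →ₗ[R] V}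
    {u : V} {v : W} (hf : f.IsUnital u v) : f.op e [u] = v := by
  rw [f.op_one, hf.1]

theorem Hom.op_mem {X : Algebra k R gr s} {Y : Algebra k R gr' s} (f : Hom X Y) {e : V →ₗ[R] V}
    {u : V} {v : W} (hf : f.IsUnital u v) (heu : e u = u) (l : List V) (hu : u ∈ l)
    (hl : 2 ≤ l.length) : f.op e l = 0 :=
  ofList_eq_zero_of_mem (g := fun n => f.f n) (hf.2 _ hl) (by simp) (twist_mem heu _ hu)

theorem ofList_ofFn (g : (n : ℕ) → (Fin n → V) → W) (n : ℕ) (a : Fin n → V) :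
    ofList g (List.ofFn a) = g n a := by
  rw [ofList_eq g (List.ofFn a) n (fun i => (List.ofFn a).getD i 0) (by simp) fun _ _ => rfl]
  congr 1
  funext i
  simp

theorem Algebra.isStrictUnit_of_op (X : Algebra k R gr s) {e : V →ₗ[R] V} (he : IsGrading gr e)
    {u : V} (heu : e u = u) (h : UnitalOp (-e) (X.op e) u) : X.IsStrictUnit u := by
  have key : ∀ (n : ℕ) (a : Fin n → V), X.m n a = X.op e (twist e (List.ofFn a)) := by
    intro n a
    rw [Algebra.op, twist_twist he, ofList_ofFn (fun n => X.m n)]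
  refine ⟨fun x => ?_, fun x => ?_, fun n hn a ha => ?_⟩
  · rw [key]
    change X.op e [e u, x] = x
    rw [heu, h.left]
  · rw [key]
    change X.op e [e x, u] = x
    rw [h.right, LinearMap.neg_apply, neg_neg, he.invol]
  · rw [key]
    obtain ⟨i, hi⟩ := ha
    have hu : u ∈ twist e (List.ofFn a) :=
      twist_mem heu _ (hi ▸ (List.mem_ofFn' a _).2 ⟨i, rfl⟩)
    have hlen : (twist e (List.ofFn a)).length = n := by simp
    obtain ⟨p, q, hpq⟩ := List.append_of_mem hu
    rw [hpq] at hlen ⊢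
    rw [List.length_append, List.length_cons] at hlen
    by_cases h2 : 2 ≤ p.length + q.length
    · exact h.other p q h2
    · have hp : p = [] := List.length_eq_zero_iff.1 (by omega)
      have hq : q = [] := List.length_eq_zero_iff.1 (by omega)
      subst hp hq
      exact h.one

theorem Hom.isUnital_of_op {X : Algebra k R gr s} {Y : Algebra k R gr' s} (f : Hom X Y)
    {e : V →ₗ[R] V} (he : IsGrading gr e) {u : V} {v : W} (heu : e u = u) (h1 : f.op e [u] = v)
    (h : ∀ l, u ∈ l → 2 ≤ l.length → f.op e l = 0) : f.IsUnital u v := by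
  refine ⟨by rw [← f.op_one e, h1], fun n hn a ha => ?_⟩
  obtain ⟨i, hi⟩ := ha
  have key : f.f n a = f.op e (twist e (List.ofFn a)) := by
    rw [Hom.op, twist_twist he, ofList_ofFn (fun n => f.f n)]
  rw [key]
  exact h _ (twist_mem heu _ (hi ▸ (List.mem_ofFn' a _).2 ⟨i, rfl⟩)) (by simpa using hn)

theorem IsGrading.apply_unit {e : V →ₗ[R] V} (he : IsGrading gr e) {u : V} (hu : u ∈ gr (0, 0)) :
    e u = u := by
  rw [he.parity _ u hu]; simp [totalDeg]

end operations

/-! ### Reduction modulo `ħ` of operations and morphisms -/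

section reduction

variable {k : Type u} [CommRing k]
  {V : Type w} [AddCommGroup V] [Module k V] {gr : ℤ × ℤ → Submodule k V}
  {W : Type w} [AddCommGroup W] [Module k W] {gr' : ℤ × ℤ → Submodule k W}
  {s : ℕ}

/-- The parity involution of series. -/
abbrev parS {e : V →ₗ[k] V} (he : IsGrading gr e) : BgrSeries gr →ₗ[Polynomial k] BgrSeries gr :=
  mapCoeff gr e he.apply_mem

/-- The sign of suspended series. -/
noncomputable abbrev npar {e : V →ₗ[k] V} (he : IsGrading gr e) : BgrSeries gr →ₗ[Polynomial k] BgrSeries gr :=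
  -parS he

theorem twist_map {A B : Type*} {e : A → A} {e' : B → B} {c : A → B} (h : ∀ x, c (e x) = e' (c x))
    (l : List A) : (twist e l).map c = twist e' (l.map c) := by
  have hit : ∀ n x, c (e^[n] x) = e'^[n] (c x) := by
    intro n
    induction n with
    | zero => exact fun _ => rfl
    | succ n ih => intro x; rw [Function.iterate_succ_apply', h, ih, Function.iterate_succ_apply']
  induction l with
  | nil => rfl
  | cons x l ih => rw [twist, List.map_cons, ih, hit, List.map_cons, twist, List.length_map]

theorem coeff_zero_ofList {g : (n : ℕ) → (Fin n → BgrSeries gr) → BgrSeries gr'}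
    {g' : (n : ℕ) → (Fin n → V) → W}
    (h : ∀ n a, constCoeff gr' (g n a) = g' n (fun i => constCoeff gr (a i)))
    (l : List (BgrSeries gr)) : coeff gr' 0 (ofList g l) = ofList g' (l.map (coeff gr 0)) := by
  rw [ofList_eq g' (l.map (coeff gr 0)) l.length (fun i => (l.map (coeff gr 0)).getD i 0) (by simp)
    fun _ _ => rfl]
  refine (h _ _).trans ?_
  congr 1
  funext i
  change coeff gr 0 _ = _
  rw [List.getD_eq_getElem _ _ i.2, List.getD_eq_getElem _ _ (by simp), List.getElem_map]

theorem FormalDeformation.coeff_zero_op {X : Algebra k k gr s} (D : FormalDeformation X)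
    {e : V →ₗ[k] V} (he : IsGrading gr e) (l : List (BgrSeries gr)) :
    coeff gr 0 (D.alg.op (parS he) l) = X.op e (l.map (coeff gr 0)) := by
  rw [Algebra.op, Algebra.op, coeff_zero_ofList D.reduces, twist_map (e := parS he) (e' := e) (c := coeff gr 0) fun x => rfl]

theorem DeformationHom.coeff_zero_op {X : Algebra k k gr s} {Y : Algebra k k gr' s}
    {D : FormalDeformation X} {E : FormalDeformation Y} (F : DeformationHom D E)
    {e : V →ₗ[k] V} (he : IsGrading gr e) (l : List (BgrSeries gr)) :
    coeff gr' 0 (F.lift.op (parS he) l) = F.base.op e (l.map (coeff gr 0)) := by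
  rw [Hom.op, Hom.op, coeff_zero_ofList F.reduces, twist_map (e := parS he) (e' := e) (c := coeff gr 0) fun x => rfl]

theorem coeff_zero_pull {U : Type w} [AddCommGroup U] [Module k U] {gr'' : ℤ × ℤ → Submodule k U}
    {F : List (BgrSeries gr) → BgrSeries gr'} {f : List V → W}
    {T : List (BgrSeries gr') → BgrSeries gr''} {t : List W → U}
    (hF : ∀ l, coeff gr' 0 (F l) = f (l.map (coeff gr 0)))
    (hT : ∀ l, coeff gr'' 0 (T l) = t (l.map (coeff gr' 0))) (l : List (BgrSeries gr)) :
    coeff gr'' 0 (pull F T l) = pull f t (l.map (coeff gr 0)) := by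
  rw [← pull_comap hF t l, ← funext hT]
  exact (pull_map (coeff gr'' 0).toAddMonoidHom F T l).symm

theorem coeff_zero_cod {U : Type w} [AddCommGroup U] [Module k U] {gr'' : ℤ × ℤ → Submodule k U}
    {P H F : List (BgrSeries gr) → BgrSeries gr'} {p η f : List V → W}
    {T : List (BgrSeries gr') → BgrSeries gr''} {t : List W → U}
    (hP : ∀ l, coeff gr' 0 (P l) = p (l.map (coeff gr 0)))
    (hH : ∀ l, coeff gr' 0 (H l) = η (l.map (coeff gr 0)))
    (hF : ∀ l, coeff gr' 0 (F l) = f (l.map (coeff gr 0)))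
    (hT : ∀ l, coeff gr'' 0 (T l) = t (l.map (coeff gr' 0))) (l : List (BgrSeries gr)) :
    coeff gr'' 0 (cod P H F T l) = cod p η f t (l.map (coeff gr 0)) := by
  rw [← cod_comap hP hH hF t l, ← funext hT]
  exact (cod_map (coeff gr'' 0).toAddMonoidHom P H F T l).symm

theorem coeff_zero_single {E : BgrSeries gr → BgrSeries gr'} {e : V → W}
    (h : ∀ x, coeff gr' 0 (E x) = e (coeff gr 0 x)) (l : List (BgrSeries gr)) :
    coeff gr' 0 (single E l) = single e (l.map (coeff gr 0)) := by
  match l with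
  | [] => exact map_zero _
  | [x] => exact h x
  | _ :: _ :: _ => exact map_zero _

theorem coeff_zero_coder {e : V →ₗ[k] V} (he : IsGrading gr e)
    {M : List (BgrSeries gr) → BgrSeries gr} {m : List V → V}
    {T : List (BgrSeries gr) → BgrSeries gr'} {t : List V → W}
    (hM : ∀ l, coeff gr 0 (M l) = m (l.map (coeff gr 0)))
    (hT : ∀ l, coeff gr' 0 (T l) = t (l.map (coeff gr 0))) (l : List (BgrSeries gr)) :
    coeff gr' 0 (coder (npar he) M T l) = coder (-e) m t (l.map (coeff gr 0)) :=
  coeff_zero_cod (coeff_zero_single fun x => by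
    rw [LinearMap.neg_apply, LinearMap.neg_apply, map_neg, coeff_mapCoeff]) hM
    (coeff_zero_single fun _ => rfl) hT l

end reduction

/-! ### Existence of the deformation and of the lift -/

section existence

variable {k : Type u} [CommRing k]
  {V : Type w} [AddCommGroup V] [Module k V] {gr : ℤ × ℤ → Submodule k V}
  {W : Type w} [AddCommGroup W] [Module k W] {gr' : ℤ × ℤ → Submodule k W}
  {s : ℕ} {eV : V →ₗ[k] V} {eW : W →ₗ[k] W}

local notation "ħ" => (Polynomial.X : Polynomial k)

/-- `B [x]` is a multiple of `ħ`, and this factor is pulled out of `T`. -/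
theorem div_apply_of_coeff_zero {B : List (BgrSeries gr) → BgrSeries gr}
    (hB : ∀ x, coeff gr 0 (B [x]) = 0) {U : Type*} [AddCommGroup U] [Module (Polynomial k) U]
    {T : List (BgrSeries gr) → U} (hT : MultiLin (Polynomial k) T) {j : ℕ}
    {p q : List (BgrSeries gr)} {x : BgrSeries gr}
    (h : ∀ y, Div (ħ ^ j) (T (p ++ y :: q))) : Div (ħ ^ (j + 1)) (T (p ++ B [x] :: q)) := by
  obtain ⟨y, hy⟩ : Div (ħ ^ 1) (B [x]) := div_X_pow_iff.2 fun N hN => by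
    obtain rfl : N = 0 := by omega
    exact hB x
  obtain ⟨z, hz⟩ := h y
  rw [hy, hT.map_smul, hz, smul_smul]
  exact ⟨z, by rw [pow_one, pow_succ']⟩

/-- A coderivation whose linear part vanishes modulo `ħ` improves divisibility. -/
theorem div_coder_of_minimal {e : BgrSeries gr →ₗ[Polynomial k] BgrSeries gr}
    {B : List (BgrSeries gr) → BgrSeries gr} (hB : ∀ x, coeff gr 0 (B [x]) = 0)
    {U : Type*} [AddCommGroup U] [Module (Polynomial k) U]
    {T : List (BgrSeries gr) → U} (hT : MultiLin (Polynomial k) T) {w : ℕ}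
    (h : ∀ l, Div (ħ ^ (w - l.length + 1)) (T l)) (l : List (BgrSeries gr)) :
    Div (ħ ^ (w + 1 - l.length + 1)) (coder e B T l) := by
  -- A longer block shortens the list, and the hypothesis for shorter lists is stronger by at least
  -- one power of `ħ`; a block of length one contributes this power through `hB`.
  refine div_coder hT l (fun q (hq : q.length < l.length) =>
    show Div (ħ ^ (w + 1 - l.length + 1)) (T q) from (h q).mono (by omega)) fun p x q hpq => ?_
  refine (div_apply_of_coeff_zero hB hT (j := w - l.length + 1) fun y => ?_).mono (b := w - l.length + 1 + 1) (by omega)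
  have := h (p ++ y :: q)
  rwa [List.length_append, List.length_cons, ← add_assoc, hpq] at this

variable (X : Algebra k k gr' s) (Xh : FormalDeformation X) (H : Algebra k k gr s) (f : Hom H X)
  (hV : IsGrading gr eV) (hW : IsGrading gr' eW)

/-- The failure of the family `C` to be a morphism from the operations `B` to `Xh`. -/
noncomputable def morphismDefect (B : List (BgrSeries gr) → BgrSeries gr) (C : List (BgrSeries gr) → BgrSeries gr')
    (l : List (BgrSeries gr)) : BgrSeries gr' :=
  pull C (Xh.alg.op (parS hW)) l - coder (npar hV) B C l

/-- The bidegree of `C` is written as a difference to fit the general scheme with `δ = 2 • typ s`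
and `τ = typ s`. -/
abbrev AdmissibleOp (Z : List V → Prop) (B : List (BgrSeries gr) → BgrSeries gr)
    (C : List (BgrSeries gr) → BgrSeries gr') : Prop :=
  Admissible gr gr' hV.span hW.span (typ s) ((2 : ℤ) • typ s) ((2 : ℤ) • typ s - typ s) Z
    (H.op eV) (f.op eV) B C

variable {X H f hV hW} {Z : List V → Prop} {B : List (BgrSeries gr) → BgrSeries gr}
  {C : List (BgrSeries gr) → BgrSeries gr'}

theorem AdmissibleOp.homog (h : AdmissibleOp X H f hV hW Z B C) :
    Homog (seriesGrading gr) (seriesGrading gr') (typ s) (typ s) C :=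
  h.homog_right.congr (by rw [two_smul]; abel)

theorem AdmissibleOp.odd (h : AdmissibleOp X H f hV hW Z B C) (l : List (BgrSeries gr)) :
    C (l.map (npar hV)) = (npar hW) (C l) :=
  h.homog.odd (totalDeg_typ s) (by rw [totalDeg_typ]; exact odd_one) h.multiLin_right hV.series
    hW.series l

theorem AdmissibleOp.even (h : AdmissibleOp X H f hV hW Z B C) (l : List (BgrSeries gr)) :
    B (l.map (npar hV)) = -(npar hV) (B l) :=
  h.homog_left.even (totalDeg_typ s) (by rw [totalDeg_smul]; exact even_two_mul _) h.multiLin_left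
    hV.series hV.series l

theorem AdmissibleOp.minimal (h : AdmissibleOp X H f hV hW Z B C) (hmin : H.m 1 = 0)
    (x : BgrSeries gr) : coeff gr 0 (B [x]) = 0 := by
  rw [h.coeff_left]
  change H.m 1 _ = 0
  rw [hmin]; rfl

theorem AdmissibleOp.linear (h : AdmissibleOp X H f hV hW Z B C) (x : BgrSeries gr) :
    coeff gr' 0 (C [x]) = f.linear (coeff gr 0 x) := by
  rw [h.coeff_right, List.map_singleton, f.op_one]

/-- The Bianchi identity for the defect of a morphism. -/
theorem AdmissibleOp.bianchi (h : AdmissibleOp X H f hV hW Z B C) (l : List (BgrSeries gr)) :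
    cod (fun l => (npar hW) (C l)) (morphismDefect X Xh hV hW B C) C (Xh.alg.op (parS hW)) l
      + coder (npar hV) B (morphismDefect X Xh hV hW B C) l
      + cod (proj _) (coder (npar hV) B B) (proj _) C l = 0 := by
  have hM := Xh.alg.multiLin_op (parS hW)
  have h1 := pull_coder (eV := npar hV) (eW := npar hW) (m' := B) (Xh.alg.op_nil (parS hW))
    h.nil_right h.multiLin_right h.odd hM l
  -- The left side was the pullback of the square of the coderivation of `Xh`, which is zero.
  rw [funext (Xh.alg.coder_op hW.series), pull_zero] at h1
  have h2 := coder_coder h.nil_left h.multiLin_left hV.series.neg_invol h.even h.multiLin_right l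
  have h3 : coder (npar hV) B (morphismDefect X Xh hV hW B C) l
      = coder (npar hV) B (pull C (Xh.alg.op (parS hW))) l - coder (npar hV) B (coder (npar hV) B C) l :=
    coder_sub _ _ _ _ l
  rw [h3, ← h2]
  refine Eq.trans ?_ h1.symm
  change cod _ (morphismDefect X Xh hV hW B C) C _ l + _ + _
    = _ + cod _ (morphismDefect X Xh hV hW B C) C _ l
  abel

/-- Every `x` is a cycle, since the differential of `H` vanishes. Its image is a boundary, so `x` is
a boundary by injectivity on cohomology, and hence zero. -/
theorem eq_zero_of_linear_eq (hmin : H.m 1 = 0) (hf : f.IsQuasiIso) {x : V} {y : W}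
    (h : f.linear x + X.d y = 0) : x = 0 := by
  have hd : ∀ z, H.d z = 0 := fun z => by
    change H.m 1 _ = 0
    rw [hmin]; rfl
  obtain ⟨z, -, hz, -⟩ := hf.coneExact x (-y) (hd x) (by rw [map_neg]; exact eq_neg_of_add_eq_zero_left h)
  rw [hz, hd]

/-- By induction on `j ≤ n`: once `x` is divisible by `ħ ^ j`, the coefficients of order `j` satisfy
`f₁ x_j + m₁ y_j = 0`, so `x_j` vanishes. Then `C [x]` is divisible as well, and so is the other
summand. -/
theorem div_of_apply_add (hmin : H.m 1 = 0) (hf : f.IsQuasiIso)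
    {C : List (BgrSeries gr) → BgrSeries gr'} (hC : MultiLin (Polynomial k) C)
    (hCf : ∀ x, coeff gr' 0 (C [x]) = f.linear (coeff gr 0 x)) {n : ℕ} {x : BgrSeries gr}
    {y : BgrSeries gr'} (hy : Div (ħ ^ n) y) (h : Div (ħ ^ (n + 1)) (Xh.alg.d y + C [x])) :
    Div (ħ ^ (n + 1)) x ∧ Div (ħ ^ (n + 1)) (Xh.alg.d y) := by
  have hx : ∀ j ≤ n + 1, Div (ħ ^ j) x := by
    intro j
    induction j with
    | zero => exact fun _ => ⟨_, by rw [pow_zero, one_smul]⟩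
    | succ j ih =>
      intro hj
      have hdj := ih (by omega)
      refine div_succ hdj ?_
      have hc := div_X_pow_iff.1 h j (by omega)
      obtain ⟨z, hz⟩ := hdj
      have hCx : coeff gr' j (C [x]) = f.linear (coeff gr j x) := by
        have e1 := hC.map_smul [] [] (ħ ^ j) z
        rw [List.nil_append, List.nil_append] at e1
        have e2 := coeff_X_pow_smul_add (C [z]) j 0
        have e3 := coeff_X_pow_smul_add z j 0
        rw [zero_add] at e2 e3
        rw [hz, e1, e2, e3, hCf]
      rw [map_add, hCx, coeff_apply_of_div (m := X.d) (fun x => Xh.reduces 1 _)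
        (hy.mono (by omega)), add_comm] at hc
      exact eq_zero_of_linear_eq hmin hf hc
  have hCx := (hx _ le_rfl).multiLin hC [] []
  rw [List.nil_append] at hCx
  have := h.sub hCx
  rw [add_sub_cancel_right] at this
  exact ⟨hx _ le_rfl, this⟩

/-- In the Bianchi identity the leading terms are `m₁ (E l)` and `C [S l]`, where `S` is the square
of `B`; injectivity of `f₁` on cohomology separates them. The other terms of `S` are evaluated on
shorter lists, whence the induction on the length. -/
theorem AdmissibleOp.div_square_and_closed (h : AdmissibleOp X H f hV hW Z B C)
    (hmin : H.m 1 = 0) (hf : f.IsQuasiIso) (w : ℕ)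
    (hE : ∀ l, Div (ħ ^ (w - l.length + 1)) (morphismDefect X Xh hV hW B C l))
    (l : List (BgrSeries gr)) (hl : l.length ≤ w) :
    Div (ħ ^ (w - l.length + 1 + 1)) (coder (npar hV) B B l) ∧
      Div (ħ ^ (w - l.length + 1 + 1)) (Xh.alg.d (morphismDefect X Xh hV hW B C l)) := by
  induction hn : l.length using Nat.strong_induction_on generalizing l with
  | _ n ih =>
  subst hn
  set E := morphismDefect X Xh hV hW B C with hEdef
  set S := coder (npar hV) B B with hS
  have hM := Xh.alg.multiLin_op (parS hW)
  have hEM : MultiLin (Polynomial k) E :=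
    (h.multiLin_right.pull hM).sub (h.multiLin_left.coder h.multiLin_right)
  have hE0 : E [] = 0 := by
    simp [hEdef, morphismDefect, pull, cod, Xh.alg.op_nil (parS hW)]
  have h1 := cod_lead (r := ħ ^ (w - l.length + 1 + 1)) hM
    (p := fun l => (npar hW) (C l)) (η := E) (f := C) (by simp [h.nil_right]) hE0 h.nil_right l
    (fun q hq => (hE q).mono (by omega))
  have h2 := div_coder_of_minimal (e := npar hV) (h.minimal hmin) hEM hE l
  have h3 := cod_lead (r := ħ ^ (w - l.length + 1 + 1)) h.multiLin_right (p := proj (BgrSeries gr))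
    (η := S) (f := proj _) rfl rfl rfl l
    (fun q hq => ((ih q.length hq q (by omega) rfl).1).mono (by omega))
  have h4 : Div (ħ ^ (w - l.length + 1 + 1)) (Xh.alg.d (E l) + C [S l]) := by
    have hb := h.bianchi (hV := hV) (hW := hW) Xh l
    rw [← hEdef, ← hS] at hb
    rw [Xh.alg.op_one] at h1
    have h5 := (h1.add (h2.mono (by omega))).add h3
    have h6 := h5.neg
    convert h6 using 1
    rw [← sub_eq_zero, ← hb]
    abel
  exact div_of_apply_add Xh hmin hf h.multiLin_right h.linear (hE l) h4

/-- The linear part of `C` agrees with `f₁` modulo `ħ`, which is one order better on multiples of `ħ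
^ n`. -/
theorem div_linear_sub {C : List (BgrSeries gr) → BgrSeries gr'} (hC : MultiLin (Polynomial k) C)
    {f : Hom H X} (hCf : ∀ x, coeff gr' 0 (C [x]) = f.linear (coeff gr 0 x)) {n : ℕ}
    {x : BgrSeries gr} (hx : Div (ħ ^ n) x) :
    Div (ħ ^ (n + 1)) (C [x] - mapCoeff gr f.linear f.linear_mem x) := by
  obtain ⟨y, hy⟩ := hx
  have e1 := hC.map_smul [] [] (ħ ^ n) y
  rw [List.nil_append, List.nil_append] at e1
  rw [hy, e1, map_smul, ← smul_sub]
  obtain ⟨z, hz⟩ : Div (ħ ^ 1) (C [y] - mapCoeff gr f.linear f.linear_mem y) :=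
    div_X_pow_iff.2 fun N hN => by
      obtain rfl : N = 0 := by omega
      rw [map_sub, hCf, coeff_mapCoeff, sub_self]
  exact ⟨z, by rw [hz, smul_smul, ← pow_add]⟩

/-- For `lead`: a change of `C` in the pullback contributes `m₁ ΔC` and terms on shorter lists;
under the coderivation of `B'` it is negligible by minimality; a change of `B` contributes `C [ΔB]`,
which is `f₁ ΔB` in leading order. -/
theorem solvable_morphismDefect (hmin : H.m 1 = 0) (hf : f.IsQuasiIso)
    (hZ : ∀ B C, AdmissibleOp X H f hV hW Z B C → ∀ l, Z l →
      morphismDefect X Xh hV hW B C (l.map (constLin hV.span)) = 0) :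
    Solvable gr gr' hV.span hW.span (typ s) ((2 : ℤ) • typ s) (typ s) Z (H.op eV) (f.op eV)
      f.linear X.d (mapCoeff gr f.linear f.linear_mem) Xh.alg.d (morphismDefect X Xh hV hW) where
  multiLin B C h :=
    (h.multiLin_right.pull (Xh.alg.multiLin_op _)).sub (h.multiLin_left.coder h.multiLin_right)
  homog B C h := by
    have h' : AdmissibleOp X H f hV hW Z B C := h
    refine (h'.homog.pull (Xh.alg.homog_op hW.series)).sub ?_
    refine (h.homog_left.coder hV.series h'.homog).congr ?_
    abel
  nil B C h := by simp [morphismDefect, pull, cod, Xh.alg.op_nil (parS hW)]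
  coeff_zero B C h l := by
    rw [morphismDefect, map_sub, coeff_zero_pull h.coeff_right (Xh.coeff_zero_op hW),
      coeff_zero_coder hV h.coeff_left h.coeff_right, f.pull_op hV hW, sub_self]
  mem := hZ
  lead B C h B' C' h' w hB hC l := by
    have hAO : AdmissibleOp X H f hV hW Z B C := h
    have hAO' : AdmissibleOp X H f hV hW Z B' C' := h'
    have hM := Xh.alg.multiLin_op (parS hW)
    have e1 := pull_sub_pull hM h.nil_right h'.nil_right l
    have e2 := cod_lead (r := ħ ^ (w + 1 - l.length + 1)) hM (p := C) (η := fun l => C' l - C l)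
      (f := C') h.nil_right (by simp [h.nil_right, h'.nil_right]) h'.nil_right l
      (fun q hq => (hC q).mono (by omega))
    rw [← e1, Xh.alg.op_one] at e2
    have e3 := div_coder_of_minimal (e := npar hV) (hAO'.minimal hmin)
      (h'.multiLin_right.sub h.multiLin_right) hC l
    rw [coder_sub] at e3
    have e4 := cod_lead (r := ħ ^ (w + 1 - l.length + 1)) h.multiLin_right
      (p := single (npar hV)) (η := fun l => B' l - B l) (f := proj _) rfl
      (by simp [h.nil_left, h'.nil_left]) rfl l (fun q hq => (hB q).mono (by omega))
    have e5 : cod (single (npar hV)) (fun l => B' l - B l) (proj _) C l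
        = coder (npar hV) B' C l - coder (npar hV) B C l := by
      have := cod_add_mid h.multiLin_right (p := single (npar hV)) (η := fun l => B' l - B l)
        (χ := B) (f := proj _) rfl (by simp [h.nil_left, h'.nil_left]) h.nil_left rfl l
      simp only [sub_add_cancel] at this
      rw [coder, this]
      exact (add_sub_cancel_right _ _).symm
    have e6 : Div (ħ ^ (w + 1 - l.length + 1))
        (C [B' l - B l] - mapCoeff gr f.linear f.linear_mem (B' l - B l)) :=
      (div_linear_sub h.multiLin_right hAO.linear (hB l)).mono (by omega)
    rw [e5] at e4
    have e8 := ((e2.sub e3).sub e4).sub e6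
    convert e8 using 1
    simp only [morphismDefect]
    abel
  closed B C h w hE l hl := (AdmissibleOp.div_square_and_closed Xh h hmin hf w hE l hl).2
  red_left x := coeff_mapCoeff _ _ _ _
  red_right x := Xh.reduces 1 _
  exact a ha := by
    obtain ⟨z, y, -, hy⟩ := hf.coneExact 0 a (map_zero _) (by rw [map_zero, ha])
    exact ⟨z, -y, by rw [hy, map_neg, sub_neg_eq_add]⟩
  left_mem := f.linear_mem
  right_mem := X.d_mem

/-- Existence of the deformation and of the lift. -/
theorem exists_deformation [Module.Projective k V] (hgr : DirectSum.IsInternal gr)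
    (hgr' : DirectSum.IsInternal gr') (hmin : H.m 1 = 0) (hf : f.IsQuasiIso)
    (hZ : ∀ B C, AdmissibleOp X H f hV hW Z B C → ∀ l, Z l →
      morphismDefect X Xh hV hW B C (l.map (constLin hV.span)) = 0)
    {P : V →ₗ[k] V} (hP : ∀ d, ∀ x ∈ gr d, P x ∈ gr d)
    (hPe : ∀ e : List V → W, MultiLin k e → (∀ l, Z l → e l = 0) → ∀ l, e (l.map P) = e l)
    (hPZ : ∀ l, Z l → (0 : V) ∈ l.map P) :
    ∃ (D : FormalDeformation H) (F : DeformationHom D Xh), F.base = f ∧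
      AdmissibleOp X H f hV hW Z (D.alg.op (parS hV)) (F.lift.op (parS hV)) := by
  obtain ⟨π, hπ⟩ := exists_isProj hgr
  obtain ⟨π', hπ'⟩ := exists_isProj hgr'
  obtain ⟨B, C, h, hE⟩ := (solvable_morphismDefect Xh hmin hf hZ).exists_solution hV.span hW.span
    hπ hπ' hP hPe hPZ (H.multiLin_op eV) (H.homog_op hV) (H.op_nil eV) (f.multiLin_op eV)
    ((f.homog_op hV).congr (by rw [two_smul]; abel)) (f.op_nil eV)
  have hAO : AdmissibleOp X H f hV hW Z B C := h
  -- With `E = 0` the estimate for the square of `B` is available in every weight, so the Stasheff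
  -- identities hold without being imposed.
  have hS : ∀ l, coder (npar hV) B B l = 0 := fun l => eq_zero_of_div fun j => by
    refine ((hAO.div_square_and_closed Xh hmin hf (l.length + j) (fun q => ?_) l (by omega)).1).mono
      (by omega)
    rw [hE]
    exact Div.zero
  let A := Algebra.ofOp hV.series h.multiLin_left h.nil_left h.homog_left hS
  have hA : A.op (parS hV) = B := Algebra.ofOp_op _ _ _ _ _
  have hconst : ∀ (n : ℕ) (a : Fin n → BgrSeries gr),
      (twist (parS hV) (List.ofFn a)).map (coeff gr 0)
        = twist eV (List.ofFn fun i => constCoeff gr (a i)) := by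
    intro n a
    rw [twist_map (e := parS hV) (e' := eV) (c := coeff gr 0) fun x => rfl, List.map_ofFn]
    rfl
  have key : ∀ (n : ℕ) (a : Fin n → BgrSeries gr),
      A.m n a = B (twist (parS hV) (List.ofFn a)) := fun n a => rfl
  let D : FormalDeformation H :=
    { alg := A
      reduces := fun n a => by
        rw [key, ← coeff_zero, h.coeff_left, hconst, Algebra.op, twist_twist hV,
          ofList_ofFn (fun n => H.m n)] }
  have hC : ∀ l, pull C (Xh.alg.op (parS hW)) l = coder (npar hV) (A.op (parS hV)) C l := by
    intro l
    rw [hA]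
    exact sub_eq_zero.1 (hE l)
  let Fl : Hom A Xh.alg := Hom.ofOp hV.series hW.series h.multiLin_right h.nil_right hAO.homog hC
  have hFl : Fl.op (parS hV) = C := Hom.ofOp_op _ _ _ _ _ _
  have keyF : ∀ (n : ℕ) (a : Fin n → BgrSeries gr),
      Fl.f n a = C (twist (parS hV) (List.ofFn a)) := fun n a => rfl
  refine ⟨D, ⟨f, Fl, fun n a => ?_⟩, rfl, ?_⟩
  · rw [keyF, ← coeff_zero, h.coeff_right, hconst, Hom.op, twist_twist hV,
      ofList_ofFn (fun n => f.f n)]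
  · change AdmissibleOp X H f hV hW Z (A.op (parS hV)) (Fl.op (parS hV))
    rw [hA, hFl]
    exact hAO

end existence

theorem cod_zero_mid {R : Type u} {V : Type v} {W : Type v} {U : Type w} [CommRing R]
    [AddCommGroup V] [Module R V] [AddCommGroup W] [Module R W] [AddCommGroup U] [Module R U]
    {p f : List V → W} {θ : List W → U} (hθ : MultiLin R θ) (hp0 : p [] = 0) (hf0 : f [] = 0)
    (l : List V) : cod p (fun _ => 0) f θ l = 0 := by
  have := cod_add_mid hθ hp0 (η := fun _ => 0) (χ := fun _ => 0) rfl rfl hf0 l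
  simpa using this

/-! ### Comparison of two lifts up to homotopy -/

section uniqueness

variable {k : Type u} [CommRing k]
  {V : Type w} [AddCommGroup V] [Module k V] {gr : ℤ × ℤ → Submodule k V}
  {W : Type w} [AddCommGroup W] [Module k W] {gr' : ℤ × ℤ → Submodule k W}
  {s : ℕ} {eV : V →ₗ[k] V} {eW : W →ₗ[k] W}

local notation "ħ" => (Polynomial.X : Polynomial k)

variable {X : Algebra k k gr' s} {Xh : FormalDeformation X} {H : Algebra k k gr s}
  {D D' : FormalDeformation H} (F : DeformationHom D Xh) (F' : DeformationHom D' Xh)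
  (hV : IsGrading gr eV) (hW : IsGrading gr' eW)

/-- The failure of `-C` to be a homotopy from the composition of `F'` with `B` to `F`. -/
noncomputable def homotopyDefect (B : List (BgrSeries gr) → BgrSeries gr)
    (C : List (BgrSeries gr) → BgrSeries gr') (l : List (BgrSeries gr)) : BgrSeries gr' :=
  F.lift.op (parS hV) l - pull B (F'.lift.op (parS hV)) l
    - cod (fun l => npar hW (pull B (F'.lift.op (parS hV)) l)) (fun l => -C l)
        (F.lift.op (parS hV)) (Xh.alg.op (parS hW)) l
    - coder (npar hV) (D.alg.op (parS hV)) (fun l => -C l) l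

/-- `B` deforms the identity and `C` the zero homotopy. Here `δ = τ = typ s` in the general scheme,
so that the bidegree of `C` is a difference equal to zero. -/
abbrev AdmissibleHomotopy (Z : List V → Prop) (B : List (BgrSeries gr) → BgrSeries gr)
    (C : List (BgrSeries gr) → BgrSeries gr') : Prop :=
  Admissible gr gr' hV.span hW.span (typ s) (typ s) (typ s - typ s) Z (proj V) (fun _ => (0 : W))
    B C

variable {F F' hV hW} {Z : List V → Prop} {B : List (BgrSeries gr) → BgrSeries gr}
  {C : List (BgrSeries gr) → BgrSeries gr'}

theorem DeformationHom.coeff_op_one (F : DeformationHom D Xh) (hV : IsGrading gr eV)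
    (x : BgrSeries gr) :
    coeff gr' 0 (F.lift.op (parS hV) [x]) = F.base.linear (coeff gr 0 x) := by
  rw [F.coeff_zero_op hV, List.map_singleton, F.base.op_one]

theorem FormalDeformation.minimal (D : FormalDeformation H) (hmin : H.m 1 = 0)
    (hV : IsGrading gr eV) (x : BgrSeries gr) : coeff gr 0 (D.alg.op (parS hV) [x]) = 0 := by
  rw [D.coeff_zero_op hV]
  change H.m 1 _ = 0
  rw [hmin]; rfl

theorem AdmissibleHomotopy.multiLin (h : AdmissibleHomotopy (s := s) hV hW Z B C) :
    MultiLin (Polynomial k) (homotopyDefect F F' hV hW B C) := by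
  have hp := h.multiLin_left.pull (F'.lift.multiLin_op (parS hV))
  have hM := Xh.alg.multiLin_op (parS hW)
  exact (((F.lift.multiLin_op _).sub hp).sub ((hp.comp_left (npar hW)).cod h.multiLin_right.neg
    (F.lift.multiLin_op _) hM)).sub ((D.alg.multiLin_op _).coder h.multiLin_right.neg)

theorem AdmissibleHomotopy.homog_pull (h : AdmissibleHomotopy (s := s) hV hW Z B C) :
    Homog (seriesGrading gr) (seriesGrading gr') (typ s) (typ s)
      (pull B (F'.lift.op (parS hV))) :=
  h.homog_left.pull (F'.lift.homog_op hV.series)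

theorem AdmissibleHomotopy.homog (h : AdmissibleHomotopy (s := s) hV hW Z B C) :
    Homog (seriesGrading gr) (seriesGrading gr') (typ s) (typ s)
      (homotopyDefect F F' hV hW B C) := by
  have hp := h.homog_pull (F' := F')
  have hp' : Homog (seriesGrading gr) (seriesGrading gr') (typ s) (typ s)
      (fun l => npar hW (pull B (F'.lift.op (parS hV)) l)) :=
    fun l ds hl => hW.series.neg_apply_mem _ _ (hp l ds hl)
  refine (((F.lift.homog_op hV.series).sub hp).sub ?_).sub ?_
  · exact (hp'.cod h.homog_right.neg (F.lift.homog_op hV.series)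
      (Xh.alg.homog_op hW.series)).congr (by rw [two_smul]; abel)
  · exact ((D.alg.homog_op hV.series).coder hV.series h.homog_right.neg).congr
      (by rw [two_smul]; abel)

theorem homotopyDefect_nil : homotopyDefect F F' hV hW B C [] = 0 := by
  simp [homotopyDefect, pull, cod, F.lift.op_nil (parS hV), F'.lift.op_nil (parS hV)]

theorem AdmissibleHomotopy.coeff_zero (h : AdmissibleHomotopy (s := s) hV hW Z B C)
    (hF : F'.base = F.base) (l : List (BgrSeries gr)) :
    coeff gr' 0 (homotopyDefect F F' hV hW B C l) = 0 := by
  have h1 : ∀ l, coeff gr' 0 (pull B (F'.lift.op (parS hV)) l)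
      = F.base.op eV (l.map (coeff gr 0)) := fun l => by
    rw [coeff_zero_pull h.coeff_left (F'.coeff_zero_op hV), pull_proj_left (F'.base.multiLin_op eV),
      hF]
  have h2 : ∀ l, coeff gr' 0 (npar hW (pull B (F'.lift.op (parS hV)) l))
      = (-eW) (F.base.op eV (l.map (coeff gr 0))) := fun l => by
    rw [LinearMap.neg_apply, map_neg, coeff_mapCoeff, h1, LinearMap.neg_apply]
  have h3 : ∀ l, coeff gr' 0 (-C l) = (fun _ : List V => (0 : W)) (l.map (coeff gr 0)) := fun l => by
    rw [map_neg, h.coeff_right, neg_zero]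
  rw [homotopyDefect, map_sub, map_sub, map_sub, h1, F.coeff_zero_op hV, sub_self,
    coeff_zero_cod (p := fun l => (-eW) (F.base.op eV l)) (η := fun _ => 0) h2 h3 (F.coeff_zero_op hV) (Xh.coeff_zero_op hW),
    coeff_zero_coder hV (D.coeff_zero_op hV) (t := fun _ => 0) h3, coder, cod_zero, cod_zero_mid (X.multiLin_op eW)]
  · simp
  · rw [F.base.op_nil, map_zero]
  · exact F.base.op_nil eV

/-- The composite `pull B` varies by `f₁ ΔB` and the homotopy term by `m₁ ΔC`, in leading order. The
change of the composite inside the homotopy term only sees shorter lists, and the coderivation on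
the source gains a power of `ħ` by minimality. -/
theorem AdmissibleHomotopy.lead (h : AdmissibleHomotopy (s := s) hV hW Z B C)
    {B' : List (BgrSeries gr) → BgrSeries gr} {C' : List (BgrSeries gr) → BgrSeries gr'}
    (h' : AdmissibleHomotopy (s := s) hV hW Z B' C') (hmin : H.m 1 = 0) (hF : F'.base = F.base)
    (w : ℕ) (hB : ∀ l, Div (ħ ^ (w - l.length + 1)) (B' l - B l))
    (hC : ∀ l, Div (ħ ^ (w - l.length + 1)) (C' l - C l)) (l : List (BgrSeries gr)) :
    Div (ħ ^ (w + 1 - l.length + 1))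
      (homotopyDefect F F' hV hW B' C' l - homotopyDefect F F' hV hW B C l
        - (Xh.alg.d (C' l - C l)
          - mapCoeff gr F.base.linear F.base.linear_mem (B' l - B l))) := by
  have hM := Xh.alg.multiLin_op (parS hW)
  have hΦ' := F'.lift.multiLin_op (parS hV)
  have hΦ0 := F.lift.op_nil (parS hV)
  have hΦ0' := F'.lift.op_nil (parS hV)
  have hlin : ∀ x, coeff gr' 0 (F'.lift.op (parS hV) [x]) = F.base.linear (coeff gr 0 x) :=
    fun x => by rw [F'.coeff_op_one, hF]
  have hdp : ∀ l, Div (ħ ^ (w + 1 - l.length + 1)) (pull B' (F'.lift.op (parS hV)) l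
      - pull B (F'.lift.op (parS hV)) l
      - mapCoeff gr F.base.linear F.base.linear_mem (B' l - B l)) := by
    intro l
    have e2 := cod_lead (r := ħ ^ (w + 1 - l.length + 1)) hΦ' (p := B)
      (η := fun l => B' l - B l) (f := B') h.nil_left (by simp [h.nil_left, h'.nil_left])
      h'.nil_left l (fun q hq => (hB q).mono (by omega))
    rw [← pull_sub_pull hΦ' h.nil_left h'.nil_left] at e2
    exact e2.trans_sub ((div_linear_sub hΦ' hlin (hB l)).mono (by omega))
  have hdp' : ∀ l, Div (ħ ^ (w - l.length + 1)) (pull B' (F'.lift.op (parS hV)) l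
      - pull B (F'.lift.op (parS hV)) l) := fun l =>
    ((hdp l).mono (by omega)).of_sub_left ((hB l).map _)
  have hη : ∀ l, Div (ħ ^ (w - l.length + 1)) (-C' l - -C l) := fun l => by
    have := (hC l).neg
    rwa [neg_sub, ← neg_sub_neg] at this
  have hp0 : npar hW (pull B (F'.lift.op (parS hV)) []) = 0 := by
    simp [pull, hΦ0']
  have hp0' : npar hW (pull B' (F'.lift.op (parS hV)) []) = 0 := by
    simp [pull, hΦ0']
  have e3 := div_cod_sub_cod (r := ħ ^ (w + 1 - l.length + 1)) hM
    (p := fun l => npar hW (pull B (F'.lift.op (parS hV)) l))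
    (p' := fun l => npar hW (pull B' (F'.lift.op (parS hV)) l)) (η := fun l => -C l)
    (f := F.lift.op (parS hV)) hp0 hp0' (by simp [h.nil_right]) hΦ0 l (fun q hq => by
      have := ((hdp' q).map (npar hW)).mono (a := w + 1 - l.length + 1) (by omega)
      rwa [map_sub] at this)
  have e4 := cod_lead (r := ħ ^ (w + 1 - l.length + 1)) hM
    (p := fun l => npar hW (pull B' (F'.lift.op (parS hV)) l)) (η := fun l => -C' l - -C l)
    (f := F.lift.op (parS hV)) hp0' (by simp [h.nil_right, h'.nil_right]) hΦ0 l
    (fun q hq => (hη q).mono (by omega))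
  have e5 := cod_add_mid hM (p := fun l => npar hW (pull B' (F'.lift.op (parS hV)) l))
    (η := fun l => -C' l - -C l) (χ := fun l => -C l) (f := F.lift.op (parS hV)) hp0'
    (by simp [h.nil_right, h'.nil_right]) (by simp [h.nil_right]) hΦ0 l
  simp only [sub_add_cancel] at e5
  rw [eq_sub_of_add_eq e5.symm, Xh.alg.op_one] at e4
  have e6 := div_coder_of_minimal (e := npar hV) (D.minimal hmin hV)
    (h'.multiLin_right.neg.sub h.multiLin_right.neg) hη l
  rw [coder_sub] at e6
  have e7 := (((hdp l).add e3).add e4).add e6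
  have e8 := e7.neg
  convert e8 using 1
  simp only [homotopyDefect, map_sub, map_neg]
  abel

/-- The counterpart of `AdmissibleOp.div_square_and_closed`, with the defect `K` of `B` as a
morphism in place of the square. The identity `homotopy_coder` is applied to the structure `M`
itself; as all the given structures square to zero and `Φ` is a morphism, its leading terms are `m₁
(E l)` and `Φ' [K l]`. -/
theorem AdmissibleHomotopy.div_defect_and_closed (h : AdmissibleHomotopy (s := s) hV hW Z B C)
    (hmin : H.m 1 = 0) (hf : F.base.IsQuasiIso) (hF : F'.base = F.base) (w : ℕ)
    (hE : ∀ l, Div (ħ ^ (w - l.length + 1)) (homotopyDefect F F' hV hW B C l))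
    (l : List (BgrSeries gr)) (hl : l.length ≤ w) :
    Div (ħ ^ (w - l.length + 1 + 1)) (pull B (D'.alg.op (parS hV)) l
        - coder (npar hV) (D.alg.op (parS hV)) B l) ∧
      Div (ħ ^ (w - l.length + 1 + 1)) (Xh.alg.d (homotopyDefect F F' hV hW B C l)) := by
  set E := homotopyDefect F F' hV hW B C with hEdef
  set M := Xh.alg.op (parS hW) with hMdef
  set Φ := F.lift.op (parS hV) with hΦdef
  set Φ' := F'.lift.op (parS hV) with hΦdef'
  set m := D.alg.op (parS hV) with hmdef
  set m' := D'.alg.op (parS hV) with hmdef'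
  set p := pull B Φ' with hpdef
  set K := fun l => pull B m' l - coder (npar hV) m B l with hKdef
  have hM : MultiLin (Polynomial k) M := Xh.alg.multiLin_op _
  have hΦ : MultiLin (Polynomial k) Φ := F.lift.multiLin_op _
  have hΦ' : MultiLin (Polynomial k) Φ' := F'.lift.multiLin_op _
  have hm : MultiLin (Polynomial k) m := D.alg.multiLin_op _
  have hm' : MultiLin (Polynomial k) m' := D'.alg.multiLin_op _
  have hp : MultiLin (Polynomial k) p := h.multiLin_left.pull hΦ'
  have hΦ0 : Φ [] = 0 := F.lift.op_nil _
  have hΦ0' : Φ' [] = 0 := F'.lift.op_nil _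
  have hp0 : p [] = 0 := hΦ0'
  have hK0 : K [] = 0 := by
    simp [hKdef, pull, cod, hmdef', D'.alg.op_nil (parS hV)]
  have hBo : ∀ l, B (l.map (npar hV)) = npar hV (B l) :=
    h.homog_left.odd (totalDeg_typ s) (by rw [totalDeg_typ]; exact odd_one) h.multiLin_left
      hV.series hV.series
  have hpo : ∀ l, p (l.map (npar hV)) = npar hW (p l) :=
    (h.homog_pull (F' := F')).odd (totalDeg_typ s) (by rw [totalDeg_typ]; exact odd_one) hp
      hV.series hW.series
  have hCe : ∀ l, -C (l.map (npar hV)) = -npar hW (-C l) :=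
    h.homog_right.neg.even (totalDeg_typ s) (by rw [sub_self]; exact Even.zero)
      h.multiLin_right.neg hV.series hW.series
  -- Since `Φ'` is a morphism, the defect of the composite `p` comes from `B` alone.
  have hκ : ∀ l, pull p M l - coder (npar hV) m p l
      = cod (fun l => npar hV (B l)) K B Φ' l := by
    intro l
    have h1 := pull_coder (eV := npar hV) (eW := npar hV) (m' := m) (D'.alg.op_nil (parS hV))
      h.nil_left h.multiLin_left hBo hΦ' l
    rw [hpdef, ← pull_pull hΦ0' hM, show pull Φ' M = coder (npar hV) m' Φ' from
      funext (F'.lift.pull_op hV.series hW.series), h1, add_sub_cancel_left]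
  have hκl : ∀ l, (∀ q : List (BgrSeries gr), q.length < l.length →
      Div (ħ ^ (w - l.length + 1 + 1)) (K q)) → Div (ħ ^ (w - l.length + 1 + 1))
        (pull p M l - coder (npar hV) m p l - Φ' [K l]) := fun l hq => by
    rw [hκ]
    exact cod_lead hΦ' (by simp [h.nil_left]) hK0 h.nil_left l hq
  induction hn : l.length using Nat.strong_induction_on generalizing l with
  | _ n ih =>
  subst hn
  have hKq : ∀ q : List (BgrSeries gr), q.length < l.length →
      Div (ħ ^ (w - l.length + 1 + 1)) (K q) := fun q hq =>
    ((ih q.length hq q (by omega) rfl).1).mono (by omega)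
  have hκq : ∀ q : List (BgrSeries gr), q.length < l.length →
      Div (ħ ^ (w - l.length + 1 + 1)) (npar hW (pull p M q - coder (npar hV) m p q)) :=
    fun q hq => by
      have h1 := (ih q.length hq q (by omega) rfl).1.multiLin hΦ' [] []
      exact (((hκl q fun q' hq' => (((ih q'.length (hq'.trans hq) q' (by omega) rfl).1).mono
        (by omega))).of_sub_left h1).mono (by omega)).map _
  obtain ⟨S, _, _, ι, ev, hev⟩ := exists_universal hM
  have hR := homotopy_coder (eV := npar hV) (eW := npar hW) hev (m := M) (m' := m) (p := p)
    (η := fun l => -C l) (f := Φ) (Xh.alg.op_nil _) hp0 (by simp [h.nil_right]) hΦ0 hM hp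
    h.multiLin_right.neg hΦ hW.series.neg_invol (Xh.alg.op_even hW.series) hpo hCe
    (F.lift.op_odd hV.series hW.series) (F.lift.pull_op hV.series hW.series) l
  -- The homotopy component uses up at least one entry, so the defect of `p` enters here on shorter
  -- lists only.
  have e1 : Div (ħ ^ (w - l.length + 1 + 1)) (ev ((geom ι p
      * lft ι (fun l => npar hW (pull p M l - coder (npar hV) m p l))
      * (geom ι (fun l => npar hW (p l)) * lft ι (fun l => -C l) * geom ι Φ)) l)) := by
    refine div_ev_mul_of_nil ι ev _ _ ?_ l hκq
    simp [Conv.mul_nil, lft, h.nil_right]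
  have e2 := cod_lead (r := ħ ^ (w - l.length + 1 + 1)) hM (p := p) (η := E) (f := Φ) hp0 homotopyDefect_nil
    hΦ0 l (fun q hq => (hE q).mono (by omega))
  have e3 := div_coder_of_minimal (e := npar hV) (D.minimal hmin hV) h.multiLin hE l
  have e4 := hκl l hKq
  have hmm : coder (npar hV) m (coder (npar hV) m fun l => -C l) l = 0 := by
    rw [coder_coder (D.alg.op_nil _) hm hV.series.neg_invol (D.alg.op_even hV.series)
      h.multiLin_right.neg, show coder (npar hV) m m = fun _ => 0 from
      funext (D.alg.coder_op hV.series)]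
    exact cod_zero_mid h.multiLin_right.neg rfl rfl l
  have hcE : coder (npar hV) m E l = coder (npar hV) m Φ l - coder (npar hV) m p l
      - coder (npar hV) m (cod (fun l => npar hW (p l)) (fun l => -C l) Φ M) l := by
    have : E = fun l => (fun l => (fun l => Φ l - p l) l
        - cod (fun l => npar hW (p l)) (fun l => -C l) Φ M l) l
        - coder (npar hV) m (fun l => -C l) l := rfl
    rw [this, coder_sub, coder_sub, coder_sub, hmm, sub_zero]
  have hMM : cod (fun l => npar hW (p l)) (fun l => -C l) Φ (coder (npar hW) M M) l = 0 := by
    rw [show coder (npar hW) M M = fun _ => 0 from funext (Xh.alg.coder_op hW.series), cod_zero]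
  have hΦM : pull Φ M l = coder (npar hV) m Φ l := F.lift.pull_op hV.series hW.series l
  have h4 : Div (ħ ^ (w - l.length + 1 + 1)) (Xh.alg.d (E l) + Φ' [K l]) := by
    rw [hMM, hΦM] at hR
    rw [hMdef, Xh.alg.op_one, ← hMdef] at e2
    have e5 := ((e3.mono (a := w - l.length + 1 + 1) (by omega)).sub e4).sub (e2.add e1)
    convert e5 using 1
    have hE' : (fun l => Φ l - p l - cod (fun l => npar hW (p l)) (fun l => -C l) Φ M l
        - coder (npar hV) m (fun l => -C l) l) = E := rfl
    rw [hE'] at hR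
    rw [hcE, ← sub_eq_zero, ← neg_eq_zero]
    rw [← sub_eq_zero] at hR
    rw [← hR]
    abel
  exact div_of_apply_add Xh hmin hf hΦ' (fun x => by rw [hΦdef', F'.coeff_op_one, hF]) (hE l) h4

end uniqueness

/-! ### The identity morphism -/

section identity

variable {k : Type u} {R : Type v} [CommRing k] [CommRing R]
  {V : Type w} [AddCommGroup V] [Module k V] [Module R V] {gr : ℤ × ℤ → Submodule k V}
  {s : ℕ} {e : V →ₗ[R] V}

theorem multiLin_proj : MultiLin R (proj V) := multiLin_single LinearMap.id

/-- The identity morphism. -/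
noncomputable def Hom.refl (X : Algebra k R gr s) (he : IsGrading gr e) : Hom X X :=
  Hom.ofOp he he (f := proj V) multiLin_proj rfl (homog_single fun _ _ h => h) fun l => by
    rw [pull_proj_left (X.multiLin_op e), coder, cod_proj (X.op_nil e)]

theorem Hom.op_refl (X : Algebra k R gr s) (he : IsGrading gr e) :
    (Hom.refl X he).op e = proj V := Hom.ofOp_op _ _ _ _ _ _

theorem Hom.linear_refl (X : Algebra k R gr s) (he : IsGrading gr e) (x : V) :
    (Hom.refl X he).linear x = x := by
  rw [← Hom.op_one _ e, Hom.op_refl]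
  rfl

theorem Hom.isQuasiIso_refl (X : Algebra k R gr s) (he : IsGrading gr e) :
    (Hom.refl X he).IsQuasiIso := by
  refine ConeExact.isQuasiIsoMap (fun x y _ h => ⟨y, 0, ?_, ?_⟩) fun x => ?_
  · rw [← h, Hom.linear_refl]
  · rw [Hom.linear_refl, map_zero, add_zero]
  · rw [Hom.linear_refl, Hom.linear_refl]

end identity

/-! ### Uniqueness of the deformation -/

section uniqueness

variable {k : Type u} [CommRing k]
  {V : Type w} [AddCommGroup V] [Module k V] {gr : ℤ × ℤ → Submodule k V}
  {W : Type w} [AddCommGroup W] [Module k W] {gr' : ℤ × ℤ → Submodule k W}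
  {s : ℕ} {eV : V →ₗ[k] V} {eW : W →ₗ[k] W}

variable {X : Algebra k k gr' s} {Xh : FormalDeformation X} {H : Algebra k k gr s}
  {D D' : FormalDeformation H} {F : DeformationHom D Xh} {F' : DeformationHom D' Xh}
  {hV : IsGrading gr eV} {hW : IsGrading gr' eW} {Z : List V → Prop}

theorem solvable_homotopyDefect (hmin : H.m 1 = 0) (hf : F.base.IsQuasiIso)
    (hF : F'.base = F.base)
    (hZ : ∀ B C, AdmissibleHomotopy (s := s) hV hW Z B C → ∀ l, Z l →
      homotopyDefect F F' hV hW B C (l.map (constLin hV.span)) = 0) :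
    Solvable gr gr' hV.span hW.span (typ s) (typ s) (typ s) Z (proj V) (fun _ => (0 : W))
      F.base.linear X.d (mapCoeff gr F.base.linear F.base.linear_mem) Xh.alg.d
      (homotopyDefect F F' hV hW) where
  multiLin B C h := AdmissibleHomotopy.multiLin h
  homog B C h := AdmissibleHomotopy.homog h
  nil B C _ := homotopyDefect_nil
  coeff_zero B C h l := AdmissibleHomotopy.coeff_zero h hF _
  mem := hZ
  lead B C h B' C' h' w hB hC l := AdmissibleHomotopy.lead h h' hmin hF w hB hC l
  closed B C h w hE l hl := (AdmissibleHomotopy.div_defect_and_closed h hmin hf hF w hE l hl).2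
  red_left x := coeff_mapCoeff _ _ _ _
  red_right x := Xh.reduces 1 _
  exact a ha := by
    obtain ⟨z, y, -, hy⟩ := hf.coneExact 0 a (map_zero _) (by rw [map_zero, ha])
    exact ⟨z, -y, by rw [hy, map_neg, sub_neg_eq_add]⟩
  left_mem := F.base.linear_mem
  right_mem := X.d_mem

/-- Two deformations with lifts of the same quasi-isomorphism are related by a deformation of the
identity. -/
theorem exists_deformation_refl [Module.Projective k V] (hgr : DirectSum.IsInternal gr)
    (hgr' : DirectSum.IsInternal gr') (hmin : H.m 1 = 0) (hf : F.base.IsQuasiIso)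
    (hF : F'.base = F.base)
    (hZ : ∀ B C, AdmissibleHomotopy (s := s) hV hW Z B C → ∀ l, Z l →
      homotopyDefect F F' hV hW B C (l.map (constLin hV.span)) = 0)
    {P : V →ₗ[k] V} (hP : ∀ d, ∀ x ∈ gr d, P x ∈ gr d)
    (hPe : ∀ e : List V → W, MultiLin k e → (∀ l, Z l → e l = 0) → ∀ l, e (l.map P) = e l)
    (hPZ : ∀ l, Z l → (0 : V) ∈ l.map P) :
    ∃ (G : DeformationHom D D') (C : List (BgrSeries gr) → BgrSeries gr'),
      G.base = Hom.refl H hV ∧ AdmissibleHomotopy (s := s) hV hW Z (G.lift.op (parS hV)) C := by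
  obtain ⟨π, hπ⟩ := exists_isProj hgr
  obtain ⟨π', hπ'⟩ := exists_isProj hgr'
  obtain ⟨B, C, h, hE⟩ := (solvable_homotopyDefect hmin hf hF hZ).exists_solution hV.span hW.span
    hπ hπ' hP hPe hPZ multiLin_proj (homog_single fun _ _ h => h) rfl MultiLin.zero
    (fun _ _ _ => Submodule.zero_mem _) rfl
  -- As for the square before: with the homotopy equation solved, the defect of `B` is divisible by
  -- every power of `ħ`.
  have hK : ∀ l, pull B (D'.alg.op (parS hV)) l = coder (npar hV) (D.alg.op (parS hV)) B l :=
    fun l => sub_eq_zero.1 <| eq_zero_of_div fun j => by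
      refine (AdmissibleHomotopy.div_defect_and_closed (hW := hW) h hmin hf hF (l.length + j) (fun q => ?_) l
        (by omega)).1.mono (by omega)
      rw [hE]
      exact Div.zero
  let G : Hom D.alg D'.alg :=
    Hom.ofOp hV.series hV.series h.multiLin_left h.nil_left h.homog_left hK
  have hG : G.op (parS hV) = B := Hom.ofOp_op _ _ _ _ _ _
  refine ⟨⟨Hom.refl H hV, G, fun n a => ?_⟩, C, rfl, ?_⟩
  · have h1 : G.f n a = B (twist (parS hV) (List.ofFn a)) := rfl
    have h2 : ∀ b : Fin n → V, (Hom.refl H hV).f n b = proj V (twist eV (List.ofFn b)) :=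
      fun b => rfl
    rw [h1, h2, ← coeff_zero, h.coeff_left,
      twist_map (e := parS hV) (e' := eV) (c := coeff gr 0) fun x => rfl, List.map_ofFn]
    rfl
  · change AdmissibleHomotopy (s := s) hV hW Z (G.op (parS hV)) C
    rw [hG]
    exact h

end uniqueness

/-! ### Strict units -/

section unit

variable {R V W U : Type*} [CommRing R] [AddCommGroup V] [Module R V] [AddCommGroup W] [Module R W]
  [AddCommGroup U] [Module R U] {u : V} {v : W} {w : U}

/-- The condition of strict unitarity for suspended components of morphisms. -/
structure UnitalMap (f : List V → W) (u : V) (v : W) : Prop where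
  one : f [u] = v
  other : ∀ p q, p ++ q ≠ [] → f (p ++ u :: q) = 0

theorem unitalMap_of_mem {f : List V → W} (h1 : f [u] = v)
    (h : ∀ l, u ∈ l → 2 ≤ l.length → f l = 0) : UnitalMap f u v where
  one := h1
  other p q hpq := h _ (by simp) (by
    have := List.length_pos_iff.2 hpq
    rw [List.length_append] at this ⊢
    rw [List.length_cons]; omega)

theorem UnitalMap.mem {f : List V → W} (h : UnitalMap f u v) (l : List V) (hu : u ∈ l)
    (hl : 2 ≤ l.length) : f l = 0 := by
  obtain ⟨p, q, rfl⟩ := List.append_of_mem hu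
  refine h.other p q fun hpq => ?_
  have := congrArg List.length hpq
  rw [List.length_append] at hl this
  rw [List.length_cons] at hl
  rw [List.length_nil] at this
  omega

/-- The unit is a piece by itself, so `g` receives `v` along with the other pieces and vanishes as
soon as there is one. -/
theorem UnitalMap.pull {f : List V → W} (hf : UnitalMap f u v) {g : List W → U}
    (hg : UnitalMap g v w) (hgm : MultiLin R g) : UnitalMap (pull f g) u w := by
  have key : ∀ p q, AInf.pull f g (p ++ u :: q)
      = AInf.pull f (fun l₁ => AInf.pull f (fun l₂ => g (l₁ ++ v :: l₂)) q) p := fun p q =>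
    pull_unit hf.one hf.other q p hgm
  refine ⟨?_, fun p q hpq => ?_⟩
  · exact (key [] []).trans hg.one
  · rw [key]
    cases p with
    | nil =>
      cases q with
      | nil => exact absurd rfl hpq
      | cons x q =>
        exact pull_eq_zero_of_cons x q fun y l => hg.other [] (y :: l) (by simp)
    | cons x p =>
      refine pull_eq_zero_of_cons x p fun y l => ?_
      rw [show (fun l₂ => g ((y :: l) ++ v :: l₂)) = fun _ => 0 from
        funext fun l₂ => hg.other (y :: l) l₂ (by simp)]
      exact pull_zero f q

theorem UnitalOp.mem {e : V → V} {m : List V → V} (h : UnitalOp e m u) (l : List V) (hu : u ∈ l)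
    (hl : 3 ≤ l.length) : m l = 0 := by
  obtain ⟨p, q, rfl⟩ := List.append_of_mem hu
  refine h.other p q ?_
  rw [List.length_append, List.length_cons] at hl
  omega

/-- The equation of a morphism holds on lists that contain the strict unit. -/
theorem pull_eq_coder_of_unit {e : V →ₗ[R] V} {e' : W →ₗ[R] W} {m : List V → V} {m' : List W → W}
    (hm' : MultiLin R m') (hmu : UnitalOp e m u) (hmv : UnitalOp e' m' v) {f : List V → W}
    (hf : MultiLin R f) (hf0 : f [] = 0) (hfe : ∀ l, f (l.map e) = e' (f l))
    (hfu : UnitalMap f u v) (p q : List V) :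
    AInf.pull f m' (p ++ u :: q) = coder e m f (p ++ u :: q) := by
  rw [pull_unit_op hm' hmv hf0 hfu.one hfu.other]
  cases p with
  | nil =>
    rw [List.nil_append, coder_unit_left hmu hf hfu.other]
    by_cases hq : q = []
    · simp [hq, hf0]
    · simp [hq]
  | cons x p =>
    rw [coder_unit hmu q _ hf hfu.other (by simp), hfe]
    by_cases hq : q = [] <;> simp [hq]

/-- The equation of a homotopy holds on lists that contain the strict unit. -/
theorem cod_add_coder_of_unit {e : V →ₗ[R] V} {e' : W →ₗ[R] W} {m : List V → V}
    {m' : List W → W} (hm' : MultiLin R m') (hmu : UnitalOp e m u) (hmv : UnitalOp e' m' v)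
    {p' η f : List V → W} (hη : MultiLin R η) (hη0 : η [] = 0)
    (hηe : ∀ l, η (l.map e) = -e' (η l)) (hηu : ∀ p q, η (p ++ u :: q) = 0)
    (hfu : UnitalMap f u v) (hpu : UnitalMap p' u (-v)) (p q : List V) :
    cod p' η f m' (p ++ u :: q) + coder e m η (p ++ u :: q) = 0 := by
  rw [cod_unit_op hm' hmv hη0 hfu.one hfu.other hpu.one hpu.other hηu]
  cases p with
  | nil =>
    rw [List.nil_append, coder_unit_left hmu hη fun p q _ => hηu p q]
    by_cases hq : q = [] <;> simp [hq, hη0]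
  | cons x p =>
    rw [coder_unit hmu q _ hη (fun p q _ => hηu p q) (by simp), hηe]
    by_cases hq : q = [] <;> simp [hq]

end unit

/-! ### Strict units of series -/

section series

variable {k : Type u} [CommRing k]
  {V : Type w} [AddCommGroup V] [Module k V] {gr : ℤ × ℤ → Submodule k V}
  {W : Type w} [AddCommGroup W] [Module k W] {gr' : ℤ × ℤ → Submodule k W}
  {eV : V →ₗ[k] V} {u : V} {v : W}

theorem mapCoeff_constLin (hV : IsGrading gr eV) (x : V) :
    parS hV (constLin hV.span x) = constLin hV.span (eV x) := by
  refine coeff_ext fun N => ?_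
  rw [coeff_mapCoeff]
  cases N with
  | zero => rfl
  | succ N => rw [coeff_constLin_succ, coeff_constLin_succ, map_zero]

theorem linear_ext_of_const (hs : ⨆ d, gr d = ⊤) {M M' : BgrSeries gr →ₗ[Polynomial k] BgrSeries gr'}
    (h : ∀ x, M (constLin hs x) = M' (constLin hs x)) (x : BgrSeries gr) : M x = M' x := by
  refine (multiLin_single M).eq_of_const hs (multiLin_single M') (fun l => ?_) [x]
  match l with
  | [] => rfl
  | [x] => exact h x
  | _ :: _ :: _ => rfl

/-- A multilinear function on lists as a linear function of one entry. -/
def MultiLin.toLinear {R V W : Type*} [CommRing R] [AddCommGroup V] [Module R V] [AddCommGroup W]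
    [Module R W] {θ : List V → W} (h : MultiLin R θ) (p q : List V) : V →ₗ[R] W where
  toFun x := θ (p ++ x :: q)
  map_add' := h.map_add p q
  map_smul' := h.map_smul p q

/-- Each unit condition is a multilinear identity over `k[ħ]`, hence determined by constant series.
-/
theorem UnitalOp.of_const (hV : IsGrading gr eV) {m : List V → V} (hm : UnitalOp (-eV) m u)
    {B : List (BgrSeries gr) → BgrSeries gr} (hB : MultiLin (Polynomial k) B)
    (h : ∀ l, u ∈ l → B (l.map (constLin hV.span)) = constLin hV.span (m l)) :
    UnitalOp (npar hV) B (constLin hV.span u) where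
  parity := by
    have h1 := hm.parity
    rw [LinearMap.neg_apply, neg_inj] at h1
    rw [LinearMap.neg_apply, mapCoeff_constLin, h1]
  one := by
    have h1 := h [u] (by simp)
    rw [hm.one, map_zero] at h1
    exact h1
  left x := linear_ext_of_const hV.span (M := hB.toLinear [constLin hV.span u] [])
    (M' := LinearMap.id) (fun x => by
      have h1 := h [u, x] (by simp)
      rw [hm.left] at h1
      exact h1) x
  right x := linear_ext_of_const hV.span (M := hB.toLinear [] [constLin hV.span u])
    (M' := -npar hV) (fun x => by
      have h1 := h [x, u] (by simp)
      rw [hm.right, LinearMap.neg_apply, neg_neg] at h1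
      rw [LinearMap.neg_apply, LinearMap.neg_apply, neg_neg, mapCoeff_constLin]
      exact h1) x
  other p q hpq := hB.eq_zero_of_const_mem hV.span u (fun n => 3 ≤ n)
    (fun l hl hn => by rw [h l hl, hm.mem l hl hn, map_zero]) _ (by simp) (by
      rw [List.length_append, List.length_cons]; omega)

theorem UnitalMap.of_const (hs : ⨆ d, gr d = ⊤) (hs' : ⨆ d, gr' d = ⊤) {f : List V → W}
    (hf : UnitalMap f u v) {C : List (BgrSeries gr) → BgrSeries gr'}
    (hC : MultiLin (Polynomial k) C)
    (h : ∀ l, u ∈ l → C (l.map (constLin hs)) = constLin hs' (f l)) :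
    UnitalMap C (constLin hs u) (constLin hs' v) := by
  refine unitalMap_of_mem ?_ fun l hu hl => ?_
  · have h1 := h [u] (by simp)
    rw [hf.one] at h1
    exact h1
  · exact hC.eq_zero_of_const_mem hs u (fun n => 2 ≤ n)
      (fun l hl hn => by rw [h l hl, hf.mem l hl hn, map_zero]) l hu hl

end series

/-! ### The projection along a strict unit -/

section projection

variable {k : Type u} [CommRing k] {V : Type w} [AddCommGroup V] [Module k V]
  {gr : ℤ × ℤ → Submodule k V}

/-- Subtracting a multiple of `u` from an entry changes the value by a multiple of a value at a list
through `u`, which is zero. -/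
theorem MultiLin.map_sub_smul {W : Type*} [AddCommGroup W] [Module k W] {u : V} {lam : V →ₗ[k] k}
    {e : List V → W} (he : MultiLin k e) (h : ∀ l, u ∈ l → e l = 0) (l : List V) :
    e (l.map (LinearMap.id - lam.smulRight u : V →ₗ[k] V)) = e l := by
  suffices H : ∀ q p, e (p ++ q.map (LinearMap.id - lam.smulRight u : V →ₗ[k] V)) = e (p ++ q) from
    H l []
  intro q
  induction q with
  | nil => intro p; rfl
  | cons x q ih =>
    intro p
    rw [List.map_cons, LinearMap.sub_apply, he.map_sub, LinearMap.smulRight_apply, he.map_smul,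
      h (p ++ u :: _) (by simp), smul_zero, sub_zero, LinearMap.id_apply]
    have := ih (p ++ [x])
    rwa [List.append_assoc, List.append_assoc] at this

/-- `P x = x - lam (x₀) u`, where `x₀` is the component of bidegree `(0, 0)`; passing to this
component makes `P` homogeneous. For `P u = 0` it suffices that `lam u • u = u`; it is not needed
that `lam u = 1`. -/
theorem Algebra.exists_projection [Module.Projective k V] {s : ℕ} (hgr : DirectSum.IsInternal gr)
    (H : Algebra k k gr s) {u : V} (hu : u ∈ gr (0, 0)) (hH : H.IsStrictUnit u) :
    ∃ P : V →ₗ[k] V, (∀ d, ∀ x ∈ gr d, P x ∈ gr d) ∧ P u = 0 ∧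
      ∀ {W : Type w} [AddCommGroup W] [Module k W] (e : List V → W), MultiLin k e →
        (∀ l, u ∈ l → e l = 0) → ∀ l, e (l.map P) = e l := by
  obtain ⟨π, hπ⟩ := exists_isProj hgr
  have hm := multiLin_ofList H.m
  let μ : V →ₗ[k] V →ₗ[k] V := LinearMap.mk₂ k (fun x y => ofList (fun n => H.m n) [x, y])
    (fun x x' y => hm.map_add [] [y] x x') (fun c x y => hm.map_smul [] [y] c x)
    (fun x y y' => hm.map_add [x] [] y y') (fun c x y => hm.map_smul [x] [] c y)
  obtain ⟨lam, hlam⟩ := exists_unit_form u μ fun x =>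
    (ofList_ofFn (fun n => H.m n) 2 ![u, x]).trans (hH.1 x)
  refine ⟨LinearMap.id - (lam ∘ₗ π (0, 0)).smulRight u, fun d x hx => ?_, ?_,
    fun e he h l => he.map_sub_smul h l⟩
  · rw [LinearMap.sub_apply, LinearMap.smulRight_apply, LinearMap.comp_apply]
    refine Submodule.sub_mem _ hx ?_
    by_cases hd : d = (0, 0)
    · subst hd
      exact Submodule.smul_mem _ _ hu
    · rw [hπ.ne _ _ (Ne.symm hd) x hx, map_zero, zero_smul]
      exact Submodule.zero_mem _
  · rw [LinearMap.sub_apply, LinearMap.smulRight_apply, LinearMap.comp_apply, hπ.same _ _ hu, hlam,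
      LinearMap.id_apply, sub_self]

end projection

section components

variable {k : Type u} {R : Type v} [CommRing k] [CommRing R]
  {V : Type w} [AddCommGroup V] [Module k V] [Module R V] {gr : ℤ × ℤ → Submodule k V}
  {W : Type w} [AddCommGroup W] [Module k W] [Module R W] {gr' : ℤ × ℤ → Submodule k W}
  {s : ℕ} {X : Algebra k R gr s} {Y : Algebra k R gr' s} {e : V →ₗ[R] V} {u : V} {v : W}

theorem Hom.IsUnital.unitalMap {f : Hom X Y} (hf : f.IsUnital u v) (heu : e u = u) :
    UnitalMap (f.op e) u v :=
  unitalMap_of_mem (f.op_unit hf) (f.op_mem hf heu)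

theorem Hom.isUnital_of_unitalMap {f : Hom X Y} (he : IsGrading gr e) (heu : e u = u)
    (h : UnitalMap (f.op e) u v) : f.IsUnital u v :=
  f.isUnital_of_op he heu h.one h.mem

theorem unitalMap_proj {V : Type*} [AddCommGroup V] (u : V) : UnitalMap (proj V) u u where
  one := rfl
  other p q hpq := by
    match p, q with
    | [], [] => exact absurd rfl hpq
    | [], _ :: _ => rfl
    | [_], _ => rfl
    | _ :: _ :: _, _ => rfl

end components

/-! ### Strictly unitary existence and uniqueness -/

section unital

variable {k : Type u} [CommRing k]
  {V : Type w} [AddCommGroup V] [Module k V] {gr : ℤ × ℤ → Submodule k V}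
  {W : Type w} [AddCommGroup W] [Module k W] {gr' : ℤ × ℤ → Submodule k W}
  {s : ℕ} {eV : V →ₗ[k] V} {eW : W →ₗ[k] W}
  {X : Algebra k k gr' s} {Xh : FormalDeformation X} {H : Algebra k k gr s} {f : Hom H X}
  {hV : IsGrading gr eV} {hW : IsGrading gr' eW} {u : V} {v : W}
  {B : List (BgrSeries gr) → BgrSeries gr} {C : List (BgrSeries gr) → BgrSeries gr'}

theorem IsGrading.apply_const_unit (hV : IsGrading gr eV) (hu : u ∈ gr (0, 0)) :
    parS hV (constLin hV.span u) = constLin hV.span u := by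
  rw [mapCoeff_constLin, hV.apply_unit hu]

theorem AdmissibleOp.unitalOp (h : AdmissibleOp X H f hV hW (fun l => u ∈ l) B C)
    (hu : u ∈ gr (0, 0)) (hH : H.IsStrictUnit u) :
    UnitalOp (npar hV) B (constLin hV.span u) :=
  UnitalOp.of_const hV (H.unitalOp hH (hV.apply_unit hu)) h.multiLin_left h.const_left

theorem AdmissibleOp.unitalMap (h : AdmissibleOp X H f hV hW (fun l => u ∈ l) B C)
    (hu : u ∈ gr (0, 0)) (hf : f.IsUnital u v) :
    UnitalMap C (constLin hV.span u) (constLin hW.span v) :=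
  UnitalMap.of_const hV.span hW.span (hf.unitalMap (hV.apply_unit hu)) h.multiLin_right
    h.const_right

/-- Admissibility fixes `B` and `C` on lists through the unit and so makes them strictly unitary;
the morphism equation then holds there by itself. -/
theorem morphismDefect_eq_zero_of_mem (hu : u ∈ gr (0, 0)) (hv : v ∈ gr' (0, 0))
    (hXh : Xh.alg.IsStrictUnit (constLin hW.span v)) (hH : H.IsStrictUnit u)
    (hf : f.IsUnital u v) (B : List (BgrSeries gr) → BgrSeries gr)
    (C : List (BgrSeries gr) → BgrSeries gr')
    (h : AdmissibleOp X H f hV hW (fun l => u ∈ l) B C) (l : List V) (hl : u ∈ l) :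
    morphismDefect X Xh hV hW B C (l.map (constLin hV.span)) = 0 := by
  obtain ⟨p, q, rfl⟩ := List.append_of_mem hl
  rw [List.map_append, List.map_cons]
  exact sub_eq_zero.2 (pull_eq_coder_of_unit (Xh.alg.multiLin_op _) (h.unitalOp hu hH)
    (Xh.alg.unitalOp hXh (hW.apply_const_unit hv)) h.multiLin_right h.nil_right h.odd
    (h.unitalMap hu hf) _ _)

/-- Existence of a strictly unital deformation with a strictly unital lift. -/
theorem exists_unital_deformation [Module.Projective k V] (hgr : DirectSum.IsInternal gr)
    (hgr' : DirectSum.IsInternal gr') (hmin : H.m 1 = 0) (hqf : f.IsQuasiIso)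
    (eH : gr (0, 0)) (e : gr' (0, 0)) (hXh : Xh.PreservesUnit e) (hH : H.IsStrictUnit (eH : V))
    (hf : f.IsUnital (eH : V) (e : W)) :
    ∃ (D : FormalDeformation H) (F : DeformationHom D Xh),
      D.PreservesUnit eH ∧ F.IsUnital eH e ∧ F.base = f := by
  obtain ⟨eV, hV⟩ := exists_isGrading hgr
  obtain ⟨eW, hW⟩ := exists_isGrading hgr'
  obtain ⟨P, hP, hPu, hPe⟩ := H.exists_projection hgr eH.2 hH
  obtain ⟨D, F, hF, h⟩ := exists_deformation (hV := hV) (hW := hW) (Z := fun l => (eH : V) ∈ l) Xh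
    hgr hgr' hmin hqf (morphismDefect_eq_zero_of_mem eH.2 e.2 hXh hH hf) hP hPe
    fun l hl => List.mem_map.2 ⟨_, hl, hPu⟩
  exact ⟨D, F, D.alg.isStrictUnit_of_op hV.series (hV.apply_const_unit eH.2) (h.unitalOp eH.2 hH),
    ⟨hF ▸ hf, Hom.isUnital_of_unitalMap hV.series (hV.apply_const_unit eH.2)
      (h.unitalMap eH.2 hf)⟩, hF⟩

variable {D D' : FormalDeformation H} {F : DeformationHom D Xh} {F' : DeformationHom D' Xh}

theorem AdmissibleHomotopy.unitalMap
    (h : AdmissibleHomotopy (s := s) hV hW (fun l => u ∈ l) B C) :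
    UnitalMap B (constLin hV.span u) (constLin hV.span u) :=
  UnitalMap.of_const hV.span hV.span (unitalMap_proj u) h.multiLin_left h.const_left

/-- Both lifts being strictly unitary, `F` and the composite agree on lists through the unit; `C`
vanishes there, and the two homotopy terms cancel. -/
theorem homotopyDefect_eq_zero_of_mem (hu : u ∈ gr (0, 0)) (hv : v ∈ gr' (0, 0))
    (hXh : Xh.alg.IsStrictUnit (constLin hW.span v)) (hD : D.alg.IsStrictUnit (constLin hV.span u))
    (hF : F.lift.IsUnital (constLin hV.span u) (constLin hW.span v))
    (hF' : F'.lift.IsUnital (constLin hV.span u) (constLin hW.span v))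
    (B : List (BgrSeries gr) → BgrSeries gr) (C : List (BgrSeries gr) → BgrSeries gr')
    (h : AdmissibleHomotopy (s := s) hV hW (fun l => u ∈ l) B C) (l : List V) (hl : u ∈ l) :
    homotopyDefect F F' hV hW B C (l.map (constLin hV.span)) = 0 := by
  have heu := hV.apply_const_unit hu
  have hev := hW.apply_const_unit hv
  have hΦ := hF.unitalMap heu
  have hp := (AdmissibleHomotopy.unitalMap h).pull (hF'.unitalMap heu)
    (F'.lift.multiLin_op (parS hV))
  have hp' : UnitalMap (fun l => npar hW (pull B (F'.lift.op (parS hV)) l)) (constLin hV.span u)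
      (-constLin hW.span v) :=
    ⟨by rw [hp.one, LinearMap.neg_apply, hev], fun p q hpq => by rw [hp.other p q hpq, map_zero]⟩
  have hC : ∀ p q, -C (p ++ constLin hV.span u :: q) = 0 := fun p q => by
    rw [neg_eq_zero]
    refine h.multiLin_right.eq_zero_of_const_mem hV.span u (fun _ => True) (fun l hl _ => ?_) _
      (by simp) trivial
    rw [h.const_right l hl, map_zero]
  have hCe : ∀ l, -C (l.map (npar hV)) = -npar hW (-C l) :=
    h.homog_right.neg.even (totalDeg_typ s) (by rw [sub_self]; exact Even.zero)
      h.multiLin_right.neg hV.series hW.series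
  obtain ⟨p, q, rfl⟩ := List.append_of_mem hl
  rw [List.map_append, List.map_cons]
  have key := cod_add_coder_of_unit (Xh.alg.multiLin_op (parS hW)) (D.alg.unitalOp hD heu)
    (Xh.alg.unitalOp hXh hev) (η := fun l => -C l) h.multiLin_right.neg (by simp [h.nil_right]) hCe
    hC hΦ hp' (p.map (constLin hV.span)) (q.map (constLin hV.span))
  have h2 : F.lift.op (parS hV)
        (p.map (constLin hV.span) ++ constLin hV.span u :: q.map (constLin hV.span))
      = pull B (F'.lift.op (parS hV))
        (p.map (constLin hV.span) ++ constLin hV.span u :: q.map (constLin hV.span)) := by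
    by_cases hpq : p.map (constLin hV.span) ++ q.map (constLin hV.span) = []
    · rw [List.append_eq_nil_iff] at hpq
      rw [hpq.1, hpq.2]
      exact hΦ.one.trans hp.one.symm
    · rw [hΦ.other _ _ hpq, hp.other _ _ hpq]
  rw [homotopyDefect, h2, sub_self, zero_sub, ← neg_add', key, neg_zero]

/-- Two strictly unital deformations with strictly unital lifts of the same quasi-isomorphism are
related by a strictly unital deformation of the identity. -/
theorem exists_unital_deformation_refl [Module.Projective k V] (hgr : DirectSum.IsInternal gr)
    (hgr' : DirectSum.IsInternal gr') (hmin : H.m 1 = 0) (hqf : F.base.IsQuasiIso)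
    (hbase : F'.base = F.base) (eH : gr (0, 0)) (e : gr' (0, 0)) (hXh : Xh.PreservesUnit e)
    (hH : H.IsStrictUnit (eH : V)) (hD : D.PreservesUnit eH) (hF : F.IsUnital eH e)
    (hF' : F'.IsUnital eH e) :
    ∃ G : DeformationHom D D', G.base.IsQuasiIso ∧ G.IsUnital eH eH := by
  obtain ⟨eV, hV⟩ := exists_isGrading hgr
  obtain ⟨eW, hW⟩ := exists_isGrading hgr'
  obtain ⟨P, hP, hPu, hPe⟩ := H.exists_projection hgr eH.2 hH
  obtain ⟨G, C, hG, h⟩ := exists_deformation_refl (hV := hV) (hW := hW)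
    (Z := fun l => (eH : V) ∈ l) hgr hgr' hmin hqf hbase
    (homotopyDefect_eq_zero_of_mem eH.2 e.2 hXh hD hF.2 hF'.2) hP hPe
    fun l hl => List.mem_map.2 ⟨_, hl, hPu⟩
  refine ⟨G, ?_, ?_, ?_⟩
  · rw [hG]; exact Hom.isQuasiIso_refl H hV
  · rw [hG]
    refine Hom.isUnital_of_unitalMap hV (hV.apply_unit eH.2) ?_
    rw [Hom.op_refl]
    exact unitalMap_proj _
  · exact Hom.isUnital_of_unitalMap hV.series (hV.apply_const_unit eH.2)
      (AdmissibleHomotopy.unitalMap h)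

end unital

end AInf

theorem theorem3p1 {k : Type*} [CommRing k] {A : Type*} [AddCommGroup A] [Module k A]
    (gr : ℤ × ℤ → Submodule k A) (hgr : DirectSum.IsInternal gr) (s : ℕ)
    -- the bigraded algebra `A`, with projective cohomology, and its deformation
    (X : AInf.Algebra k k gr s) (hflat : Module.Projective k (AInf.Cohomology X.d))
    (Xh : AInf.FormalDeformation X)
    -- the minimal model on the cohomology and the quasi-isomorphism to `A`
    (H : AInf.Algebra k k (AInf.cohomologyGrading gr X.d) s) (hmin : H.m 1 = 0)
    (f : AInf.Hom H X) (hf : f.IsQuasiIso) :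
    -- existence
    (∃ (D : AInf.FormalDeformation H) (F : AInf.DeformationHom D Xh),
      F.base = f ∧ F.IsQuasiIso) ∧
    -- every lift is a quasi-isomorphism
    (∀ (D : AInf.FormalDeformation H) (F : AInf.DeformationHom D Xh),
      F.base = f → F.IsQuasiIso) ∧
    -- uniqueness up to quasi-isomorphism
    (∀ (D D' : AInf.FormalDeformation H) (F : AInf.DeformationHom D Xh)
      (F' : AInf.DeformationHom D' Xh), F.base = f → F'.base = f →
      ∃ G : AInf.DeformationHom D D', G.IsQuasiIso) ∧
    -- existence and uniqueness in the strictly unitary case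
    (∀ (e : gr (0, 0)) (eH : AInf.cohomologyGrading gr X.d (0, 0)),
      X.IsStrictUnit (e : A) → Xh.PreservesUnit e → H.IsStrictUnit (eH : AInf.Cohomology X.d) →
      f.IsUnital (eH : AInf.Cohomology X.d) (e : A) →
      (∃ (D : AInf.FormalDeformation H) (F : AInf.DeformationHom D Xh),
        D.PreservesUnit eH ∧ F.IsUnital eH e ∧ F.base = f ∧ F.IsQuasiIso) ∧
      (∀ (D D' : AInf.FormalDeformation H) (F : AInf.DeformationHom D Xh)
        (F' : AInf.DeformationHom D' Xh), D.PreservesUnit eH → D'.PreservesUnit eH →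
        F.IsUnital eH e → F'.IsUnital eH e → F.base = f → F'.base = f →
        ∃ G : AInf.DeformationHom D D', G.IsUnital eH eH ∧ G.IsQuasiIso)) := by
  obtain ⟨π, hπ⟩ := AInf.exists_isProj hgr
  -- The differential has bidegree `typ s`, so the induced family of submodules is a bigrading of
  -- the cohomology.
  obtain ⟨π', hπ'⟩ := AInf.exists_isProj_cohomology hπ X.d (AInf.typ s) X.d_mem
  have hgrH := hπ'.isInternal
  obtain ⟨eV, hV⟩ := AInf.exists_isGrading hgrH
  obtain ⟨eW, hW⟩ := AInf.exists_isGrading hgr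
  have lift : ∀ (D : AInf.FormalDeformation H) (F : AInf.DeformationHom D Xh),
      F.base = f → F.IsQuasiIso := fun D F h => F.isQuasiIso_of_base hgrH hgr (h ▸ hf)
  refine ⟨?_, lift, ?_, fun e eH _ hXh hH hfu => ⟨?_, ?_⟩⟩
  -- Without units there are no constrained lists, and the corrections need no projection.
  · obtain ⟨D, F, hF, -⟩ := AInf.exists_deformation (hV := hV) (hW := hW) (Z := fun _ => False) Xh
      hgrH hgr hmin hf (fun _ _ _ _ h => h.elim) (P := LinearMap.id) (fun _ _ h => h)
      (fun _ _ _ _ => by simp) (fun _ h => h.elim)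
    exact ⟨D, F, hF, lift D F hF⟩
  · intro D D' F F' hF hF'
    obtain ⟨G, -, hG, -⟩ := AInf.exists_deformation_refl (hV := hV) (hW := hW)
      (Z := fun _ => False) hgrH hgr hmin (F := F) (F' := F') (hF ▸ hf) (hF'.trans hF.symm)
      (fun _ _ _ _ h => h.elim) (P := LinearMap.id) (fun _ _ h => h) (fun _ _ _ _ => by simp)
      (fun _ h => h.elim)
    exact ⟨G, G.isQuasiIso_of_base hgrH hgrH (hG ▸ AInf.Hom.isQuasiIso_refl H hV)⟩
  · obtain ⟨D, F, hD, hF, hb⟩ := AInf.exists_unital_deformation hgrH hgr hmin hf eH e hXh hH hfu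
    exact ⟨D, F, hD, hF, hb, lift D F hb⟩
  · intro D D' F F' hD _ hF hF' hb hb'
    obtain ⟨G, hG, hGu⟩ := AInf.exists_unital_deformation_refl hgrH hgr hmin (hb ▸ hf)
      (hb'.trans hb.symm) eH e hXh hH hD hF hF'
    exact ⟨G, hGu, G.isQuasiIso_of_base hgrH hgrH hG⟩
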